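/- Let $\gamma\in(1,\frac43)$, $G(y;\rho,\omega)=\gamma\rho^{\gamma-1}-y^2\omega^2$ and $h(\rho,\omega)=2\omega^2+(\gamma-1)\omega-\frac{4\pi\rho\omega}{4-3\gamma}+(\gamma-1)(2-\gamma)$, and consider the self-similar Euler–Poisson system $$\rho'=\frac{y\rho h(\rho,\omega)}{G(y;\rho,\omega)},\qquad \omega'=\frac{4-3\gamma-3\omega}{y}-\frac{y\omega h(\rho,\omega)}{G(y;\rho,\omega)}.\qquad(*)$$ Let $y_f=\frac{\sqrt\gamma}{2-\gamma}\big(\frac{4-3\gamma}{2\pi}\big)^{\frac{\gamma-1}2}$ and $y_F=\frac{3}{4-3\gamma}\sqrt{\frac{\gamma}{(6\pi)^{\gamma-1}}}$. For $y_*\in[y_f,y_F]$, a solution of LPH type at $y_*$ is a pair $(\rho,\omega)$ of functions, real analytic at $y_*$, which solves $(*)$ (multiplied by $G$) near $y_*$ and satisfies, with $\rho_0=\rho(y_*)>0$ and $\omega_0=\omega(y_*)$, $$G(y_*;\rho_0,\omega_0)=0,\quad h(\rho_0,\omega_0)=0,\quad \rho'(y_*)=\frac{\rho_0R_1}{y_*},\quad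 \omega'(y_*)=\frac{W_1}{y_*},$$ where $$R_1=\frac{(9-7\gamma)\omega_0^2-8\omega_0^3-\sqrt{\omega_0^3s(\omega_0)}}{2\omega_0^3(\gamma+1)},\qquad W_1=4-3\gamma-3\omega_0-\omega_0R_1,$$ $$s(\omega_0)=-4(4-3\gamma)(\gamma+1)(\gamma-1)(2-\gamma)+(57-114\gamma+73\gamma^2-12\gamma^3)\omega_0-8(3\gamma^2-15\gamma+14)\omega_0^2+8(5-3\gamma)\omega_0^3.$$ Let $s(y_*)$ be the infimum of all $y\in(0,y_*)$ such that the solution of LPH type at $y_*$ extends to $(y,y_*]$ as a solution of $(*)$ on $(y,y_*)$ with $G>0$ there, and let $(\rho(\cdot;y_*),\omega(\cdot;y_*))$ be its extension to $(s(y_*),y_*]$. Let $Y$ be the set of all $y_*\in[y_f,y_F)$ such that for every $\tilde y_*\in[y_*,y_F)$ there is $y\in(s(\tilde y_*),\tilde y_*)$ with $\omega(y;\tilde y_*)=\frac{4-3\gamma}3$, and let $\bar y_*=\inf Y$. Then $\bar y_*>0$ and $s(\bar y_*)=0$, so that the critical solution $(\rho,\omega)=(\rho(\cdot;\bar y_*),\omega(\cdot;\bar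 y_*))$ exists on $(0,\bar y_*]$, and it has the following properties. 1. $\omega'(y)>0$ for all $y\in(0,\bar y_*)$, and $\lim_{y\to0^+}\omega(y)=\frac{4-3\gamma}{3}=:\omega(0)$. 2. $\rho'(y)<0$ for all $y\in(0,\bar y_*)$, and $\rho(y)$ converges, as $y\to0^+$, to a finite limit $\rho(0)>\frac1{6\pi}$. 3. $\lim_{y\to0^+}\rho'(y)=\lim_{y\to0^+}\omega'(y)=0$, and the functions $\rho$, $\omega$, extended to $y=0$ by $\rho(0)$, $\omega(0)$, have one-sided derivatives $\rho'(0)=\omega'(0)=0$. 4. The function $\rho$, so extended, is $C^2$ on $[0,\bar y_*]$. -/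

import Mathlib

open Set Filter Topology

noncomputable section

namespace SelfSimilarEP

/-- The sonic function `G(y; ρ, ω) = γ ρ^(γ-1) - y² ω²`. -/
def G (γ y ρ ω : ℝ) : ℝ := γ * ρ ^ (γ - 1) - y ^ 2 * ω ^ 2

/-- `h(ρ, ω) = 2ω² + (γ-1)ω - 4πρω/(4-3γ) + (γ-1)(2-γ)`. -/
def h (γ ρ ω : ℝ) : ℝ :=
  2 * ω ^ 2 + (γ - 1) * ω - 4 * Real.pi * ρ * ω / (4 - 3 * γ) + (γ - 1) * (2 - γ)

/-- The Friedman value of the relative velocity. -/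
def omegaF (γ : ℝ) : ℝ := (4 - 3 * γ) / 3

/-- The sonic point of the far-field solution. -/
def yf (γ : ℝ) : ℝ :=
  Real.sqrt γ / (2 - γ) * ((4 - 3 * γ) / (2 * Real.pi)) ^ ((γ - 1) / 2)

/-- The sonic point of the Friedman solution. -/
def yF (γ : ℝ) : ℝ :=
  3 / (4 - 3 * γ) * Real.sqrt (γ / (6 * Real.pi) ^ (γ - 1))

/-- The self-similar Euler-Poisson system
`ρ' = y ρ h / G`, `ω' = (4 - 3γ - 3ω)/y - y ω h / G` at the point `y`. -/
def SolvesAt (γ : ℝ) (ρ ω : ℝ → ℝ) (y : ℝ) : Prop :=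
  HasDerivAt ρ (y * ρ y * h γ (ρ y) (ω y) / G γ y (ρ y) (ω y)) y ∧
  HasDerivAt ω ((4 - 3 * γ - 3 * ω y) / y
    - y * ω y * h γ (ρ y) (ω y) / G γ y (ρ y) (ω y)) y

/-- The system at the point `y`, multiplied through by `G` so that it makes sense at sonic
points as well. -/
def SolvesMulAt (γ : ℝ) (ρ ω : ℝ → ℝ) (y : ℝ) : Prop :=
  G γ y (ρ y) (ω y) * deriv ρ y = y * ρ y * h γ (ρ y) (ω y) ∧
  G γ y (ρ y) (ω y) * deriv ω y
    = (4 - 3 * γ - 3 * ω y) / y * G γ y (ρ y) (ω y) - y * ω y * h γ (ρ y) (ω y)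

/-- The discriminant polynomial `s(ω₀)` of the quadratic equation for `R = y⋆ ρ₁ / ρ₀`. -/
def branchDisc (γ w : ℝ) : ℝ :=
  -4 * (4 - 3 * γ) * (γ + 1) * (γ - 1) * (2 - γ)
    + (57 - 114 * γ + 73 * γ ^ 2 - 12 * γ ^ 3) * w
    - 8 * (3 * γ ^ 2 - 15 * γ + 14) * w ^ 2
    + 8 * (5 - 3 * γ) * w ^ 3

/-- The value `R₁` of `y⋆ ρ₁ / ρ₀` on the Larson-Penston-Hunter branch (the smaller root). -/
def R1 (γ w : ℝ) : ℝ :=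
  ((9 - 7 * γ) * w ^ 2 - 8 * w ^ 3 - Real.sqrt (w ^ 3 * branchDisc γ w))
    / (2 * w ^ 3 * (γ + 1))

/-- The value `W₁` of `y⋆ ω₁` on the Larson-Penston-Hunter branch. -/
def W1 (γ w : ℝ) : ℝ := 4 - 3 * γ - 3 * w - w * R1 γ w

/-- `(ρ, ω)` is of Larson-Penston-Hunter type at the sonic point `ys`: both functions are real
analytic at `ys`, the zeroth order Taylor coefficients satisfy the two sonic constraints, the
first order ones are those of the branch `(R₁, W₁)`, and the system holds near `ys`, that is,
order by order in `y - ys` (this is the recursion for the higher coefficients). -/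
structure IsLPHType (γ ys : ℝ) (ρ ω : ℝ → ℝ) : Prop where
  analytic_rho : AnalyticAt ℝ ρ ys
  analytic_omega : AnalyticAt ℝ ω ys
  rho_pos : 0 < ρ ys
  sonic : G γ ys (ρ ys) (ω ys) = 0
  constraint : h γ (ρ ys) (ω ys) = 0
  deriv_rho : deriv ρ ys = ρ ys * R1 γ (ω ys) / ys
  deriv_omega : deriv ω ys = W1 γ (ω ys) / ys
  solves : ∀ᶠ y in 𝓝 ys, SolvesMulAt γ ρ ω y

/-- `(ρ, ω)` is an extension onto `(a, ys]` of the solution of Larson-Penston-Hunter type at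
`ys`, which is subsonic on `(a, ys)`. -/
structure IsSubsonicExtension (γ ys a : ℝ) (ρ ω : ℝ → ℝ) : Prop where
  lph : IsLPHType γ ys ρ ω
  solves : ∀ y ∈ Ioo a ys, SolvesAt γ ρ ω y
  subsonic : ∀ y ∈ Ioo a ys, 0 < G γ y (ρ y) (ω y)

/-- The sonic time `s(ys)`. -/
def sonicTime (γ ys : ℝ) : ℝ :=
  sInf {y | y ∈ Ioo 0 ys ∧ ∃ ρ ω : ℝ → ℝ, IsSubsonicExtension γ ys y ρ ω}

/-- `(ρ, ω)` is the solution `(ρ(·; ys), ω(·; ys))`, extended to its maximal interval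
`(s(ys), ys]`. Values outside a neighbourhood of this interval are irrelevant. -/
def IsMaximalLPH (γ ys : ℝ) (ρ ω : ℝ → ℝ) : Prop :=
  IsSubsonicExtension γ ys (sonicTime γ ys) ρ ω

/-- The fundamental set `Y`: all `ys ∈ [y_f, y_F)` such that for every `yt ∈ [ys, y_F)` the
function `ω(·; yt)` attains the Friedman value on `(s(yt), yt)`. -/
def fundamentalSet (γ : ℝ) : Set ℝ :=
  {ys | ys ∈ Ico (yf γ) (yF γ) ∧ ∀ yt ∈ Ico ys (yF γ),
    ∃ ρ ω : ℝ → ℝ, IsMaximalLPH γ yt ρ ω ∧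
      ∃ y ∈ Ioo (sonicTime γ yt) yt, ω y = omegaF γ}

/-- The critical sonic point `inf Y`. -/
def criticalPoint (γ : ℝ) : ℝ := sInf (fundamentalSet γ)

end SelfSimilarEP

end

noncomputable section

namespace SelfSimilarEP

/-! ### The sonic curve and the quadratic equation for the slope -/

/-! In logarithmic time t = log(y/y_*), with R = yρ'/ρ, W = yω' and q = γρ^(γ-1)/y², the system
becomes autonomous in (ρ, ω, q): ρ' = ρR, ω' = W = 4-3γ-3ω-ωR, q' = q((γ-1)R-2), where (q-ω²)R = h.
A sonic point is determined by its velocity w = ω(y_*), and `yS` maps [ω_F, 2-γ] decreasingly onto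
[y_f, y_F], where ω_F = (4-3γ)/3 (`yS_strictAnti`, `exists_yS_eq`). The proof is a shooting argument
in w.

Local theory. At a sonic point R is a root of a quadratic, and R₁ is the smaller root.
Differentiating the constraint gives (q-ω²)R' = `excess`. On this branch the gap q-ω² has negative
derivative while `excess` increases in R, so the recursion for the Taylor coefficients of R has no
resonance, uniformly in w. The implicit function theorem in a Banach algebra of power series with
coefficients continuous in w then gives a family of analytic solutions jointly continuous in (w, t)
(`exists_sonic_family`). The same two signs give uniqueness to the left of the sonic point
(`SonicGerm.eventually_eq`), so every solution of LPH type is a member of the family.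

Shooting. For w < 2-γ one has W > 0 at the sonic point, so ω decreases as t does. Say that w crosses
if ω falls below ω_F while W is still positive. This is an open condition (`eventually_crosses`),
and it holds at w = ω_F. It fails for some w close to 2-γ: such an orbit follows the explicit
far-field solution ω = 2-γ for a long time, and there p = W/(ω-(2-γ)) ≤ 0 would satisfy p' ≤
-δ(1+p²), which cannot last longer than π/δ (`exists_not_crosses`). Hence there is a first
non-crossing w, and it is smaller than 2-γ.

The critical orbit. If the orbit of this w had a first time (going backwards) with W = 0, then ω >
ω_F there, by uniqueness of the Friedman solution, and ω'' > 0 (`accel_pos`). So W would become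
negative while ω > ω_F, and nearby orbits could not cross, although w is a limit of crossing values.
If ω reached ω_F with W > 0, then w itself would cross. Monotone quantities exclude blow-up at
finite t (`exists_compact`). Thus W > 0 and ω_F < ω < w for all t < 0 (`exists_global`). It follows
that Y is the open interval from `yS γ w` to y_F, and that the critical solution lives on all of (0,
inf Y].

The origin. W > 0 means 3(ω-ω_F) < ω·(-R), so everything follows from decay of R. From the growth of
ρω one gets -R ≤ C y^ε with ε > 0 because w < 2-γ. Hence ω → ω_F, and a bootstrap gives -R ≤ C y²
and bounded ρ (`eventually_neg_slope_le_sq`). Quadratic convergence of ρ and ω, vanishing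
derivatives and the C² property follow. The limit ρ(0) = 1/(6π) is excluded because it would make -R
too small for W > 0 (`lt_limit`). -/

/-- The density at a sonic point where the relative velocity is `w`. -/
def rhoS (γ w : ℝ) : ℝ :=
  (4 - 3 * γ) / (4 * Real.pi) * (2 * w + (γ - 1) + (γ - 1) * (2 - γ) / w)

/-- The sonic point at which the relative velocity is `w`. -/
def yS (γ w : ℝ) : ℝ := Real.sqrt (γ * rhoS γ w ^ (γ - 1)) / w

/-- The logarithmic derivative `y ω'`, as a function of `ω` and `R = y ρ' / ρ`. -/
def relVel (γ ω R : ℝ) : ℝ := 4 - 3 * γ - 3 * ω - ω * R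

/-- The derivative of `q - ω²` in logarithmic time. -/
def gRate (γ ω q R : ℝ) : ℝ := q * ((γ - 1) * R - 2) - 2 * ω * relVel γ ω R

/-- The derivative of `h` in logarithmic time. -/
def hRate (γ ρ ω R : ℝ) : ℝ :=
  -(4 * Real.pi / (4 - 3 * γ)) * ρ * ω * R
    + (4 * ω + (γ - 1) - 4 * Real.pi / (4 - 3 * γ) * ρ) * relVel γ ω R

/-- The right-hand side of `(q - ω²) R' = excess`. -/
def excess (γ ρ ω q R : ℝ) : ℝ := hRate γ ρ ω R - gRate γ ω q R * R

/-- The divided difference of `excess` in its last variable. -/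
def excessSlope (γ ρ ω q R R' : ℝ) : ℝ :=
  -(4 * Real.pi / (4 - 3 * γ)) * ρ * ω
    - (4 * ω + (γ - 1) - 4 * Real.pi / (4 - 3 * γ) * ρ) * ω
    + 2 * q + 2 * ω * (4 - 3 * γ - 3 * ω) - (q * (γ - 1) + 2 * ω ^ 2) * (R + R')

/-- For a fixed state `excess` is quadratic in R, so its divided difference is affine in R + R'. The
uniqueness proof uses this to compare two slopes over the same state. -/
theorem excess_sub (γ ρ ω q R R' : ℝ) :
    excess γ ρ ω q R - excess γ ρ ω q R' = (R - R') * excessSlope γ ρ ω q R R' := by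
  unfold excess excessSlope hRate gRate relVel
  ring

section Sonic

variable {γ w : ℝ}

theorem omegaF_pos (hγ : γ ∈ Ioo (1 : ℝ) (4 / 3)) : 0 < omegaF γ := by
  unfold omegaF; linarith [hγ.2]

theorem omegaF_lt (hγ : γ ∈ Ioo (1 : ℝ) (4 / 3)) : omegaF γ < 2 - γ := by
  unfold omegaF; linarith [hγ.2]

theorem rhoS_pos (hγ : γ ∈ Ioo (1 : ℝ) (4 / 3)) (hw : 0 < w) : 0 < rhoS γ w := by
  obtain ⟨h1, h2⟩ := hγ
  have hα : 0 < 4 - 3 * γ := by linarith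
  have h3 : 0 < γ - 1 := by linarith
  have h4 : 0 < 2 - γ := by linarith
  unfold rhoS
  have := Real.pi_pos
  positivity

theorem rhoS_mul (hγ : γ ∈ Ioo (1 : ℝ) (4 / 3)) (hw : w ≠ 0) :
    4 * Real.pi / (4 - 3 * γ) * rhoS γ w * w = 2 * w ^ 2 + (γ - 1) * w + (γ - 1) * (2 - γ) := by
  have hα : 4 - 3 * γ ≠ 0 := by linarith [hγ.2]
  have := Real.pi_ne_zero
  unfold rhoS
  field_simp

theorem h_eq (γ ρ ω : ℝ) : h γ ρ ω = 2 * ω ^ 2 + (γ - 1) * ω + (γ - 1) * (2 - γ)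
    - 4 * Real.pi / (4 - 3 * γ) * ρ * ω := by
  unfold h; ring

theorem h_rhoS (hγ : γ ∈ Ioo (1 : ℝ) (4 / 3)) (hw : w ≠ 0) : h γ (rhoS γ w) w = 0 := by
  rw [h_eq, rhoS_mul hγ hw]; ring

/-- The discriminant of the quadratic equation for the slope, in terms of `branchDisc`. -/
theorem disc_eq (γ w : ℝ) : w ^ 3 * branchDisc γ w =
    (8 * w ^ 3 - (9 - 7 * γ) * w ^ 2) ^ 2
      - 4 * (γ + 1) * w ^ 3 * ((2 * w ^ 2 - (γ - 1) * (2 - γ)) * (3 * w - (4 - 3 * γ))) := by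
  unfold branchDisc; ring

theorem mul_excess_sonic (hγ : γ ∈ Ioo (1 : ℝ) (4 / 3)) (hw : w ≠ 0) (R : ℝ) :
    w * excess γ (rhoS γ w) w (w ^ 2) R = -((γ + 1) * w ^ 3 * R ^ 2
      + (8 * w ^ 3 - (9 - 7 * γ) * w ^ 2) * R
      + (2 * w ^ 2 - (γ - 1) * (2 - γ)) * (3 * w - (4 - 3 * γ))) := by
  have e := rhoS_mul hγ hw
  have : w * excess γ (rhoS γ w) w (w ^ 2) R =
      -(4 * Real.pi / (4 - 3 * γ) * rhoS γ w * w) * w * R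
      + (4 * w ^ 2 + (γ - 1) * w - 4 * Real.pi / (4 - 3 * γ) * rhoS γ w * w) * relVel γ w R
      - w * (gRate γ w (w ^ 2) R * R) := by
    unfold excess hRate; ring
  rw [this, e]
  unfold gRate relVel
  ring

/-- The distance of the point `W = 0` from the vertex of the quadratic. -/
theorem vertex_sq (γ w : ℝ) :
    (2 * (γ + 1) * w ^ 2 * (4 - 3 * γ - 3 * w) + (8 * w ^ 3 - (9 - 7 * γ) * w ^ 2)) ^ 2
      = w ^ 3 * branchDisc γ w + 4 * (γ + 1) * w ^ 3 *
        ((3 * w - (4 - 3 * γ)) * (γ - 1) * ((w - (2 - γ)) * (3 * w + 1))) := by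
  rw [disc_eq]; ring

/-- Inside the interval `vertex_sq` exhibits the discriminant as a square plus a positive multiple
of (3w-(4-3γ))(2-γ-w). At either endpoint this product vanishes, and the remaining square is
nonzero. -/
theorem disc_pos (hγ : γ ∈ Ioo (1 : ℝ) (4 / 3)) (hw : w ∈ Icc (omegaF γ) (2 - γ)) :
    0 < w ^ 3 * branchDisc γ w := by
  have hw0 : 0 < w := (omegaF_pos hγ).trans_le hw.1
  obtain ⟨h1, h2⟩ := hγ
  have hF : 4 - 3 * γ ≤ 3 * w := by have := hw.1; unfold omegaF at this; linarith
  have h3 : 0 < γ - 1 := by linarith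
  rcases hF.eq_or_lt with h | h
  · rw [disc_eq, ← h]
    have : 8 * w ^ 3 - (9 - 7 * γ) * w ^ 2 = w ^ 2 * ((5 - 3 * γ) / 3) := by
      have : w = (4 - 3 * γ) / 3 := by linarith
      subst this; ring
    rw [this]
    have : 0 < 5 - 3 * γ := by linarith
    have : 0 < w ^ 2 * ((5 - 3 * γ) / 3) := by positivity
    nlinarith
  · rcases hw.2.eq_or_lt with h' | h'
    · have e := vertex_sq γ w
      rw [h'] at e ⊢
      have : (2 * (γ + 1) * (2 - γ) ^ 2 * (4 - 3 * γ - 3 * (2 - γ))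
        + (8 * (2 - γ) ^ 3 - (9 - 7 * γ) * (2 - γ) ^ 2)) = -((2 - γ) ^ 2 * (5 * γ - 3)) := by ring
      rw [this] at e
      have h4 : 0 < 2 - γ := by linarith
      have h5 : 0 < 5 * γ - 3 := by linarith
      have : 0 < (2 - γ) ^ 2 * (5 * γ - 3) := by positivity
      nlinarith
    · have e := vertex_sq γ w
      have h4 : 0 < 2 - γ - w := by linarith
      have h5 : 0 < 3 * w - (4 - 3 * γ) := by linarith
      have : 0 < 4 * (γ + 1) * w ^ 3 *
        ((3 * w - (4 - 3 * γ)) * (γ - 1) * ((2 - γ - w) * (3 * w + 1))) := by positivity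
      nlinarith [sq_nonneg (2 * (γ + 1) * w ^ 2 * (4 - 3 * γ - 3 * w)
        + (8 * w ^ 3 - (9 - 7 * γ) * w ^ 2))]

theorem two_mul_R1 (hγ : γ ∈ Ioo (1 : ℝ) (4 / 3)) (hw : 0 < w) :
    2 * (γ + 1) * w ^ 3 * R1 γ w
      = -(8 * w ^ 3 - (9 - 7 * γ) * w ^ 2) - Real.sqrt (w ^ 3 * branchDisc γ w) := by
  have : γ + 1 ≠ 0 := by linarith [hγ.1]
  unfold R1
  field_simp
  ring

theorem excess_R1 (hγ : γ ∈ Ioo (1 : ℝ) (4 / 3)) (hw : w ∈ Icc (omegaF γ) (2 - γ)) :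
    excess γ (rhoS γ w) w (w ^ 2) (R1 γ w) = 0 := by
  have hw0 : 0 < w := (omegaF_pos hγ).trans_le hw.1
  have e1 := two_mul_R1 hγ hw0
  have e2 := Real.sq_sqrt (disc_pos hγ hw).le
  have e3 := disc_eq γ w
  have h3 : 0 < γ + 1 := by linarith [hγ.1]
  have e4 := mul_excess_sonic hγ hw0.ne' (R1 γ w)
  have : w * excess γ (rhoS γ w) w (w ^ 2) (R1 γ w) * (4 * (γ + 1) * w ^ 3) = 0 := by
    rw [e4]
    have : Real.sqrt (w ^ 3 * branchDisc γ w) = -(8 * w ^ 3 - (9 - 7 * γ) * w ^ 2)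
      - 2 * (γ + 1) * w ^ 3 * R1 γ w := by linarith
    rw [this, e3] at e2
    linear_combination -e2
  have h4 : 4 * (γ + 1) * w ^ 3 ≠ 0 := by positivity
  have := (mul_eq_zero.mp this).resolve_right h4
  exact (mul_eq_zero.mp this).resolve_left hw0.ne'

/-- As a quadratic in R, `excess` has negative leading coefficient at the sonic point, so it
increases at its smaller root. Times w, the derivative there is exactly the square root of the
discriminant. -/
theorem excessSlope_R1_pos (hγ : γ ∈ Ioo (1 : ℝ) (4 / 3)) (hw : w ∈ Icc (omegaF γ) (2 - γ)) :
    0 < excessSlope γ (rhoS γ w) w (w ^ 2) (R1 γ w) (R1 γ w) := by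
  have hw0 : 0 < w := (omegaF_pos hγ).trans_le hw.1
  have e1 := two_mul_R1 hγ hw0
  have e := rhoS_mul hγ hw0.ne'
  have h5 := Real.sqrt_pos.mpr (disc_pos hγ hw)
  have : w * excessSlope γ (rhoS γ w) w (w ^ 2) (R1 γ w) (R1 γ w)
      = Real.sqrt (w ^ 3 * branchDisc γ w) := by
    have : w * excessSlope γ (rhoS γ w) w (w ^ 2) (R1 γ w) (R1 γ w) =
      -(4 * Real.pi / (4 - 3 * γ) * rhoS γ w * w) * w
      - (4 * w ^ 2 + (γ - 1) * w - (4 * Real.pi / (4 - 3 * γ) * rhoS γ w * w)) * w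
      + 2 * w ^ 3 + 2 * w ^ 2 * (4 - 3 * γ - 3 * w)
      - (w ^ 3 * (γ - 1) + 2 * w ^ 3) * (R1 γ w + R1 γ w) := by
      unfold excessSlope; ring
    rw [this, e]
    linear_combination -e1
  rw [← this] at h5
  exact pos_of_mul_pos_right h5 hw0.le

/-- The exact value 2w·`gRate` = -√(w³s(w)) - (7-5γ)w² is negative since γ < 4/3 < 7/5. So q-ω²
turns positive to the left of the sonic point. Together with `excessSlope_R1_pos` this rules out
resonances. -/
theorem gRate_R1_neg (hγ : γ ∈ Ioo (1 : ℝ) (4 / 3)) (hw : w ∈ Icc (omegaF γ) (2 - γ)) :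
    gRate γ w (w ^ 2) (R1 γ w) < 0 := by
  have hw0 : 0 < w := (omegaF_pos hγ).trans_le hw.1
  have e1 := two_mul_R1 hγ hw0
  have h5 := Real.sqrt_pos.mpr (disc_pos hγ hw)
  have : 2 * w * gRate γ w (w ^ 2) (R1 γ w)
      = -Real.sqrt (w ^ 3 * branchDisc γ w) - w ^ 2 * (7 - 5 * γ) := by
    unfold gRate relVel
    linear_combination e1
  have h6 : 0 < w ^ 2 * (7 - 5 * γ) := by
    have : 0 < 7 - 5 * γ := by linarith [hγ.2]
    positivity
  nlinarith

/-- W vanishes at R = (4-3γ-3w)/w. By `vertex_sq` this value lies strictly between the two roots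
when ω_F < w < 2-γ. Since W decreases in R, it is positive at the smaller root. At w = ω_F the
vertex term itself is positive. -/
theorem relVel_R1_pos (hγ : γ ∈ Ioo (1 : ℝ) (4 / 3)) (hw : w ∈ Ico (omegaF γ) (2 - γ)) :
    0 < relVel γ w (R1 γ w) := by
  have hw0 : 0 < w := (omegaF_pos hγ).trans_le hw.1
  have e1 := two_mul_R1 hγ hw0
  have hd := disc_pos hγ ⟨hw.1, hw.2.le⟩
  have h5 := Real.sqrt_pos.mpr hd
  have hF : 4 - 3 * γ ≤ 3 * w := by have := hw.1; unfold omegaF at this; linarith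
  have h1 := hγ.1
  have h2 := hγ.2
  have e := vertex_sq γ w
  set X := 2 * (γ + 1) * w ^ 2 * (4 - 3 * γ - 3 * w) + (8 * w ^ 3 - (9 - 7 * γ) * w ^ 2) with hX
  have e2 := Real.sq_sqrt hd.le
  have key : 0 < X + Real.sqrt (w ^ 3 * branchDisc γ w) := by
    rcases hF.eq_or_lt with h | h
    · have : X = w ^ 2 * ((5 - 3 * γ) / 3) := by
        have : w = (4 - 3 * γ) / 3 := by linarith
        rw [hX, this]; ring
      have h3 : 0 < 5 - 3 * γ := by linarith
      rw [this]; positivity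
    · have h4 : 0 < 2 - γ - w := by linarith [hw.2]
      have h6 : 0 < 3 * w - (4 - 3 * γ) := by linarith
      have h7 : 0 < γ - 1 := by linarith
      have : 0 < 4 * (γ + 1) * w ^ 3 *
        ((3 * w - (4 - 3 * γ)) * (γ - 1) * ((2 - γ - w) * (3 * w + 1))) := by positivity
      have : X ^ 2 < Real.sqrt (w ^ 3 * branchDisc γ w) ^ 2 := by rw [e2]; nlinarith
      have := abs_lt_of_sq_lt_sq this h5.le
      linarith [(abs_lt.mp (by simpa using this)).1]
  have h8 : 2 * (γ + 1) * w ^ 2 * relVel γ w (R1 γ w)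
      = X + Real.sqrt (w ^ 3 * branchDisc γ w) := by
    rw [hX]; unfold relVel; linear_combination -e1
  rw [← h8] at key
  have : 0 < 2 * (γ + 1) * w ^ 2 := by have : 0 < γ + 1 := by linarith
                                       positivity
  exact pos_of_mul_pos_right key this.le

/-- At w = 2-γ the branch gives the slope of the explicit far-field solution, for which W = 0. This
is the reason the shooting interval ends there. -/
theorem R1_far (hγ : γ ∈ Ioo (1 : ℝ) (4 / 3)) : R1 γ (2 - γ) = -2 / (2 - γ) := by
  have h4 : 0 < 2 - γ := by linarith [hγ.2]
  have h5 : 0 < 5 * γ - 3 := by linarith [hγ.1]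
  have h6 : 0 < γ + 1 := by linarith [hγ.1]
  have e := two_mul_R1 hγ h4
  have : (2 - γ) ^ 3 * branchDisc γ (2 - γ) = ((2 - γ) ^ 2 * (5 * γ - 3)) ^ 2 := by
    have := vertex_sq γ (2 - γ)
    linear_combination -this
  rw [this, Real.sqrt_sq (by positivity)] at e
  have h7 : 2 * (γ + 1) * (2 - γ) ^ 3 ≠ 0 := by positivity
  apply mul_left_cancel₀ h7
  rw [e]
  field_simp
  ring

theorem continuousOn_rhoS (γ : ℝ) : ContinuousOn (rhoS γ) (Ioi 0) := by
  unfold rhoS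
  refine continuousOn_const.mul ((by fun_prop : ContinuousOn _ _).add ?_)
  exact continuousOn_const.div continuousOn_id fun x hx => (ne_of_gt hx)

theorem continuousOn_R1 (hγ : γ ∈ Ioo (1 : ℝ) (4 / 3)) : ContinuousOn (R1 γ) (Ioi 0) := by
  have : γ + 1 ≠ 0 := by linarith [hγ.1]
  unfold R1 branchDisc
  refine ContinuousOn.div (by fun_prop) (by fun_prop) fun x hx => ?_
  have : x ≠ 0 := ne_of_gt hx
  positivity

theorem rhoS_omegaF (hγ : γ ∈ Ioo (1 : ℝ) (4 / 3)) : rhoS γ (omegaF γ) = 1 / (6 * Real.pi) := by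
  have hα : 4 - 3 * γ ≠ 0 := by linarith [hγ.2]
  have := Real.pi_ne_zero
  unfold rhoS omegaF
  field_simp
  ring

theorem rhoS_far (hγ : γ ∈ Ioo (1 : ℝ) (4 / 3)) :
    rhoS γ (2 - γ) = (4 - 3 * γ) / (2 * Real.pi) := by
  have hα : 2 - γ ≠ 0 := by linarith [hγ.2]
  have := Real.pi_ne_zero
  unfold rhoS
  field_simp
  ring

theorem yS_pos (hγ : γ ∈ Ioo (1 : ℝ) (4 / 3)) (hw : 0 < w) : 0 < yS γ w := by
  have := rhoS_pos hγ hw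
  have : 0 < γ := by linarith [hγ.1]
  unfold yS
  positivity

theorem yS_sq (hγ : γ ∈ Ioo (1 : ℝ) (4 / 3)) (hw : 0 < w) :
    yS γ w ^ 2 * w ^ 2 = γ * rhoS γ w ^ (γ - 1) := by
  have := rhoS_pos hγ hw
  have : 0 < γ := by linarith [hγ.1]
  unfold yS
  rw [div_pow, Real.sq_sqrt (by positivity)]
  field_simp

/-- Write `yS`² = γ(ρ/w)^(γ-1) · w^(γ-3), where ρ is the sonic density. Dividing `rhoS` by w leaves
a constant plus negative powers of w, so ρ/w decreases in w, and γ-3 is negative. -/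
theorem yS_strictAnti (hγ : γ ∈ Ioo (1 : ℝ) (4 / 3)) : StrictAntiOn (yS γ) (Ioi 0) := by
  intro x hx y hy hxy
  have hx : 0 < x := hx
  have hy : 0 < y := hy
  have hx2 := rhoS_pos hγ hx
  have hy2 := rhoS_pos hγ hy
  have h0 : 0 < γ := by linarith [hγ.1]
  have h1 : 0 < γ - 1 := by linarith [hγ.1]
  have h2 : 0 < 2 - γ := by linarith [hγ.2]
  have h3 : 0 < 4 - 3 * γ := by linarith [hγ.2]
  have hpi := Real.pi_pos
  have key : rhoS γ y / y < rhoS γ x / x := by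
    have e : ∀ z : ℝ, 0 < z → rhoS γ z / z = (4 - 3 * γ) / (4 * Real.pi) *
        (2 + (γ - 1) / z + (γ - 1) * (2 - γ) / z ^ 2) := by
      intro z hz; unfold rhoS; field_simp
    rw [e x hx, e y hy]
    have : (γ - 1) / y < (γ - 1) / x := by gcongr
    have : (γ - 1) * (2 - γ) / y ^ 2 < (γ - 1) * (2 - γ) / x ^ 2 := by gcongr
    gcongr
  have e : ∀ z : ℝ, 0 < z → yS γ z ^ 2 = γ * (rhoS γ z / z) ^ (γ - 1) * z ^ (γ - 3) := by
    intro z hz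
    have hz2 := rhoS_pos hγ hz
    have := yS_sq hγ hz
    rw [Real.div_rpow hz2.le hz.le, show γ - 3 = (γ - 1) - 2 by ring, Real.rpow_sub hz (γ - 1) 2]
    have h5 : z ^ (2 : ℝ) = z ^ 2 := by norm_cast
    rw [h5]
    have : 0 < z ^ (γ - 1) := by positivity
    field_simp
    linarith
  have : yS γ y ^ 2 < yS γ x ^ 2 := by
    rw [e x hx, e y hy]
    have a1 : (rhoS γ y / y) ^ (γ - 1) < (rhoS γ x / x) ^ (γ - 1) :=
      Real.rpow_lt_rpow (by positivity) key h1
    have a2 : y ^ (γ - 3) < x ^ (γ - 3) :=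
      Real.rpow_lt_rpow_of_neg hx hxy (by linarith)
    gcongr
  exact lt_of_pow_lt_pow_left₀ 2 (yS_pos hγ hx).le this

theorem continuousOn_yS (hγ : γ ∈ Ioo (1 : ℝ) (4 / 3)) : ContinuousOn (yS γ) (Ioi 0) := by
  unfold yS
  refine ContinuousOn.div (ContinuousOn.sqrt (continuousOn_const.mul ?_)) continuousOn_id
    fun x hx => ne_of_gt hx
  exact (continuousOn_rhoS γ).rpow_const fun x hx => Or.inl (rhoS_pos hγ hx).ne'

theorem yS_omegaF (hγ : γ ∈ Ioo (1 : ℝ) (4 / 3)) : yS γ (omegaF γ) = yF γ := by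
  have hα : 0 < 4 - 3 * γ := by linarith [hγ.2]
  unfold yS yF
  rw [rhoS_omegaF hγ, one_div, Real.inv_rpow (by positivity), ← div_eq_mul_inv]
  unfold omegaF
  field_simp

theorem yS_far (hγ : γ ∈ Ioo (1 : ℝ) (4 / 3)) : yS γ (2 - γ) = yf γ := by
  have hα : 0 < 4 - 3 * γ := by linarith [hγ.2]
  have h0 : 0 < γ := by linarith [hγ.1]
  unfold yS yf
  rw [rhoS_far hγ, Real.sqrt_mul h0.le, Real.sqrt_eq_rpow ((_ : ℝ) ^ (γ - 1)),
    ← Real.rpow_mul (by positivity)]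
  ring_nf

/-- The velocity and the density at a sonic point are determined by the sonic point. -/
theorem eq_sonic {y ρ ω : ℝ} (hγ : γ ∈ Ioo (1 : ℝ) (4 / 3)) (hy : 0 < y) (hρ : 0 < ρ)
    (hG : G γ y ρ ω = 0) (hh : h γ ρ ω = 0) : 0 < ω ∧ ρ = rhoS γ ω ∧ y = yS γ ω := by
  have h1 := hγ.1
  have h2 := hγ.2
  have hα : 0 < 4 - 3 * γ := by linarith
  have hpi := Real.pi_pos
  rw [h_eq] at hh
  -- For ω ≤ 0 the density term of h is nonnegative, and the remaining quadratic
  -- 2ω²+(γ-1)ω+(γ-1)(2-γ) has discriminant -(γ-1)(17-9γ) < 0, so h > 0.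
  have hω : 0 < ω := by
    by_contra hω
    have : 4 * Real.pi / (4 - 3 * γ) * ρ * ω ≤ 0 :=
      mul_nonpos_of_nonneg_of_nonpos (by positivity) (not_lt.mp hω)
    nlinarith [sq_nonneg (4 * ω + (γ - 1)), mul_pos (sub_pos.mpr h1) (by linarith : 0 < 17 - 9 * γ)]
  have e1 : ρ = rhoS γ ω := by
    have e := rhoS_mul hγ hω.ne'
    have : 4 * Real.pi / (4 - 3 * γ) * ω ≠ 0 := by positivity
    apply mul_left_cancel₀ this
    linear_combination -hh - e
  refine ⟨hω, e1, ?_⟩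
  have e := yS_sq hγ hω
  unfold G at hG
  rw [e1] at hG
  have : y ^ 2 = yS γ ω ^ 2 := by
    apply mul_right_cancel₀ (pow_pos hω 2).ne'
    linarith
  exact (pow_left_inj₀ hy.le (yS_pos hγ hω).le two_ne_zero).mp this

end Sonic

/-! ### Absolutely convergent power series with continuous coefficients -/

/-- Power series on `[-1, 1]` with coefficients in `C(K, ℝ)`, absolutely summable. -/
abbrev Series (K : Type*) [TopologicalSpace K] [CompactSpace K] : Type _ :=
  lp (fun _ : ℕ => C(K, ℝ)) 1

namespace Series

variable {K : Type*} [TopologicalSpace K] [CompactSpace K]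

theorem summable_norm (f : Series K) : Summable fun n => ‖f n‖ := by
  simpa using (lp.memℓp f).summable (by simp)

theorem norm_eq (f : Series K) : ‖f‖ = ∑' n, ‖f n‖ := by
  simpa using lp.norm_eq_tsum_rpow (p := 1) (by simp) f

/-- The series with given summable coefficients. -/
def mk (c : ℕ → C(K, ℝ)) (hc : Summable fun n => ‖c n‖) : Series K :=
  ⟨c, memℓp_gen (by simpa using hc)⟩

@[simp] theorem mk_apply (c : ℕ → C(K, ℝ)) (hc : Summable fun n => ‖c n‖) (n : ℕ) :
    mk c hc n = c n := rfl

theorem coeff_add (f g : Series K) (n : ℕ) : (f + g) n = f n + g n := rfl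

theorem coeff_sub (f g : Series K) (n : ℕ) : (f - g) n = f n - g n := rfl

theorem coeff_smul (a : ℝ) (f : Series K) (n : ℕ) : (a • f) n = a • f n := rfl

theorem coeff_zero (n : ℕ) : (0 : Series K) n = 0 := rfl

theorem ext_coeff {f g : Series K} (h : ∀ n, f n = g n) : f = g := lp.ext (funext h)

theorem summable_conv (f g : Series K) :
    Summable fun n => ‖∑ kl ∈ Finset.HasAntidiagonal.antidiagonal n, f kl.1 * g kl.2‖ :=
  summable_norm_sum_mul_antidiagonal_of_summable_norm f.summable_norm g.summable_norm

theorem tsum_norm_conv_le (f g : ℕ → C(K, ℝ)) (hf : Summable fun n => ‖f n‖)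
    (hg : Summable fun n => ‖g n‖) :
    ∑' n, ‖∑ kl ∈ Finset.HasAntidiagonal.antidiagonal n, f kl.1 * g kl.2‖
      ≤ (∑' n, ‖f n‖) * ∑' n, ‖g n‖ := by
  have hf' : Summable fun n => ‖(‖f n‖)‖ := by simpa using hf
  have hg' : Summable fun n => ‖(‖g n‖)‖ := by simpa using hg
  rw [tsum_mul_tsum_eq_tsum_sum_antidiagonal_of_summable_norm hf' hg']
  refine Summable.tsum_le_tsum (fun n => ?_)
    (summable_norm_sum_mul_antidiagonal_of_summable_norm hf hg)
    (summable_norm_sum_mul_antidiagonal_of_summable_norm hf' hg').of_norm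
  exact (norm_sum_le _ _).trans (Finset.sum_le_sum fun kl _ => norm_mul_le _ _)

/-- The Cauchy product, as a bilinear map. -/
def mulLinear : Series K →ₗ[ℝ] Series K →ₗ[ℝ] Series K :=
  LinearMap.mk₂ ℝ (fun f g => mk _ (summable_conv f g))
    (fun f f' g => ext_coeff fun n => by
      simp only [mk_apply, coeff_add, add_mul, Finset.sum_add_distrib])
    (fun a f g => ext_coeff fun n => by
      simp only [mk_apply, coeff_smul, smul_mul_assoc, Finset.smul_sum])
    (fun f g g' => ext_coeff fun n => by
      simp only [mk_apply, coeff_add, mul_add, Finset.sum_add_distrib])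
    (fun a f g => ext_coeff fun n => by
      simp only [mk_apply, coeff_smul, mul_smul_comm, Finset.smul_sum])

theorem norm_mulLinear_le (f g : Series K) : ‖mulLinear f g‖ ≤ 1 * ‖f‖ * ‖g‖ := by
  rw [one_mul, norm_eq f, norm_eq g, norm_eq]
  exact tsum_norm_conv_le (fun n => f n) (fun n => g n) f.summable_norm g.summable_norm

/-- The Cauchy product. -/
def mul : Series K →L[ℝ] Series K →L[ℝ] Series K :=
  LinearMap.mkContinuous₂ mulLinear 1 norm_mulLinear_le

theorem mul_coeff (f g : Series K) (n : ℕ) :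
    (mul f g) n = ∑ kl ∈ Finset.HasAntidiagonal.antidiagonal n, f kl.1 * g kl.2 := rfl

/-- The constant series. -/
def const : C(K, ℝ) →ₗ[ℝ] Series K where
  toFun b := lp.single (E := fun _ : ℕ => C(K, ℝ)) 1 0 b
  map_add' b b' := lp.single_add (E := fun _ : ℕ => C(K, ℝ)) 1 0 b b'
  map_smul' a b := lp.single_smul (E := fun _ : ℕ => C(K, ℝ)) 1 0 a b

theorem const_coeff_zero (b : C(K, ℝ)) : const b 0 = b :=
  lp.single_apply_self (E := fun _ : ℕ => C(K, ℝ)) 1 0 b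

theorem const_coeff_succ (b : C(K, ℝ)) (n : ℕ) : const b (n + 1) = 0 :=
  lp.single_apply_ne (E := fun _ : ℕ => C(K, ℝ)) 1 0 b (Nat.succ_ne_zero n)

theorem const_mul_coeff (b : C(K, ℝ)) (f : Series K) (n : ℕ) : mul (const b) f n = b * f n := by
  rw [mul_coeff, Finset.sum_eq_single (0, n)]
  · rw [const_coeff_zero]
  · rintro ⟨i, j⟩ hij hne
    rcases i with _ | i
    · have := Finset.HasAntidiagonal.mem_antidiagonal.mp hij
      have : j = n := by simpa using this
      exact absurd (by rw [this]) hne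
    · simp [const_coeff_succ]
  · intro hn
    exact absurd (Finset.HasAntidiagonal.mem_antidiagonal.mpr (zero_add n)) hn

theorem summable_mult {c : ℕ → C(K, ℝ)} {C : ℝ} (hc : ∀ n, ‖c n‖ ≤ C) (f : Series K) :
    Summable fun n => ‖c n * f n‖ :=
  (f.summable_norm.mul_left C).of_nonneg_of_le (fun _ => norm_nonneg _) fun n =>
    (norm_mul_le _ _).trans (mul_le_mul_of_nonneg_right (hc n) (norm_nonneg _))

/-- The operator multiplying the `n`-th coefficient by `c n`. -/
def mult (c : ℕ → C(K, ℝ)) (C : ℝ) (hc : ∀ n, ‖c n‖ ≤ C) : Series K →L[ℝ] Series K :=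
  LinearMap.mkContinuous
    { toFun := fun f => mk _ (summable_mult hc f)
      map_add' := fun f g => ext_coeff fun n => by simp only [mk_apply, coeff_add, mul_add]
      map_smul' := fun a f => ext_coeff fun n => by
        simp only [mk_apply, coeff_smul, mul_smul_comm, RingHom.id_apply] }
    C (fun f => by
      refine (norm_eq _).trans_le ?_
      rw [norm_eq f, ← tsum_mul_left]
      exact Summable.tsum_le_tsum (fun n => (norm_mul_le _ _).trans
        (mul_le_mul_of_nonneg_right (hc n) (norm_nonneg _))) (summable_mult hc f)
        (f.summable_norm.mul_left C))

theorem mult_coeff (c : ℕ → C(K, ℝ)) (C : ℝ) (hc : ∀ n, ‖c n‖ ≤ C) (f : Series K) (n : ℕ) :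
    mult c C hc f n = c n * f n := rfl

theorem summable_shift (f : Series K) :
    Summable fun n => ‖(Nat.casesOn n 0 fun m => f m : C(K, ℝ))‖ :=
  (summable_nat_add_iff 1).mp f.summable_norm

/-- Multiplication by the variable. -/
def shift : Series K →L[ℝ] Series K :=
  LinearMap.mkContinuous
    { toFun := fun f => mk _ (summable_shift f)
      map_add' := fun f g => ext_coeff fun n => by cases n <;> simp [mk_apply, coeff_add]
      map_smul' := fun a f => ext_coeff fun n => by cases n <;> simp [mk_apply, coeff_smul] }
    1 (fun f => by
      refine (norm_eq _).trans_le ?_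
      rw [norm_eq f, one_mul]
      exact ((summable_shift f).tsum_eq_zero_add.trans (by simp)).le)

theorem shift_coeff_zero (f : Series K) : shift f 0 = 0 := rfl

theorem shift_coeff_succ (f : Series K) (n : ℕ) : shift f (n + 1) = f n := rfl

theorem norm_inv_succ_le (n : ℕ) :
    ‖algebraMap ℝ C(K, ℝ) (((n : ℝ) + 1)⁻¹)‖ ≤ 1 := by
  have h1 : ‖(((n : ℝ) + 1)⁻¹)‖ ≤ 1 := by
    rw [Real.norm_of_nonneg (by positivity)]
    exact inv_le_one_of_one_le₀ (by linarith [n.cast_nonneg (α := ℝ)])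
  refine (ContinuousMap.norm_le _ zero_le_one).mpr fun x => ?_
  rw [_root_.algebraMap_apply]
  simpa using h1

/-- The case n = 0 relies on 0⁻¹ = 0. Accordingly `eulerInv` kills the constant term, so adding
`eulerInv S` to `R₀` never changes the prescribed slope at the sonic point. -/
theorem norm_inv_le (n : ℕ) : ‖algebraMap ℝ C(K, ℝ) ((n : ℝ)⁻¹)‖ ≤ 1 := by
  rcases n with _ | n
  · simp
  · simpa using norm_inv_succ_le (K := K) n

/-- The operator `f ↦ x⁻¹ ∫₀ˣ f`. -/
def average : Series K →L[ℝ] Series K := mult _ 1 norm_inv_succ_le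

/-- The operator `f ↦ ∫₀ˣ f`. -/
def integral : Series K →L[ℝ] Series K := shift.comp average

/-- The operator dividing the `n`-th coefficient by `n`, a right inverse of `x d/dx`. -/
def eulerInv : Series K →L[ℝ] Series K := mult _ 1 norm_inv_le

theorem average_coeff (f : Series K) (n : ℕ) : average f n = ((n : ℝ) + 1)⁻¹ • f n := by
  rw [average, mult_coeff, Algebra.smul_def]

theorem eulerInv_coeff (f : Series K) (n : ℕ) : eulerInv f n = (n : ℝ)⁻¹ • f n := by
  rw [eulerInv, mult_coeff, Algebra.smul_def]

/-- The value of the series at the parameter `w` and the point `x`. -/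
def eval (f : Series K) (w : K) (x : ℝ) : ℝ := ∑' n, f n w * x ^ n

theorem norm_term_le (f : Series K) (w : K) {x : ℝ} (hx : |x| ≤ 1) (n : ℕ) :
    ‖f n w * x ^ n‖ ≤ ‖f n‖ := by
  rw [norm_mul, norm_pow, Real.norm_eq_abs x]
  exact (mul_le_of_le_one_right (norm_nonneg _) (pow_le_one₀ (abs_nonneg x) hx)).trans
    ((f n).norm_coe_le_norm w)

theorem summable_norm_term (f : Series K) (w : K) {x : ℝ} (hx : |x| ≤ 1) :
    Summable fun n => ‖f n w * x ^ n‖ :=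
  f.summable_norm.of_nonneg_of_le (fun _ => norm_nonneg _) (f.norm_term_le w hx)

theorem summable_term (f : Series K) (w : K) {x : ℝ} (hx : |x| ≤ 1) :
    Summable fun n => f n w * x ^ n := (f.summable_norm_term w hx).of_norm

theorem eval_add (f g : Series K) (w : K) {x : ℝ} (hx : |x| ≤ 1) :
    eval (f + g) w x = eval f w x + eval g w x := by
  unfold eval
  rw [← (f.summable_term w hx).tsum_add (g.summable_term w hx)]
  congr 1; ext n
  rw [coeff_add, ContinuousMap.add_apply, add_mul]

theorem eval_sub (f g : Series K) (w : K) {x : ℝ} (hx : |x| ≤ 1) :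
    eval (f - g) w x = eval f w x - eval g w x := by
  unfold eval
  rw [← (f.summable_term w hx).tsum_sub (g.summable_term w hx)]
  congr 1; ext n
  rw [coeff_sub, ContinuousMap.sub_apply, sub_mul]

theorem eval_smul (a : ℝ) (f : Series K) (w : K) (x : ℝ) :
    eval (a • f) w x = a * eval f w x := by
  unfold eval
  rw [← tsum_mul_left]
  congr 1; ext n
  rw [coeff_smul, ContinuousMap.smul_apply, smul_eq_mul, mul_assoc]

theorem eval_zero_right (f : Series K) (w : K) : eval f w 0 = f 0 w := by
  unfold eval
  rw [tsum_eq_single 0 fun n hn => by simp [hn]]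
  simp

theorem eval_const (b : C(K, ℝ)) (w : K) (x : ℝ) : eval (const b) w x = b w := by
  unfold eval
  rw [tsum_eq_single 0 fun n hn => ?_]
  · simp [const_coeff_zero]
  · obtain ⟨m, rfl⟩ := Nat.exists_eq_succ_of_ne_zero hn
    simp [const_coeff_succ]

theorem eval_mul (f g : Series K) (w : K) {x : ℝ} (hx : |x| ≤ 1) :
    eval (mul f g) w x = eval f w x * eval g w x := by
  unfold eval
  rw [tsum_mul_tsum_eq_tsum_sum_antidiagonal_of_summable_norm (f.summable_norm_term w hx)
    (g.summable_norm_term w hx)]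
  congr 1; ext n
  rw [mul_coeff, ContinuousMap.sum_apply, Finset.sum_mul]
  refine Finset.sum_congr rfl fun kl hkl => ?_
  rw [← Finset.HasAntidiagonal.mem_antidiagonal.mp hkl, ContinuousMap.mul_apply, pow_add]
  ring

theorem eval_shift (f : Series K) (w : K) {x : ℝ} (hx : |x| ≤ 1) :
    eval (shift f) w x = x * eval f w x := by
  unfold eval
  rw [((shift f).summable_term w hx).tsum_eq_zero_add, ← tsum_mul_left]
  simp only [shift_coeff_zero, shift_coeff_succ, ContinuousMap.zero_apply, zero_mul, zero_add]
  congr 1; ext n; ring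

theorem continuousOn_eval (f : Series K) :
    ContinuousOn (fun p : K × ℝ => eval f p.1 p.2) (univ ×ˢ Icc (-1) 1) := by
  unfold eval
  refine continuousOn_tsum (fun n => ?_) f.summable_norm fun n p hp =>
    f.norm_term_le p.1 (abs_le.mpr hp.2) n
  exact Continuous.continuousOn (by fun_prop)

theorem analyticAt_eval (f : Series K) (w : K) : AnalyticAt ℝ (eval f w) 0 := by
  let p := FormalMultilinearSeries.ofScalars ℝ fun n => f n w
  have hr : (1 : ENNReal) ≤ p.radius := by
    refine p.le_radius_of_bound (r := 1) ‖f‖ fun n => ?_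
    simp only [p, FormalMultilinearSeries.ofScalars_norm, NNReal.coe_one, one_pow, mul_one]
    exact ((f n).norm_coe_le_norm w).trans (lp.norm_apply_le_norm (by simp) f n)
  have := p.hasFPowerSeriesOnBall (zero_lt_one.trans_le hr)
  refine (this.analyticAt).congr (Eventually.of_forall fun x => ?_)
  simp only [p, FormalMultilinearSeries.sum, eval]
  congr 1; ext n
  simp [FormalMultilinearSeries.ofScalars]

/-- Term by term differentiation. -/
theorem hasDerivAt_eval {f g : Series K} (hfg : ∀ n : ℕ, ((n : ℝ) + 1) • f (n + 1) = g n) (w : K)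
    {x : ℝ} (hx : |x| < 1) : HasDerivAt (eval f w) (eval g w x) x := by
  obtain ⟨s, hs1, hs2⟩ := exists_between hx
  have hs0 : 0 < s := (abs_nonneg x).trans_lt hs1
  have hder : ∀ (n : ℕ) (y : ℝ), HasDerivAt (fun y => f n w * y ^ n)
      (f n w * (n * y ^ (n - 1))) y := fun n y => (hasDerivAt_pow n y).const_mul _
  have hsum : Summable fun n : ℕ => ‖f‖ * (n * s ^ (n - 1)) := by
    refine Summable.mul_left _ ?_
    have := summable_pow_mul_geometric_of_norm_lt_one (R := ℝ) 1 (r := s)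
      (by rwa [Real.norm_of_nonneg hs0.le])
    refine (this.mul_left s⁻¹).congr fun n => ?_
    rcases n with _ | n
    · simp
    · field_simp
      simp [pow_succ]
      ring
  have key := hasDerivAt_tsum_of_isPreconnected hsum (isOpen_Ioo (a := -s) (b := s))
    isPreconnected_Ioo (fun n y _ => hder n y) (fun n y hy => ?_) (y₀ := 0) ⟨by linarith, hs0⟩
    (f.summable_term w (by simp)) (abs_lt.mp hs1)
  · have hs : Summable fun n : ℕ => f n w * (n * x ^ (n - 1)) := by
      refine hsum.of_norm_bounded fun n => ?_
      rw [norm_mul, norm_mul, norm_pow, Real.norm_natCast, Real.norm_eq_abs x]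
      gcongr
      exact ((f n).norm_coe_le_norm w).trans (lp.norm_apply_le_norm (by simp) f n)
    have e : ∑' n : ℕ, f n w * (n * x ^ (n - 1)) = eval g w x := by
      rw [hs.tsum_eq_zero_add]
      simp only [Nat.cast_zero, zero_mul, mul_zero, zero_add, eval]
      congr 1; ext n
      rw [← hfg n]
      simp
      ring
    rw [e] at key
    exact key
  · rw [norm_mul, norm_mul, norm_pow, Real.norm_natCast, Real.norm_eq_abs y]
    have : |y| ≤ s := (abs_lt.mpr hy).le
    gcongr
    exact ((f n).norm_coe_le_norm w).trans (lp.norm_apply_le_norm (by simp) f n)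

theorem hasDerivAt_integral (f : Series K) (w : K) {x : ℝ} (hx : |x| < 1) :
    HasDerivAt (eval (integral f) w) (eval f w x) x := by
  refine hasDerivAt_eval (fun n => ?_) w hx
  rw [integral, ContinuousLinearMap.comp_apply, shift_coeff_succ, average_coeff, smul_smul,
    mul_inv_cancel₀ (by positivity), one_smul]

theorem eval_integral (f : Series K) (w : K) {x : ℝ} (hx : |x| ≤ 1) :
    eval (integral f) w x = x * eval (average f) w x := eval_shift _ w hx

theorem summable_tail (f : Series K) : Summable fun n => ‖f (n + 1)‖ :=
  (summable_nat_add_iff 1).mpr f.summable_norm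

/-- The relation x·d = f(x) - f(0) does not determine the derivative d at x = 0, hence the
existential form. Subtracting the constant term is needed because `eulerInv` discards it. -/
theorem hasDerivAt_eulerInv (f : Series K) (w : K) {x : ℝ} (hx : |x| < 1) :
    ∃ d, HasDerivAt (eval (eulerInv f) w) d x ∧ x * d = eval f w x - f 0 w := by
  refine ⟨eval (mk _ f.summable_tail) w x, hasDerivAt_eval (fun n => ?_) w hx, ?_⟩
  · rw [eulerInv_coeff, smul_smul, mk_apply]
    push_cast
    rw [mul_inv_cancel₀ (by positivity), one_smul]
  · rw [← eval_shift _ w hx.le]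
    unfold eval
    rw [(summable_term _ w hx.le).tsum_eq_zero_add, (f.summable_term w hx.le).tsum_eq_zero_add]
    simp [shift_coeff_zero, shift_coeff_succ]

end Series

/-! ### The analytic family of solutions near the sonic curve -/

namespace Series

variable {K : Type*} [TopologicalSpace K] [CompactSpace K]

theorem mul_const_const (a b : C(K, ℝ)) : mul (const a) (const b) = const (a * b) := by
  refine ext_coeff fun n => ?_
  rw [const_mul_coeff]
  rcases n with _ | n
  · simp only [const_coeff_zero]
  · simp only [const_coeff_succ, mul_zero]

theorem average_const (a : C(K, ℝ)) : average (const a) = const a := by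
  refine ext_coeff fun n => ?_
  rw [average_coeff]
  rcases n with _ | n
  · simp [const_coeff_zero]
  · simp [const_coeff_succ]

/-- `relVel` for series. -/
def relVelS (γ : ℝ) (ω R : Series K) : Series K :=
  (4 - 3 * γ) • const 1 - (3 : ℝ) • ω - mul ω R

/-- `gRate` for series. -/
def gRateS (γ : ℝ) (ω q R : Series K) : Series K :=
  (γ - 1) • mul q R - (2 : ℝ) • q - (2 : ℝ) • mul ω (relVelS γ ω R)

/-- `hRate` for series. -/
def hRateS (γ : ℝ) (ρ ω R : Series K) : Series K :=
  (-(4 * Real.pi / (4 - 3 * γ))) • mul (mul ρ ω) R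
    + mul ((4 : ℝ) • ω + (γ - 1) • const 1 - (4 * Real.pi / (4 - 3 * γ)) • ρ) (relVelS γ ω R)

/-- `excess` for series. -/
def excessS (γ : ℝ) (ρ ω q R : Series K) : Series K :=
  hRateS γ ρ ω R - mul (gRateS γ ω q R) R

variable (γ : ℝ) (ρ ω q R : Series K) (w : K) {x : ℝ}

theorem eval_relVelS (hx : |x| ≤ 1) :
    eval (relVelS γ ω R) w x = relVel γ (eval ω w x) (eval R w x) := by
  simp [relVelS, relVel, eval_sub _ _ _ hx, eval_smul, eval_const, eval_mul _ _ _ hx]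

theorem eval_gRateS (hx : |x| ≤ 1) :
    eval (gRateS γ ω q R) w x = gRate γ (eval ω w x) (eval q w x) (eval R w x) := by
  simp only [gRateS, gRate, eval_sub _ _ _ hx, eval_smul, eval_mul _ _ _ hx,
    eval_relVelS _ _ _ _ hx]
  ring

theorem eval_hRateS (hx : |x| ≤ 1) :
    eval (hRateS γ ρ ω R) w x = hRate γ (eval ρ w x) (eval ω w x) (eval R w x) := by
  simp only [hRateS, hRate, eval_add _ _ _ hx, eval_sub _ _ _ hx, eval_smul, eval_mul _ _ _ hx,
    eval_relVelS _ _ _ _ hx, eval_const, ContinuousMap.one_apply]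
  ring

theorem eval_excessS (hx : |x| ≤ 1) :
    eval (excessS γ ρ ω q R) w x
      = excess γ (eval ρ w x) (eval ω w x) (eval q w x) (eval R w x) := by
  simp only [excessS, excess, eval_sub _ _ _ hx, eval_mul _ _ _ hx, eval_gRateS _ _ _ _ _ hx,
    eval_hRateS _ _ _ _ _ hx]

end Series

open Series

/-! ### The implicit function theorem for power series with coefficients continuous in w. -/

section Family

variable {K : Type*} [TopologicalSpace K] [CompactSpace K]

/-- The equation solved by the deviation from the sonic values. -/
def sonicMap (γ : ℝ) (ρ₀ ω₀ q₀ R₀ : C(K, ℝ)) (p : ℝ × (Series K × Series K × Series K × Series K)) :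
    Series K × Series K × Series K × Series K :=
  (p.2.1 - p.1 • integral (mul (const ρ₀ + p.2.1) (const R₀ + eulerInv p.2.2.2.2)),
   p.2.2.1 - p.1 • integral (relVelS γ (const ω₀ + p.2.2.1) (const R₀ + eulerInv p.2.2.2.2)),
   p.2.2.2.1 - p.1 • integral ((γ - 1) • mul (const q₀ + p.2.2.2.1)
      (const R₀ + eulerInv p.2.2.2.2) - (2 : ℝ) • (const q₀ + p.2.2.2.1)),
   -- In the rescaled time x = t/r the gap is q-ω² = r·x·average(gRate). In (q-ω²)R' = `excess` the
   -- factor r cancels against dx/dt, leaving average(gRate)·(x dR/dx) = `excess`. The unknown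
   -- `p.2.2.2.2` stands for x dR/dx, which makes the equation regular at x = 0 and at r = 0.
   mul (average (gRateS γ (const ω₀ + p.2.2.1) (const q₀ + p.2.2.2.1)
      (const R₀ + eulerInv p.2.2.2.2))) p.2.2.2.2
    - excessS γ (const ρ₀ + p.2.1) (const ω₀ + p.2.2.1) (const q₀ + p.2.2.2.1)
      (const R₀ + eulerInv p.2.2.2.2))

theorem contDiff_sonicMap (γ : ℝ) (ρ₀ ω₀ q₀ R₀ : C(K, ℝ)) :
    ContDiff ℝ 1 (sonicMap γ ρ₀ ω₀ q₀ R₀) := by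
  unfold sonicMap excessS hRateS gRateS relVelS
  fun_prop

/-- The sonic values. -/
structure SonicValues (γ : ℝ) (ρ₀ ω₀ q₀ R₀ : C(K, ℝ)) : Prop where
  excess_eq : ∀ w, excess γ (ρ₀ w) (ω₀ w) (q₀ w) (R₀ w) = 0
  gRate_neg : ∀ w, gRate γ (ω₀ w) (q₀ w) (R₀ w) < 0
  slope_pos : ∀ w, 0 < excessSlope γ (ρ₀ w) (ω₀ w) (q₀ w) (R₀ w) (R₀ w)

variable {γ : ℝ} {ρ₀ ω₀ q₀ R₀ : C(K, ℝ)}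

theorem relVelS_const (ω₀ R₀ : C(K, ℝ)) : relVelS γ (const ω₀) (const R₀)
    = const ((4 - 3 * γ) • (1 : C(K, ℝ)) - (3 : ℝ) • ω₀ - ω₀ * R₀) := by
  simp only [relVelS, mul_const_const, map_sub, map_smul]

/-- The value of `gRate` on the sonic curve. -/
def sonicRate (γ : ℝ) (ω₀ q₀ R₀ : C(K, ℝ)) : C(K, ℝ) :=
  (γ - 1) • (q₀ * R₀) - (2 : ℝ) • q₀
    - (2 : ℝ) • (ω₀ * ((4 - 3 * γ) • (1 : C(K, ℝ)) - (3 : ℝ) • ω₀ - ω₀ * R₀))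

theorem gRateS_const (ω₀ q₀ R₀ : C(K, ℝ)) :
    gRateS γ (const ω₀) (const q₀) (const R₀) = const (sonicRate γ ω₀ q₀ R₀) := by
  rw [gRateS, relVelS_const, mul_const_const, mul_const_const]
  simp only [sonicRate, map_sub, map_smul]

theorem sonicRate_apply (ω₀ q₀ R₀ : C(K, ℝ)) (w : K) :
    sonicRate γ ω₀ q₀ R₀ w = gRate γ (ω₀ w) (q₀ w) (R₀ w) := by
  simp [sonicRate, gRate, relVel]
  ring

/-- The value of `excessSlope` on the sonic curve. -/
def sonicSlope (γ : ℝ) (ρ₀ ω₀ q₀ R₀ : C(K, ℝ)) : C(K, ℝ) :=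
  (-(4 * Real.pi / (4 - 3 * γ))) • (ρ₀ * ω₀)
    - ((4 : ℝ) • ω₀ + (γ - 1) • (1 : C(K, ℝ)) - (4 * Real.pi / (4 - 3 * γ)) • ρ₀) * ω₀
    - ((γ - 1) • q₀ + (2 : ℝ) • (ω₀ * ω₀)) * R₀ - sonicRate γ ω₀ q₀ R₀

theorem sonicSlope_apply (ρ₀ ω₀ q₀ R₀ : C(K, ℝ)) (w : K) :
    sonicSlope γ ρ₀ ω₀ q₀ R₀ w = excessSlope γ (ρ₀ w) (ω₀ w) (q₀ w) (R₀ w) (R₀ w) := by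
  simp [sonicSlope, excessSlope, sonicRate]
  ring

theorem excessS_const (hv : SonicValues γ ρ₀ ω₀ q₀ R₀) :
    excessS γ (const ρ₀) (const ω₀) (const q₀) (const R₀) = 0 := by
  simp only [excessS, hRateS, relVelS_const, gRateS_const, mul_const_const, ← map_smul, ← map_add,
    ← map_sub]
  rw [← map_zero (const (K := K))]
  congr 1
  ext w
  have := hv.excess_eq w
  simp [excess, hRate, relVel, sonicRate, gRate] at this ⊢
  linear_combination this

theorem sonicMap_zero (hv : SonicValues γ ρ₀ ω₀ q₀ R₀) : sonicMap γ ρ₀ ω₀ q₀ R₀ 0 = 0 := by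
  simp [sonicMap, excessS_const hv]

/-- The linearization of the last component of `sonicMap` in its last variable. -/
def linS (γ : ℝ) (ρ₀ ω₀ q₀ R₀ : C(K, ℝ)) (T : Series K) : Series K :=
  mul (const (sonicRate γ ω₀ q₀ R₀)) T - mul (const (sonicSlope γ ρ₀ ω₀ q₀ R₀)) (eulerInv T)

theorem const_mul_mul (a b : C(K, ℝ)) (f : Series K) :
    mul (const a) (mul (const b) f) = mul (const (a * b)) f := by
  refine ext_coeff fun n => ?_
  simp only [const_mul_coeff, mul_assoc]

theorem mul_const_comm (a : C(K, ℝ)) (f : Series K) : mul f (const a) = mul (const a) f := by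
  refine ext_coeff fun n => ?_
  rw [const_mul_coeff, mul_coeff, Finset.sum_eq_single (n, 0)]
  · rw [const_coeff_zero, mul_comm]
  · rintro ⟨i, j⟩ hij hne
    rcases j with _ | j
    · have := Finset.HasAntidiagonal.mem_antidiagonal.mp hij
      have : i = n := by simpa using this
      exact absurd (by rw [this]) hne
    · simp [const_coeff_succ]
  · intro hn
    exact absurd (Finset.HasAntidiagonal.mem_antidiagonal.mpr (add_zero n)) hn

/-- At r = 0 the last component, restricted to a ray in its last variable, is a quadratic polynomial
in s without constant term. Its partial derivative can therefore be read off as the linear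
coefficient. -/
theorem sonicMap_line (hv : SonicValues γ ρ₀ ω₀ q₀ R₀) (T : Series K) : ∃ E : Series K,
    ∀ s : ℝ, (sonicMap γ ρ₀ ω₀ q₀ R₀ (0, 0, 0, 0, s • T)).2.2.2
      = s • linS γ ρ₀ ω₀ q₀ R₀ T + (s * s) • E := by
  set D := eulerInv T with hD
  set G1 := (γ - 1) • mul (const q₀) D + (2 : ℝ) • mul (const (ω₀ * ω₀)) D with hG1
  refine ⟨mul (average G1) T + mul G1 D, fun s => ?_⟩
  have e1 : gRateS γ (const ω₀) (const q₀) (const R₀ + s • D)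
      = const (sonicRate γ ω₀ q₀ R₀) + s • G1 := by
    rw [← gRateS_const, hG1, ← const_mul_mul]
    simp only [gRateS, relVelS, map_add, map_sub, map_smul]
    module
  have e2 : excessS γ (const ρ₀) (const ω₀) (const q₀) (const R₀ + s • D)
      = excessS γ (const ρ₀) (const ω₀) (const q₀) (const R₀)
        + s • mul (const (sonicSlope γ ρ₀ ω₀ q₀ R₀)) D - (s * s) • mul G1 D := by
    have e3 : mul G1 (const R₀)
        = mul (const (((γ - 1) • q₀ + (2 : ℝ) • (ω₀ * ω₀)) * R₀)) D := by
      rw [mul_const_comm, hG1]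
      simp only [map_add, map_smul, const_mul_mul, add_apply,
        smul_apply, mul_comm _ R₀, mul_add, mul_smul_comm]
    simp only [excessS, e1, gRateS_const, map_add, map_smul, add_apply,
      smul_apply, e3]
    simp only [hRateS, relVelS, sonicSlope, map_add, map_sub, map_smul, const_mul_mul,
      mul_const_const, sub_mul, add_mul, smul_mul_assoc, add_apply,
      sub_apply, smul_apply, neg_smul, map_neg,
      neg_apply]
    module
  simp only [sonicMap, add_zero, map_smul, ← hD]
  rw [e1, e2, excessS_const hv]
  simp only [linS, map_add, map_smul, average_const, add_apply,
    smul_apply, ← hD]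
  module

theorem linS_coeff (T : Series K) (n : ℕ) : linS γ ρ₀ ω₀ q₀ R₀ T n
    = (sonicRate γ ω₀ q₀ R₀ - (n : ℝ)⁻¹ • sonicSlope γ ρ₀ ω₀ q₀ R₀) * T n := by
  rw [linS, coeff_sub, const_mul_coeff, const_mul_coeff, eulerInv_coeff]
  simp [sub_mul]

/-- `linS` acts diagonally on coefficients, with multiplier `gRate` - `excessSlope`/n. Both terms
push it below zero, so there is no resonance at any order. For n = 0 the second term is absent by
the convention 0⁻¹ = 0. -/
theorem linS_multiplier_neg (hv : SonicValues γ ρ₀ ω₀ q₀ R₀) (n : ℕ) (w : K) :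
    (sonicRate γ ω₀ q₀ R₀ - (n : ℝ)⁻¹ • sonicSlope γ ρ₀ ω₀ q₀ R₀) w
      ≤ gRate γ (ω₀ w) (q₀ w) (R₀ w) := by
  rw [ContinuousMap.sub_apply, ContinuousMap.smul_apply, sonicRate_apply, sonicSlope_apply,
    smul_eq_mul]
  have := hv.slope_pos w
  have : 0 ≤ (n : ℝ)⁻¹ * excessSlope γ (ρ₀ w) (ω₀ w) (q₀ w) (R₀ w) (R₀ w) := by positivity
  linarith

theorem linS_injective (hv : SonicValues γ ρ₀ ω₀ q₀ R₀) {T : Series K}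
    (hT : linS γ ρ₀ ω₀ q₀ R₀ T = 0) : T = 0 := by
  refine ext_coeff fun n => ?_
  ext w
  have h1 := congrArg (fun f : Series K => f n w) hT
  simp only [linS_coeff, coeff_zero, ContinuousMap.mul_apply, ContinuousMap.zero_apply] at h1 ⊢
  exact (mul_eq_zero.mp h1).resolve_left
    ((linS_multiplier_neg hv n w).trans_lt (hv.gRate_neg w)).ne

theorem linS_surjective (hv : SonicValues γ ρ₀ ω₀ q₀ R₀) (Z : Series K) :
    ∃ T, linS γ ρ₀ ω₀ q₀ R₀ T = Z := by
  rcases isEmpty_or_nonempty K with hK | hK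
  · exact ⟨0, ext_coeff fun n => by ext w; exact hK.elim w⟩
  -- Compactness of K makes the bound uniform in w. With `linS_multiplier_neg` it is uniform in n
  -- too, so the reciprocal multipliers define a bounded operator on the series.
  obtain ⟨m, hm⟩ : ∃ m : ℝ, 0 < m ∧ ∀ w, gRate γ (ω₀ w) (q₀ w) (R₀ w) ≤ -m := by
    obtain ⟨w, -, hw⟩ := isCompact_univ.exists_isMaxOn univ_nonempty
      (sonicRate γ ω₀ q₀ R₀).continuous.continuousOn
    refine ⟨-gRate γ (ω₀ w) (q₀ w) (R₀ w), neg_pos.mpr (hv.gRate_neg w), fun w' => ?_⟩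
    have := hw (mem_univ w')
    simp only [mem_ofPred_eq, sonicRate_apply] at this
    linarith
  have hle : ∀ (n : ℕ) (w : K),
      (sonicRate γ ω₀ q₀ R₀ - (n : ℝ)⁻¹ • sonicSlope γ ρ₀ ω₀ q₀ R₀) w ≤ -m :=
    fun n w => (linS_multiplier_neg hv n w).trans (hm.2 w)
  let c : ℕ → C(K, ℝ) := fun n =>
    ⟨fun w => ((sonicRate γ ω₀ q₀ R₀ - (n : ℝ)⁻¹ • sonicSlope γ ρ₀ ω₀ q₀ R₀) w)⁻¹,
      (ContinuousMap.continuous _).inv₀ fun w => by linarith [hle n w, hm.1]⟩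
  have hc : ∀ n, ‖c n‖ ≤ m⁻¹ := fun n => by
    refine (ContinuousMap.norm_le _ (inv_pos.mpr hm.1).le).mpr fun w => ?_
    simp only [c, ContinuousMap.coe_mk, norm_inv, Real.norm_eq_abs]
    refine inv_anti₀ hm.1 ?_
    rw [abs_of_neg (by linarith [hle n w, hm.1])]
    linarith [hle n w]
  refine ⟨mult c _ hc Z, ext_coeff fun n => ?_⟩
  ext w
  rw [linS_coeff, mult_coeff]
  have : (sonicRate γ ω₀ q₀ R₀ - (n : ℝ)⁻¹ • sonicSlope γ ρ₀ ω₀ q₀ R₀) w ≠ 0 := by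
    linarith [hle n w, hm.1]
  simp only [ContinuousMap.mul_apply, c, ContinuousMap.coe_mk]
  rw [mul_inv_cancel_left₀ this]

/-- At r = 0 the zero deviation is a solution. The partial derivative there is block triangular: the
identity on the first three variables and `linS` on the last. The implicit function theorem solves
the equation for small r > 0, and r becomes the length scale of the time interval. -/
theorem exists_sonicMap_eq_zero (hv : SonicValues γ ρ₀ ω₀ q₀ R₀) :
    ∃ r : ℝ, 0 < r ∧ ∃ v, sonicMap γ ρ₀ ω₀ q₀ R₀ (r, v) = 0 := by
  set F := sonicMap γ ρ₀ ω₀ q₀ R₀ with hF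
  have hs : HasStrictFDerivAt F (fderiv ℝ F 0) 0 :=
    (contDiff_sonicMap γ ρ₀ ω₀ q₀ R₀).contDiffAt.hasStrictFDerivAt one_ne_zero
  set L := fderiv ℝ F 0 ∘L ContinuousLinearMap.inr ℝ ℝ _ with hL
  have hline : ∀ v, HasDerivAt (fun s : ℝ => F (0, s • v)) (L v) 0 := by
    intro v
    have h1 : HasDerivAt (fun s : ℝ => ((0 : ℝ), s • v)) (0, v) 0 := by
      refine (hasDerivAt_const _ _).prodMk ?_
      simpa using (hasDerivAt_id (0 : ℝ)).smul_const v
    have h2 : HasFDerivAt F (fderiv ℝ F 0) ((0 : ℝ), (0 : ℝ) • v) := by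
      rw [zero_smul]; exact hs.hasFDerivAt
    exact h2.comp_hasDerivAt (0 : ℝ) h1
  have hid : ∀ z : Series K, HasDerivAt (fun s : ℝ => s • z) z 0 := fun z => by
    simpa using (hasDerivAt_id (0 : ℝ)).smul_const z
  have hproj : ∀ (π : Series K × Series K × Series K × Series K →L[ℝ] Series K) (v),
      HasDerivAt (fun s : ℝ => π (F (0, s • v))) (π (L v)) 0 := fun π v =>
    π.hasFDerivAt.comp_hasDerivAt (0 : ℝ) (hline v)
  have h1 : ∀ v, (L v).1 = v.1 := fun v => by
    refine (hproj (.fst ℝ _ _) v).unique ((hid v.1).congr_of_eventuallyEq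
      (Eventually.of_forall fun s => ?_))
    simp [hF, sonicMap]
  have h2 : ∀ v, (L v).2.1 = v.2.1 := fun v => by
    refine (hproj (.fst ℝ _ _ ∘L .snd ℝ _ _) v).unique ((hid v.2.1).congr_of_eventuallyEq
      (Eventually.of_forall fun s => ?_))
    simp [hF, sonicMap]
  have h3 : ∀ v, (L v).2.2.1 = v.2.2.1 := fun v => by
    refine (hproj (.fst ℝ _ _ ∘L .snd ℝ _ _ ∘L .snd ℝ _ _) v).unique
      ((hid v.2.2.1).congr_of_eventuallyEq (Eventually.of_forall fun s => ?_))
    simp [hF, sonicMap]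
  have h4 : ∀ T, (L (0, 0, 0, T)).2.2.2 = linS γ ρ₀ ω₀ q₀ R₀ T := fun T => by
    obtain ⟨E, hE⟩ := sonicMap_line hv T
    have h6 : HasDerivAt (fun s : ℝ => s • linS γ ρ₀ ω₀ q₀ R₀ T + (s * s) • E)
        (linS γ ρ₀ ω₀ q₀ R₀ T) 0 := by
      have := (hid (linS γ ρ₀ ω₀ q₀ R₀ T)).add
        (((hasDerivAt_id (0 : ℝ)).mul (hasDerivAt_id (0 : ℝ))).smul_const E)
      refine this.congr_deriv ?_
      simp
    refine (hproj (.snd ℝ _ _ ∘L .snd ℝ _ _ ∘L .snd ℝ _ _) (0, 0, 0, T)).unique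
      (h6.congr_of_eventuallyEq (Eventually.of_forall fun s => ?_))
    simp only [Prod.smul_mk, smul_zero]
    exact hE s
  have hinj : Function.Injective L := by
    refine (injective_iff_map_eq_zero L).mpr fun v hv0 => ?_
    have a1 : v.1 = 0 := by rw [← h1 v, hv0]; rfl
    have a2 : v.2.1 = 0 := by rw [← h2 v, hv0]; rfl
    have a3 : v.2.2.1 = 0 := by rw [← h3 v, hv0]; rfl
    have a5 : v = (0, 0, 0, v.2.2.2) := Prod.ext a1 (Prod.ext a2 (Prod.ext a3 rfl))
    have a4 : v.2.2.2 = 0 := by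
      refine linS_injective hv ?_
      rw [← h4, ← a5, hv0]; rfl
    rw [a5, a4]; rfl
  have hsurj : Function.Surjective L := by
    intro z
    set ℓ := (L (z.1, z.2.1, z.2.2.1, 0)).2.2.2 with hℓ
    obtain ⟨T, hT⟩ := linS_surjective hv (z.2.2.2 - ℓ)
    refine ⟨(z.1, z.2.1, z.2.2.1, T), Prod.ext (h1 _) (Prod.ext (h2 _) (Prod.ext (h3 _) ?_))⟩
    have : ((z.1, z.2.1, z.2.2.1, T) : Series K × Series K × Series K × Series K)
        = (z.1, z.2.1, z.2.2.1, 0) + (0, 0, 0, T) := by simp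
    rw [this, map_add, Prod.snd_add, Prod.snd_add, Prod.snd_add, h4, hT, ← hℓ]
    abel
  have hinv : L.IsInvertible := by
    refine ⟨ContinuousLinearEquiv.ofBijective L (LinearMap.ker_eq_bot.mpr hinj)
      (LinearMap.range_eq_top.mpr hsurj), ?_⟩
    exact ContinuousLinearMap.ext fun v => rfl
  have key := hs.eventually_apply_implicitFunctionOfProdDomain hinv
  have hF0 : F 0 = 0 := sonicMap_zero hv
  simp only [hF0] at key
  obtain ⟨ε, hε, hball⟩ := Metric.eventually_nhds_iff.mp key
  refine ⟨ε / 2, by positivity, _, hball ?_⟩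
  simp only [Prod.fst_zero, dist_zero_right, Real.norm_eq_abs]
  rw [abs_of_pos (by positivity)]
  linarith

end Family

/-- The vector field of the autonomous system for `(ρ, ω, q)` in logarithmic time, where the
logarithmic derivative `R` of `ρ` is considered as an independent variable. -/
def slopeField (γ : ℝ) (u : ℝ × ℝ × ℝ) (R : ℝ) : ℝ × ℝ × ℝ :=
  (u.1 * R, relVel γ u.2.1 R, u.2.2 * ((γ - 1) * R - 2))

theorem hasDerivAt_h {γ : ℝ} {ρ ω : ℝ → ℝ} {c R t : ℝ} (hρ : HasDerivAt ρ (c * (ρ t * R)) t)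
    (hω : HasDerivAt ω (c * relVel γ (ω t) R) t) :
    HasDerivAt (fun s => h γ (ρ s) (ω s)) (c * hRate γ (ρ t) (ω t) R) t := by
  have h1 : HasDerivAt (fun s => 2 * ω s ^ 2 + (γ - 1) * ω s + (γ - 1) * (2 - γ)
      - 4 * Real.pi / (4 - 3 * γ) * ρ s * ω s) (c * hRate γ (ρ t) (ω t) R) t := by
    have := (((((hω.fun_pow 2).const_mul 2).fun_add (hω.const_mul (γ - 1))).add_const
      ((γ - 1) * (2 - γ))).fun_sub ((((hρ.const_mul (4 * Real.pi / (4 - 3 * γ)))).fun_mul hω)))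
    refine this.congr_deriv ?_
    simp only [hRate]; push_cast; ring
  refine h1.congr_of_eventuallyEq (Eventually.of_forall fun s => h_eq γ (ρ s) (ω s))

theorem hasDerivAt_gap {γ : ℝ} {ω q : ℝ → ℝ} {c R t : ℝ}
    (hω : HasDerivAt ω (c * relVel γ (ω t) R) t)
    (hq : HasDerivAt q (c * (q t * ((γ - 1) * R - 2))) t) :
    HasDerivAt (fun s => q s - ω s ^ 2) (c * gRate γ (ω t) (q t) R) t := by
  refine (hq.fun_sub (hω.fun_pow 2)).congr_deriv ?_
  simp only [gRate]; push_cast; ring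

open Series in
/-- The analytic family of solutions through the sonic curve. -/
theorem exists_sonic_family {γ : ℝ} (hγ : γ ∈ Ioo (1 : ℝ) (4 / 3)) :
    ∃ r : ℝ, 0 < r ∧ ∃ (u : ℝ → ℝ → ℝ × ℝ × ℝ) (R : ℝ → ℝ → ℝ),
      ContinuousOn (fun p : ℝ × ℝ => u p.1 p.2) (univ ×ˢ Icc (-r) r) ∧
      ContinuousOn (fun p : ℝ × ℝ => R p.1 p.2) (univ ×ˢ Icc (-r) r) ∧
      ∀ w ∈ Icc (omegaF γ) (2 - γ),
        AnalyticAt ℝ (fun t => (u w t).1) 0 ∧ AnalyticAt ℝ (fun t => (u w t).2.1) 0 ∧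
        AnalyticAt ℝ (R w) 0 ∧ u w 0 = (rhoS γ w, w, w ^ 2) ∧ R w 0 = R1 γ w ∧
        ∀ t ∈ Ioo (-r) r, HasDerivAt (u w) (slopeField γ (u w t) (R w t)) t ∧
          ((u w t).2.2 - (u w t).2.1 ^ 2) * R w t = h γ (u w t).1 (u w t).2.1 ∧
          0 < (u w t).1 ∧ (t < 0 → (u w t).2.1 ^ 2 < (u w t).2.2) := by
  have hle := (omegaF_lt hγ).le
  have hpos : ∀ w : Icc (omegaF γ) (2 - γ), (0 : ℝ) < w :=
    fun w => (omegaF_pos hγ).trans_le w.2.1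
  let K := Icc (omegaF γ) (2 - γ)
  let ρ₀ : C(K, ℝ) := ⟨fun w => rhoS γ w,
    (continuousOn_rhoS γ).comp_continuous continuous_subtype_val hpos⟩
  let ω₀ : C(K, ℝ) := ⟨fun w => w, continuous_subtype_val⟩
  let q₀ : C(K, ℝ) := ⟨fun w => (w : ℝ) ^ 2, by fun_prop⟩
  let R₀ : C(K, ℝ) := ⟨fun w => R1 γ w,
    (continuousOn_R1 hγ).comp_continuous continuous_subtype_val hpos⟩
  have hv : SonicValues γ ρ₀ ω₀ q₀ R₀ :=
    ⟨fun w => excess_R1 hγ w.2, fun w => gRate_R1_neg hγ w.2, fun w => excessSlope_R1_pos hγ w.2⟩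
  obtain ⟨r, hr, ⟨vρ, vω, vq, S⟩, hsol⟩ := exists_sonicMap_eq_zero hv
  set ρ := const ρ₀ + vρ with hρ
  set ω := const ω₀ + vω with hω
  set q := const q₀ + vq with hq
  set R := const R₀ + eulerInv S with hR
  have eρ : vρ = r • integral (mul ρ R) := by
    have := congrArg Prod.fst hsol
    exact sub_eq_zero.mp this
  have eω : vω = r • integral (relVelS γ ω R) := by
    have := congrArg (fun z => z.2.1) hsol
    exact sub_eq_zero.mp this
  have eq : vq = r • integral ((γ - 1) • mul q R - (2 : ℝ) • q) := by
    have := congrArg (fun z => z.2.2.1) hsol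
    exact sub_eq_zero.mp this
  have eS : mul (average (gRateS γ ω q R)) S = excessS γ ρ ω q R := by
    have := congrArg (fun z => z.2.2.2) hsol
    exact sub_eq_zero.mp this
  rw [eρ] at hρ
  rw [eω] at hω
  rw [eq] at hq
  -- values at the sonic point
  have h00 : |(0 : ℝ)| ≤ 1 := by simp
  have int0 : ∀ (f : Series K) (w : K), eval (integral f) w 0 = 0 := fun f w => by
    rw [eval_integral _ _ h00, zero_mul]
  have ρ0 : ∀ w : K, eval ρ w 0 = rhoS γ w := fun w => by
    rw [hρ, eval_add _ _ _ h00, eval_const, eval_smul, int0, mul_zero, add_zero]; rfl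
  have ω0 : ∀ w : K, eval ω w 0 = w := fun w => by
    rw [hω, eval_add _ _ _ h00, eval_const, eval_smul, int0, mul_zero, add_zero]; rfl
  have q0 : ∀ w : K, eval q w 0 = (w : ℝ) ^ 2 := fun w => by
    rw [hq, eval_add _ _ _ h00, eval_const, eval_smul, int0, mul_zero, add_zero]; rfl
  have R0 : ∀ w : K, eval R w 0 = R1 γ w := fun w => by
    rw [hR, eval_add _ _ _ h00, eval_const, eval_zero_right, eulerInv_coeff]
    simp [R₀]
  -- derivatives
  have dρ : ∀ (w : K) (x : ℝ), |x| < 1 →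
      HasDerivAt (eval ρ w) (r * (eval ρ w x * eval R w x)) x := fun w x hx => by
    have h1 := ((hasDerivAt_integral (mul ρ R) w hx).const_mul r).const_add (ρ₀ w)
    rw [eval_mul _ _ _ hx.le] at h1
    refine h1.congr_of_eventuallyEq ?_
    filter_upwards [(isOpen_Ioo (a := (-1 : ℝ)) (b := 1)).mem_nhds (abs_lt.mp hx)] with y hy
    have hy := (abs_lt.mpr hy).le
    rw [hρ, eval_add _ _ _ hy, eval_const, eval_smul, ← hρ]
  have dω : ∀ (w : K) (x : ℝ), |x| < 1 →
      HasDerivAt (eval ω w) (r * relVel γ (eval ω w x) (eval R w x)) x := fun w x hx => by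
    have h1 := ((hasDerivAt_integral (relVelS γ ω R) w hx).const_mul r).const_add (ω₀ w)
    rw [eval_relVelS _ _ _ _ hx.le] at h1
    refine h1.congr_of_eventuallyEq ?_
    filter_upwards [(isOpen_Ioo (a := (-1 : ℝ)) (b := 1)).mem_nhds (abs_lt.mp hx)] with y hy
    have hy := (abs_lt.mpr hy).le
    rw [hω, eval_add _ _ _ hy, eval_const, eval_smul, ← hω]
  have dq : ∀ (w : K) (x : ℝ), |x| < 1 →
      HasDerivAt (eval q w) (r * (eval q w x * ((γ - 1) * eval R w x - 2))) x := fun w x hx => by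
    have h1 := ((hasDerivAt_integral ((γ - 1) • mul q R - (2 : ℝ) • q) w hx).const_mul
      r).const_add (q₀ w)
    rw [eval_sub _ _ _ hx.le, eval_smul, eval_smul, eval_mul _ _ _ hx.le] at h1
    have e : r * (eval q w x * ((γ - 1) * eval R w x - 2))
      = r * ((γ - 1) * (eval q w x * eval R w x) - 2 * eval q w x) := by ring
    rw [e]
    refine h1.congr_of_eventuallyEq ?_
    filter_upwards [(isOpen_Ioo (a := (-1 : ℝ)) (b := 1)).mem_nhds (abs_lt.mp hx)] with y hy
    have hy := (abs_lt.mpr hy).le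
    rw [hq, eval_add _ _ _ hy, eval_const, eval_smul, ← hq]
  -- the factorization of `q - ω²`
  set k := average (gRateS γ ω q R) with hk
  have gk : ∀ (w : K) (x : ℝ), |x| < 1 →
      eval q w x - eval ω w x ^ 2 = r * x * eval k w x := fun w x hx => by
    have hd : ∀ y ∈ Ioo (-1 : ℝ) 1, HasDerivAt
        (fun y => eval q w y - eval ω w y ^ 2 - r * eval (integral (gRateS γ ω q R)) w y) 0 y := by
      intro y hy
      have hy := abs_lt.mpr hy
      have h1 := (hasDerivAt_gap (dω w y hy) (dq w y hy)).fun_sub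
        ((hasDerivAt_integral (gRateS γ ω q R) w hy).const_mul r)
      rw [eval_gRateS _ _ _ _ _ hy.le, sub_self] at h1
      exact h1
    have hc := isOpen_Ioo.is_const_of_deriv_eq_zero (isPreconnected_Ioo (a := (-1 : ℝ)) (b := 1))
      (fun y hy => (hd y hy).differentiableAt.differentiableWithinAt)
      (fun y hy => (hd y hy).deriv) (abs_lt.mp hx) (y := 0) ⟨by norm_num, by norm_num⟩
    simp only [q0, ω0, int0, eval_integral _ _ hx.le] at hc
    linear_combination hc
  have k0 : ∀ w : K, eval k w 0 < 0 := fun w => by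
    rw [hk, eval_zero_right, average_coeff]
    have := eval_gRateS γ ω q R w h00
    rw [eval_zero_right, ω0, q0, R0] at this
    simp [this]
    exact gRate_R1_neg hγ w.2
  -- At x = 0 the last equation reads k·S = 0 with k < 0. Hence S has no constant term and really
  -- equals x dR/dx.
  have S0 : ∀ w : K, S 0 w = 0 := fun w => by
    have := congrArg (fun f => eval f w 0) eS
    simp only [eval_mul _ _ _ h00, eval_excessS _ _ _ _ _ _ h00, ρ0, ω0, q0, R0,
      excess_R1 hγ w.2] at this
    rw [← eval_zero_right]
    exact (mul_eq_zero.mp this).resolve_left (k0 w).ne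
  -- The defect (q-ω²)R - h vanishes at x = 0 and has zero derivative, because `excess` was defined
  -- by differentiating the constraint. The factorization of the gap brings in the equation for S.
  have gR : ∀ (w : K) (x : ℝ), |x| < 1 →
      (eval q w x - eval ω w x ^ 2) * eval R w x = h γ (eval ρ w x) (eval ω w x) := by
    intro w x hx
    have hd : ∀ y ∈ Ioo (-1 : ℝ) 1, HasDerivAt
        (fun y => (eval q w y - eval ω w y ^ 2) * eval R w y - h γ (eval ρ w y) (eval ω w y))
        0 y := by
      intro y hy
      have hy := abs_lt.mpr hy
      obtain ⟨d, hd, hd2⟩ := hasDerivAt_eulerInv S w hy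
      have dR : HasDerivAt (eval R w) d y := by
        refine (hd.const_add (R₀ w)).congr_of_eventuallyEq ?_
        filter_upwards [(isOpen_Ioo (a := (-1 : ℝ)) (b := 1)).mem_nhds (abs_lt.mp hy)] with z hz
        rw [hR, eval_add _ _ _ (abs_lt.mpr hz).le, eval_const]
      have e1 : (eval q w y - eval ω w y ^ 2) * d
          = r * excess γ (eval ρ w y) (eval ω w y) (eval q w y) (eval R w y) := by
        rw [gk w y hy, ← eval_excessS _ _ _ _ _ _ hy.le, ← eS, eval_mul _ _ _ hy.le]
        rw [S0, sub_zero] at hd2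
        rw [← hd2]; ring
      have h1 := (hasDerivAt_gap (dω w y hy) (dq w y hy)).fun_mul dR
      have h2 := hasDerivAt_h (dρ w y hy) (dω w y hy)
      refine (h1.fun_sub h2).congr_deriv ?_
      rw [e1]
      simp only [excess]
      ring
    have hc := isOpen_Ioo.is_const_of_deriv_eq_zero (isPreconnected_Ioo (a := (-1 : ℝ)) (b := 1))
      (fun y hy => (hd y hy).differentiableAt.differentiableWithinAt)
      (fun y hy => (hd y hy).deriv) (abs_lt.mp hx) (y := 0) ⟨by norm_num, by norm_num⟩
    simp only [q0, ω0, ρ0, h_rhoS hγ (hpos w).ne', sub_self, zero_mul] at hc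
    exact sub_eq_zero.mp hc
  -- uniform sign of `k` and `ρ`
  obtain ⟨η, hη, hη1, hsign⟩ : ∃ η : ℝ, 0 < η ∧ η < 1 ∧ ∀ (w : K) (x : ℝ), |x| < η →
      eval k w x < 0 ∧ 0 < eval ρ w x := by
    have hU : IsOpen (univ ×ˢ Ioo (-1 : ℝ) 1 : Set (K × ℝ)) := isOpen_univ.prod isOpen_Ioo
    have hsub : (univ ×ˢ Ioo (-1 : ℝ) 1 : Set (K × ℝ)) ⊆ univ ×ˢ Icc (-1) 1 :=
      prod_mono_right Ioo_subset_Icc_self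
    have hev : ∀ w : K, ∀ᶠ p in 𝓝 (w, (0 : ℝ)), eval k p.1 p.2 < 0 ∧ 0 < eval ρ p.1 p.2 := by
      intro w
      have hmem : (w, (0 : ℝ)) ∈ (univ ×ˢ Ioo (-1 : ℝ) 1 : Set (K × ℝ)) := by simp
      have c1 := ((continuousOn_eval k).mono hsub).continuousAt (hU.mem_nhds hmem)
      have c2 := ((continuousOn_eval ρ).mono hsub).continuousAt (hU.mem_nhds hmem)
      refine (c1.eventually_lt continuousAt_const (k0 w)).and
        (continuousAt_const.eventually_lt c2 ?_)
      rw [ρ0]; exact rhoS_pos hγ (hpos w)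
    have h1 : ∀ᶠ x in 𝓝 (0 : ℝ), ∀ w ∈ (univ : Set K), eval k w x < 0 ∧ 0 < eval ρ w x :=
      isCompact_univ.eventually_forall_of_forall_eventually fun w _ =>
        (continuous_swap.tendsto ((0 : ℝ), w)).eventually (hev w)
    obtain ⟨ε, hε, h2⟩ := Metric.eventually_nhds_iff.mp h1
    refine ⟨min ε (1 / 2), by positivity, (min_le_right _ _).trans_lt (by norm_num),
      fun w x hx => h2 ?_ w (mem_univ w)⟩
    rw [Real.dist_eq, sub_zero]
    exact hx.trans_le (min_le_left _ _)
  -- assembling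
  let P : ℝ → K := projIcc (omegaF γ) (2 - γ) hle
  have hmaps : MapsTo (fun p : ℝ × ℝ => (P p.1, p.2 / r)) (univ ×ˢ Icc (-(r * η)) (r * η))
      (univ ×ˢ Icc (-1) 1) := by
    rintro ⟨w, t⟩ ⟨-, ht1, ht2⟩
    simp only at ht1 ht2
    refine ⟨mem_univ _, ?_, ?_⟩
    · simp only; rw [le_div_iff₀ hr]; nlinarith
    · simp only; rw [div_le_iff₀ hr]; nlinarith
  have hcont : Continuous (fun p : ℝ × ℝ => (P p.1, p.2 / r)) := by
    have : Continuous P := continuous_projIcc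
    fun_prop
  have hc : ∀ f : Series K, ContinuousOn (fun p : ℝ × ℝ => eval f (P p.1) (p.2 / r))
      (univ ×ˢ Icc (-(r * η)) (r * η)) := fun f =>
    (continuousOn_eval f).comp hcont.continuousOn hmaps
  have hana : ∀ (f : Series K) (w : ℝ), AnalyticAt ℝ (fun t => eval f (P w) (t / r)) 0 := by
    intro f w
    have h1 : AnalyticAt ℝ (fun t : ℝ => t / r) 0 := analyticAt_id.div_const
    have h2 := analyticAt_eval f (P w)
    exact AnalyticAt.fun_comp (by simpa using h2) h1
  refine ⟨r * η, by positivity,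
    fun w t => (eval ρ (P w) (t / r), eval ω (P w) (t / r), eval q (P w) (t / r)),
    fun w t => eval R (P w) (t / r), (hc ρ).prodMk ((hc ω).prodMk (hc q)), hc R, ?_⟩
  intro w hw
  have hP : P w = ⟨w, hw⟩ := projIcc_of_mem hle hw
  refine ⟨hana ρ w, hana ω w, hana R w, ?_, ?_, ?_⟩
  · simp only [zero_div, ρ0, ω0, q0, hP]
  · simp only [zero_div, R0, hP]
  intro t ht
  have hx : |t / r| < η := by
    rw [abs_div, abs_of_pos hr, div_lt_iff₀ hr, mul_comm]
    exact abs_lt.mpr ht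
  have hx1 := hx.trans hη1
  have hdiv : HasDerivAt (fun t : ℝ => t / r) (1 / r) t := (hasDerivAt_id t).div_const r
  have hs := hsign (P w) (t / r) hx
  refine ⟨?_, gR _ _ hx1, hs.2, fun ht0 => ?_⟩
  · have h1 := (dρ (P w) (t / r) hx1).comp t hdiv
    have h2 := (dω (P w) (t / r) hx1).comp t hdiv
    have h3 := (dq (P w) (t / r) hx1).comp t hdiv
    refine (h1.prodMk (h2.prodMk h3)).congr_deriv ?_
    simp only [slopeField]
    refine Prod.ext ?_ (Prod.ext ?_ ?_) <;> simp only <;> field_simp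
  · have := gk (P w) (t / r) hx1
    have h4 : r * (t / r) = t := by field_simp
    rw [h4] at this
    have := mul_pos_of_neg_of_neg ht0 hs.1
    simp only
    linarith

/-! ### Uniqueness at the sonic point -/

theorem eventually_gt_right {f : ℝ → ℝ} {d x : ℝ} (hf : HasDerivAt f d x) (hd : 0 < d) :
    ∀ᶠ z in 𝓝[>] x, f x < f z := by
  have h1 := (hasDerivAt_iff_tendsto_slope.mp hf).mono_left
    (nhdsWithin_mono x fun z (hz : x < z) => hz.ne')
  filter_upwards [h1.eventually (lt_mem_nhds hd), self_mem_nhdsWithin] with z hz hxz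
  rw [slope_def_field] at hz
  have : 0 < z - x := sub_pos.mpr hxz
  have := (div_pos_iff_of_pos_right this).mp hz
  linarith

theorem eventually_lt_left {f : ℝ → ℝ} {d x : ℝ} (hf : HasDerivAt f d x) (hd : 0 < d) :
    ∀ᶠ z in 𝓝[<] x, f z < f x := by
  have h1 := (hasDerivAt_iff_tendsto_slope.mp hf).mono_left
    (nhdsWithin_mono x fun z (hz : z < x) => hz.ne)
  filter_upwards [h1.eventually (lt_mem_nhds hd), self_mem_nhdsWithin] with z hz hxz
  rw [slope_def_field, ← neg_div_neg_eq] at hz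
  have hxz : z < x := hxz
  have := (div_pos_iff_of_pos_right (by linarith)).mp hz
  linarith

/-- A smooth solution through the sonic point of the curve with relative velocity `w`, with the
slope of Larson-Penston-Hunter type. -/
structure SonicGerm (γ w : ℝ) (u : ℝ → ℝ × ℝ × ℝ) (R : ℝ → ℝ) : Prop where
  analytic : AnalyticAt ℝ R 0
  init : u 0 = (rhoS γ w, w, w ^ 2)
  init_slope : R 0 = R1 γ w
  ode : ∀ᶠ t in 𝓝 0, HasDerivAt u (slopeField γ (u t) (R t)) t
  slope : ∀ᶠ t in 𝓝 0, ((u t).2.2 - (u t).2.1 ^ 2) * R t = h γ (u t).1 (u t).2.1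

/-- Multiplying the equation by e, the main term is at least (A/2)M² and the perturbation is smaller
than that in absolute value. In the application |e| = M is the maximal difference of two slopes, and
the conclusion says that e² is still increasing there. -/
theorem mul_sub_pos_of_gap {g e S A M B d : ℝ} (hg : 0 < g) (hS : A / 2 ≤ S) (he : |e| = M)
    (hM : 0 < M) (h : g * d = e * S + B) (hB : |B| < A / 2 * M) : 0 < 2 * e * d := by
  have h17 : 0 < g * (e * d) := by
    have h18 : g * (e * d) = e ^ 2 * S + e * B := by linear_combination e * h
    have h19 : e ^ 2 = M ^ 2 := by rw [← he, sq_abs]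
    have h20 : |e * B| < M * (A / 2 * M) := by
      rw [abs_mul, he]; exact mul_lt_mul_of_pos_left hB hM
    have h21 := (abs_lt.mp h20).1
    have h22 : e ^ 2 * (A / 2) ≤ e ^ 2 * S := by gcongr
    rw [h18]
    rw [h19] at h22 ⊢
    linarith [show M ^ 2 * (A / 2) = M * (A / 2 * M) by ring]
  have := pos_of_mul_pos_right h17 hg.le
  linarith

theorem hasDerivAt_h_slope {γ : ℝ} {u : ℝ → ℝ × ℝ × ℝ} {R t : ℝ}
    (hu : HasDerivAt u (slopeField γ (u t) R) t) :
    HasDerivAt (fun s => h γ (u s).1 (u s).2.1) (hRate γ (u t).1 (u t).2.1 R) t := by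
  have h1 : HasDerivAt (fun s => (u s).1) ((u t).1 * R) t :=
    (ContinuousLinearMap.fst ℝ ℝ (ℝ × ℝ)).hasFDerivAt.comp_hasDerivAt t hu
  have h2 : HasDerivAt (fun s => (u s).2.1) (relVel γ (u t).2.1 R) t :=
    (ContinuousLinearMap.fst ℝ ℝ ℝ ∘L .snd ℝ ℝ (ℝ × ℝ)).hasFDerivAt.comp_hasDerivAt t hu
  simpa using hasDerivAt_h (γ := γ) (c := 1) (R := R) (by simpa using h1) (by simpa using h2)

theorem hasDerivAt_gap_slope {γ : ℝ} {u : ℝ → ℝ × ℝ × ℝ} {R t : ℝ}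
    (hu : HasDerivAt u (slopeField γ (u t) R) t) :
    HasDerivAt (fun s => (u s).2.2 - (u s).2.1 ^ 2) (gRate γ (u t).2.1 (u t).2.2 R) t := by
  have h1 : HasDerivAt (fun s => (u s).2.2) ((u t).2.2 * ((γ - 1) * R - 2)) t :=
    (ContinuousLinearMap.snd ℝ ℝ ℝ ∘L .snd ℝ ℝ (ℝ × ℝ)).hasFDerivAt.comp_hasDerivAt t hu
  have h2 : HasDerivAt (fun s => (u s).2.1) (relVel γ (u t).2.1 R) t :=
    (ContinuousLinearMap.fst ℝ ℝ ℝ ∘L .snd ℝ ℝ (ℝ × ℝ)).hasFDerivAt.comp_hasDerivAt t hu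
  simpa using hasDerivAt_gap (γ := γ) (c := 1) (R := R) (by simpa using h2) (by simpa using h1)

/-- The equation for the derivative of the slope. -/
theorem gap_mul_deriv {γ : ℝ} {u : ℝ → ℝ × ℝ × ℝ} {R : ℝ → ℝ} {t d : ℝ}
    (hu : HasDerivAt u (slopeField γ (u t) (R t)) t) (hR : HasDerivAt R d t)
    (hs : ∀ᶠ s in 𝓝 t, ((u s).2.2 - (u s).2.1 ^ 2) * R s = h γ (u s).1 (u s).2.1) :
    ((u t).2.2 - (u t).2.1 ^ 2) * d = excess γ (u t).1 (u t).2.1 (u t).2.2 (R t) := by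
  have h1 := (hasDerivAt_gap_slope hu).fun_mul hR
  have h2 := (h1.congr_of_eventuallyEq (hs.mono fun s e => e.symm)).unique (hasDerivAt_h_slope hu)
  unfold excess
  linarith

namespace SonicGerm

variable {γ w : ℝ} {u u' : ℝ → ℝ × ℝ × ℝ} {R R' : ℝ → ℝ}

theorem continuousAt (H : SonicGerm γ w u R) : ContinuousAt u 0 :=
  H.ode.self_of_nhds.continuousAt

theorem gap_pos (hγ : γ ∈ Ioo (1 : ℝ) (4 / 3)) (hw : w ∈ Icc (omegaF γ) (2 - γ))
    (H : SonicGerm γ w u R) : ∀ᶠ t in 𝓝[<] 0, 0 < (u t).2.2 - (u t).2.1 ^ 2 := by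
  have h1 := (hasDerivAt_gap_slope H.ode.self_of_nhds).neg
  have h2 : 0 < -gRate γ (u 0).2.1 (u 0).2.2 (R 0) := by
    rw [H.init, H.init_slope]
    linarith [gRate_R1_neg hγ hw]
  filter_upwards [eventually_lt_left h1 h2] with t ht
  simp only [Pi.neg_apply, H.init] at ht
  linarith

-- The difference e of two slopes satisfies g·e' = e·S + B. To the left of the sonic point g > 0, S
-- is bounded below by A/2 > 0, and B is controlled by the difference of the states, which is small
-- relative to max |e|. A positive maximum of |e| on [-δ, 0] is not attained at 0, where e = 0.
-- Elsewhere e² would be increasing there, contradicting maximality.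
set_option maxHeartbeats 1000000 in
theorem eventually_eq (hγ : γ ∈ Ioo (1 : ℝ) (4 / 3)) (hw : w ∈ Icc (omegaF γ) (2 - γ))
    (H : SonicGerm γ w u R) (H' : SonicGerm γ w u' R') :
    ∀ᶠ t in 𝓝[≤] 0, u t = u' t ∧ R t = R' t := by
  -- Lipschitz bounds
  let Φ : (ℝ × ℝ × ℝ) × ℝ → ℝ × ℝ × ℝ × ℝ × ℝ := fun p =>
    (excess γ p.1.1 p.1.2.1 p.1.2.2 p.2, p.1.2.2 - p.1.2.1 ^ 2, slopeField γ p.1 p.2)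
  have hΦ : ContDiff ℝ 1 Φ := by
    simp only [Φ]; unfold excess hRate gRate slopeField relVel; fun_prop
  obtain ⟨K, s, hs, hK⟩ := hΦ.contDiffAt.exists_lipschitzOnWith (x := (u 0, R 0))
  have hu0 : u' 0 = u 0 := by rw [H.init, H'.init]
  have hR0 : R' 0 = R 0 := by rw [H.init_slope, H'.init_slope]
  have c1 : Tendsto (fun t => (u t, R t)) (𝓝 0) (𝓝 (u 0, R 0)) :=
    (H.continuousAt.prodMk H.analytic.continuousAt)
  have c2 : Tendsto (fun t => (u' t, R' t)) (𝓝 0) (𝓝 (u 0, R 0)) := by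
    have := (H'.continuousAt.prodMk H'.analytic.continuousAt).tendsto
    rwa [hu0, hR0] at this
  have c3 : Tendsto (fun t => (u t, R' t)) (𝓝 0) (𝓝 (u 0, R 0)) := by
    have := (H.continuousAt.prodMk H'.analytic.continuousAt).tendsto
    rwa [hR0] at this
  -- the slope of the nonlinearity
  set A := excessSlope γ (rhoS γ w) w (w ^ 2) (R1 γ w) (R1 γ w) with hA
  have hA0 : 0 < A := excessSlope_R1_pos hγ hw
  have c4 : ∀ᶠ t in 𝓝 0, A / 2 < excessSlope γ (u t).1 (u t).2.1 (u t).2.2 (R t) (R' t) := by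
    have hc : Continuous fun p : (ℝ × ℝ × ℝ) × ℝ × ℝ =>
        excessSlope γ p.1.1 p.1.2.1 p.1.2.2 p.2.1 p.2.2 := by
      unfold excessSlope; fun_prop
    have := hc.continuousAt.tendsto.comp (H.continuousAt.prodMk
      (H.analytic.continuousAt.prodMk H'.analytic.continuousAt)).tendsto
    refine this.eventually (lt_mem_nhds ?_)
    rw [hR0, H.init, H.init_slope]
    exact half_lt_self hA0
  -- bound for the derivative of the slope
  set C := |deriv R' 0| + 1 with hC
  have c5 : ∀ᶠ t in 𝓝 0, |deriv R' t| < C :=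
    H'.analytic.deriv.continuousAt.abs.eventually (gt_mem_nhds (by rw [hC]; linarith))
  have c6 := H.analytic.eventually_analyticAt
  have c7 := H'.analytic.eventually_analyticAt
  have c8 := eventually_nhdsWithin_iff.mp (H.gap_pos hγ hw)
  have hall := (((c1.eventually hs).and ((c2.eventually hs).and (c3.eventually hs))).and
    (c4.and c5)).and ((c6.and c7).and (c8.and (H.ode.and (H'.ode.and
      ((eventually_eventually_nhds.mpr H.slope).and (eventually_eventually_nhds.mpr H'.slope))))))
  obtain ⟨δ₀, hδ₀, hball⟩ := Metric.eventually_nhds_iff.mp hall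
  have hK0 : (0 : ℝ) ≤ K := K.2
  have hC0 : 0 < C := by positivity
  -- The bound Kδ ≤ 1/2 makes the difference N of the states at most the difference M of the slopes.
  -- The last inequality makes the perturbation smaller than (A/2)M.
  obtain ⟨δ, hδ, hδ1, hδ2, hδ3⟩ : ∃ δ : ℝ, 0 < δ ∧ δ < δ₀ ∧ K * δ ≤ 1 / 2 ∧
      K * (1 + C) * (2 * K * δ) < A / 2 := by
    have hcont : Tendsto (fun δ : ℝ => K * (1 + C) * (2 * K * δ)) (𝓝[>] 0) (𝓝 0) := by
      have : Continuous (fun δ : ℝ => K * (1 + C) * (2 * K * δ)) := by fun_prop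
      simpa using (this.tendsto 0).mono_left nhdsWithin_le_nhds
    have hcont2 : Tendsto (fun δ : ℝ => K * δ) (𝓝[>] 0) (𝓝 0) := by
      have : Continuous (fun δ : ℝ => K * δ) := by fun_prop
      simpa using (this.tendsto 0).mono_left nhdsWithin_le_nhds
    have := ((hcont.eventually (gt_mem_nhds (half_pos hA0))).and
      ((hcont2.eventually (gt_mem_nhds (by norm_num : (0 : ℝ) < 1 / 2))).and
        ((Ioo_mem_nhdsGT hδ₀ : Ioo 0 δ₀ ∈ 𝓝[>] 0)))).exists
    obtain ⟨δ, h1, h2, h3⟩ := this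
    exact ⟨δ, h3.1, h3.2, h2.le, h1⟩
  have hmem : ∀ t ∈ Icc (-δ) 0, dist t 0 < δ₀ := fun t ht => by
    rw [Real.dist_eq, sub_zero, abs_lt]; exact ⟨by linarith [ht.1], by linarith [ht.2]⟩
  have hcR : ContinuousOn (fun t => |R t - R' t|) (Icc (-δ) 0) := fun t ht => by
    obtain ⟨-, ⟨⟨h1, h2⟩, -⟩⟩ := hball (hmem t ht)
    exact (h1.continuousAt.sub h2.continuousAt).abs.continuousWithinAt
  have hcu : ContinuousOn (fun t => ‖u t - u' t‖) (Icc (-δ) 0) := fun t ht => by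
    obtain ⟨-, -, -, h1, h2, -⟩ := hball (hmem t ht)
    exact (h1.continuousAt.sub h2.continuousAt).norm.continuousWithinAt
  have hne : (Icc (-δ) 0).Nonempty := nonempty_Icc.mpr (by linarith)
  obtain ⟨tm, htm, hmax⟩ := isCompact_Icc.exists_isMaxOn hne hcR
  obtain ⟨tn, htn, hmaxn⟩ := isCompact_Icc.exists_isMaxOn hne hcu
  set M := |R tm - R' tm| with hM
  set N := ‖u tn - u' tn‖ with hN
  have hM0 : 0 ≤ M := abs_nonneg _
  have hN0 : 0 ≤ N := norm_nonneg _
  have hMle : ∀ t ∈ Icc (-δ) 0, |R t - R' t| ≤ M := fun t ht => hmax ht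
  have hNle : ∀ t ∈ Icc (-δ) 0, ‖u t - u' t‖ ≤ N := fun t ht => hmaxn ht
  have hlip : ∀ p ∈ s, ∀ p' ∈ s, ‖Φ p - Φ p'‖ ≤ K * ‖p - p'‖ := fun p hp p' hp' =>
    hK.norm_sub_le hp hp'
  have hmv : ∀ t ∈ Icc (-δ) 0, ‖u t - u' t‖ ≤ K * (N + M) * |t| := by
    intro t ht
    have := Convex.norm_image_sub_le_of_norm_hasDerivWithin_le (f := fun t => u t - u' t)
      (f' := fun t => slopeField γ (u t) (R t) - slopeField γ (u' t) (R' t)) (C := K * (N + M))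
      (s := Icc (-δ) 0) (x := 0) (y := t)
      (fun x hx => by
        obtain ⟨-, -, -, h1, h2, -⟩ := hball (hmem x hx)
        exact (h1.sub h2).hasDerivWithinAt)
      (fun x hx => by
        obtain ⟨⟨⟨h1, h2, -⟩, -⟩, -⟩ := hball (hmem x hx)
        have h3 := hlip _ h1 _ h2
        have h4 : ‖slopeField γ (u x) (R x) - slopeField γ (u' x) (R' x)‖
            ≤ ‖Φ (u x, R x) - Φ (u' x, R' x)‖ :=
          (norm_snd_le (Φ (u x, R x) - Φ (u' x, R' x)).2).trans (norm_snd_le _)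
        have h5 : ‖((u x, R x) : (ℝ × ℝ × ℝ) × ℝ) - (u' x, R' x)‖ ≤ N + M := by
          refine max_le ?_ ?_
          · exact (hNle x hx).trans (by linarith)
          · exact (hMle x hx).trans (by linarith)
        exact h4.trans (h3.trans (by gcongr)))
      (convex_Icc _ _) ⟨by linarith, le_rfl⟩ ht
    simpa [hu0] using this
  have hNM : N ≤ M := by
    have h1 := hmv tn htn
    have h2 : |tn| ≤ δ := abs_le.mpr ⟨htn.1, htn.2.trans hδ.le⟩
    have h3 : K * (N + M) * |tn| ≤ (N + M) * (1 / 2) := by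
      calc K * (N + M) * |tn| ≤ K * (N + M) * δ := by gcongr
        _ = (N + M) * (K * δ) := by ring
        _ ≤ (N + M) * (1 / 2) := by gcongr
    linarith
  have hM00 : M = 0 := by
    by_contra hne0
    have hMpos : 0 < M := lt_of_le_of_ne hM0 (Ne.symm hne0)
    have htm0 : tm < 0 := by
      refine lt_of_le_of_ne htm.2 fun h0 => hne0 ?_
      rw [hM, h0, hR0, sub_self, abs_zero]
    obtain ⟨⟨⟨h1, h2, h3⟩, h4, h5⟩, ⟨h6, h7⟩, h8, h9, h10, h11, h12⟩ := hball (hmem tm htm)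
    have hg := h8 htm0
    have e1 := gap_mul_deriv h9 h6.differentiableAt.hasDerivAt h11
    have e2 := gap_mul_deriv h10 h7.differentiableAt.hasDerivAt h12
    have e3 := excess_sub γ (u tm).1 (u tm).2.1 (u tm).2.2 (R tm) (R' tm)
    have hum : ‖u tm - u' tm‖ ≤ 2 * K * δ * M := by
      refine (hmv tm htm).trans ?_
      have : |tm| ≤ δ := abs_le.mpr ⟨htm.1, htm.2.trans hδ.le⟩
      calc K * (N + M) * |tm| ≤ K * (M + M) * δ := by gcongr
        _ = 2 * K * δ * M := by ring
    have h13 := hlip _ h3 _ h2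
    have h14 : ‖((u tm, R' tm) : (ℝ × ℝ × ℝ) × ℝ) - (u' tm, R' tm)‖ ≤ 2 * K * δ * M := by
      refine max_le hum ?_
      simp only [Prod.snd_sub, sub_self, norm_zero]
      positivity
    have h15 : |excess γ (u tm).1 (u tm).2.1 (u tm).2.2 (R' tm)
        - excess γ (u' tm).1 (u' tm).2.1 (u' tm).2.2 (R' tm)| ≤ K * (2 * K * δ * M) :=
      (norm_fst_le (Φ (u tm, R' tm) - Φ (u' tm, R' tm))).trans (h13.trans (by gcongr))
    have h16 : |((u tm).2.2 - (u tm).2.1 ^ 2) - ((u' tm).2.2 - (u' tm).2.1 ^ 2)|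
        ≤ K * (2 * K * δ * M) :=
      ((norm_fst_le (Φ (u tm, R' tm) - Φ (u' tm, R' tm)).2).trans (norm_snd_le _)).trans
        (h13.trans (by gcongr))
    -- the derivative of the square of the difference of the slopes is positive
    have hd : HasDerivAt (fun t => (R t - R' t) ^ 2)
        (2 * (R tm - R' tm) * (deriv R tm - deriv R' tm)) tm := by
      refine ((h6.differentiableAt.hasDerivAt.fun_sub
        h7.differentiableAt.hasDerivAt).fun_pow 2).congr_deriv ?_
      push_cast; ring
    have hpos : 0 < 2 * (R tm - R' tm) * (deriv R tm - deriv R' tm) := by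
      set g := (u tm).2.2 - (u tm).2.1 ^ 2 with hgdef
      set g' := (u' tm).2.2 - (u' tm).2.1 ^ 2 with hgdef'
      set e := R tm - R' tm with he
      set S := excessSlope γ (u tm).1 (u tm).2.1 (u tm).2.2 (R tm) (R' tm)
      set Q := excess γ (u tm).1 (u tm).2.1 (u tm).2.2 (R' tm)
        - excess γ (u' tm).1 (u' tm).2.1 (u' tm).2.2 (R' tm) with hQ
      have e4 : g * (deriv R tm - deriv R' tm) = e * S + (Q - (g - g') * deriv R' tm) := by
        rw [hQ]; linarith
      have hbd : |Q - (g - g') * deriv R' tm| < A / 2 * M := by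
        calc |Q - (g - g') * deriv R' tm| ≤ |Q| + |g - g'| * |deriv R' tm| := by
              rw [← abs_mul]; exact abs_sub _ _
          _ ≤ K * (2 * K * δ * M) + K * (2 * K * δ * M) * C := by gcongr
          _ = K * (1 + C) * (2 * K * δ) * M := by ring
          _ < A / 2 * M := by gcongr
      exact mul_sub_pos_of_gap hg h4.le hM.symm hMpos e4 hbd
    obtain ⟨z, hz1, hz2⟩ := ((eventually_gt_right hd hpos).and (Ioo_mem_nhdsGT htm0)).exists
    have := hMle z ⟨htm.1.trans hz2.1.le, hz2.2.le⟩
    exact absurd (sq_lt_sq.mp hz1) (not_lt.mpr this)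
  have hN00 : N = 0 := le_antisymm (hM00 ▸ hNM) hN0
  have : Icc (-δ) 0 ∈ 𝓝[≤] (0 : ℝ) := Icc_mem_nhdsLE (by linarith)
  filter_upwards [this] with t ht
  constructor
  · exact sub_eq_zero.mp (norm_le_zero_iff.mp (hN00 ▸ hNle t ht))
  · exact sub_eq_zero.mp (abs_nonpos_iff.mp (hM00 ▸ hMle t ht))

end SonicGerm

/-! ### Autonomous differential equations on open sets -/

section Flow

variable {E : Type*} [NormedAddCommGroup E] [NormedSpace ℝ E]

/-- `v` solves `v' = X v` in `Ω` on the interval `(a, b)`. -/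
def SolvesOn (X : E → E) (Ω : Set E) (a b : ℝ) (v : ℝ → E) : Prop :=
  ∀ t ∈ Ioo a b, HasDerivAt v (X (v t)) t ∧ v t ∈ Ω

theorem SolvesOn.mono {X : E → E} {Ω : Set E} {a b a' b' : ℝ} {v : ℝ → E}
    (h : SolvesOn X Ω a b v) (ha : a ≤ a') (hb : b' ≤ b) : SolvesOn X Ω a' b' v :=
  fun t ht => h t ⟨ha.trans_lt ht.1, ht.2.trans_le hb⟩

theorem SolvesOn.congr {X : E → E} {Ω : Set E} {a b : ℝ} {v w : ℝ → E}
    (h : SolvesOn X Ω a b v) (e : EqOn w v (Ioo a b)) : SolvesOn X Ω a b w := fun t ht => by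
  have h1 : w =ᶠ[𝓝 t] v := by
    filter_upwards [isOpen_Ioo.mem_nhds ht] with s hs using e hs
  rw [e ht]
  exact ⟨(h t ht).1.congr_of_eventuallyEq h1, (h t ht).2⟩

/-- Multiplying by a bump function gives a globally Lipschitz, bounded field that agrees with X near
the compact set. Existence and uniqueness questions on Ω thereby reduce to fields with global
solutions. -/
theorem exists_cutoff [FiniteDimensional ℝ E] {X : E → E} {Ω C : Set E} (hΩ : IsOpen Ω)
    (hX : ContDiffOn ℝ 1 X Ω) (hC : IsCompact C) (hCΩ : C ⊆ Ω) :
    ∃ (Y : E → E) (K : NNReal) (M : ℝ) (U : Set E), LipschitzWith K Y ∧ (∀ x, ‖Y x‖ ≤ M) ∧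
      IsOpen U ∧ C ⊆ U ∧ U ⊆ Ω ∧ ∀ x ∈ U, Y x = X x := by
  obtain ⟨C', hC', h1, h2⟩ := exists_compact_between hC hΩ hCΩ
  obtain ⟨χ, hχ1, hχ0, -⟩ := exists_contMDiffMap_one_nhds_of_subset_interior
    (n := 1) (modelWithCornersSelf ℝ E) hC.isClosed h1
  have hχ : ContDiff ℝ 1 χ := χ.contMDiff.contDiff
  have hY : ContDiff ℝ 1 fun x => χ x • X x := by
    rw [contDiff_iff_contDiffAt]
    intro x
    by_cases hx : x ∈ Ω
    · exact hχ.contDiffAt.smul (hX.contDiffAt (hΩ.mem_nhds hx))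
    · have : (fun x => χ x • X x) =ᶠ[𝓝 x] fun _ => 0 := by
        filter_upwards [hC'.isClosed.isOpen_compl.mem_nhds fun hx' => hx (h2 hx')] with y hy
        rw [hχ0 y hy, zero_smul]
      exact contDiffAt_const.congr_of_eventuallyEq this
  have hsupp : HasCompactSupport fun x => χ x • X x :=
    HasCompactSupport.intro hC' fun x hx => by simp only [hχ0 x hx, zero_smul]
  obtain ⟨K, hK⟩ := ContDiff.lipschitzWith_of_hasCompactSupport hsupp hY one_ne_zero
  obtain ⟨M, hM⟩ := hY.continuous.bounded_above_of_compact_support hsupp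
  obtain ⟨U, hU, hCU, hU1⟩ := eventually_nhdsSet_iff_exists.mp hχ1
  refine ⟨_, K, M, U ∩ Ω, hK, hM, hU.inter hΩ, subset_inter hCU hCΩ, inter_subset_right,
    fun x hx => ?_⟩
  rw [hU1 x hx.1, one_smul]

theorem exists_global_solution [CompleteSpace E] {Y : E → E} {K : NNReal} {M : ℝ}
    (hK : LipschitzWith K Y) (hM : ∀ x, ‖Y x‖ ≤ M) (t₀ : ℝ) (x : E) {T : ℝ} (hT : 0 < T) :
    ∃ v : ℝ → E, v t₀ = x ∧ ∀ t ∈ Ioo (t₀ - T) (t₀ + T), HasDerivAt v (Y (v t)) t := by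
  have hM0 : 0 ≤ M := (norm_nonneg _).trans (hM x)
  have ht₀ : t₀ ∈ Icc (t₀ - T) (t₀ + T) := ⟨by linarith, by linarith⟩
  have hpl : IsPicardLindelof (fun _ => Y) (tmin := t₀ - T) (tmax := t₀ + T) ⟨t₀, ht₀⟩ x
      ⟨M * T, by positivity⟩ 0 ⟨M, hM0⟩ K := by
    refine IsPicardLindelof.of_time_independent (fun y _ => hM y) hK.lipschitzOnWith ?_
    simp only [add_sub_cancel_left, sub_sub_cancel, max_self, NNReal.coe_zero, sub_zero]
    exact le_rfl
  obtain ⟨v, hv, hd⟩ := hpl.exists_eq_forall_mem_Icc_hasDerivWithinAt₀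
  exact ⟨v, hv, fun t ht => (hd t (Ioo_subset_Icc_self ht)).hasDerivAt (Icc_mem_nhds ht.1 ht.2)⟩

theorem SolvesOn.continuousOn {X : E → E} {Ω : Set E} {a b : ℝ} {v : ℝ → E}
    (h : SolvesOn X Ω a b v) : ContinuousOn v (Ioo a b) :=
  fun t ht => (h t ht).1.continuousAt.continuousWithinAt

variable [FiniteDimensional ℝ E] {X : E → E} {Ω : Set E}

theorem SolvesOn.eqOn (hΩ : IsOpen Ω) (hX : ContDiffOn ℝ 1 X Ω) {a b t₀ : ℝ} {v w : ℝ → E}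
    (hv : SolvesOn X Ω a b v) (hw : SolvesOn X Ω a b w) (ht₀ : t₀ ∈ Ioo a b) (h : v t₀ = w t₀) :
    EqOn v w (Ioo a b) := by
  intro t ht
  obtain ⟨a', ha', ha''⟩ := exists_between (lt_min ht₀.1 ht.1)
  obtain ⟨b', hb', hb''⟩ := exists_between (max_lt ht₀.2 ht.2)
  have hsub : Icc a' b' ⊆ Ioo a b := fun s hs => ⟨ha'.trans_le hs.1, hs.2.trans_lt hb''⟩
  have hC : IsCompact (v '' Icc a' b' ∪ w '' Icc a' b') :=
    (isCompact_Icc.image_of_continuousOn (hv.continuousOn.mono hsub)).union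
      (isCompact_Icc.image_of_continuousOn (hw.continuousOn.mono hsub))
  have hCΩ : v '' Icc a' b' ∪ w '' Icc a' b' ⊆ Ω := by
    rintro _ (⟨s, hs, rfl⟩ | ⟨s, hs, rfl⟩)
    · exact (hv s (hsub hs)).2
    · exact (hw s (hsub hs)).2
  obtain ⟨Y, K, M, U, hK, -, -, hCU, -, hYX⟩ := exists_cutoff hΩ hX hC hCΩ
  refine ODE_solution_unique_of_mem_Ioo (v := fun _ => Y) (s := fun _ => univ) (K := K) (t₀ := t₀)
    (a := a') (b := b') (fun _ _ => hK.lipschitzOnWith)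
    ⟨ha''.trans_le (min_le_left _ _), (le_max_left _ _).trans_lt hb'⟩ (fun s hs => ?_)
    (fun s hs => ?_) h ⟨ha''.trans_le (min_le_right _ _), (le_max_right _ _).trans_lt hb'⟩
  · have hs := Ioo_subset_Icc_self hs
    rw [hYX _ (hCU (Or.inl ⟨s, hs, rfl⟩))]
    exact ⟨(hv s (hsub hs)).1, mem_univ _⟩
  · have hs := Ioo_subset_Icc_self hs
    rw [hYX _ (hCU (Or.inr ⟨s, hs, rfl⟩))]
    exact ⟨(hw s (hsub hs)).1, mem_univ _⟩

/-- A solution that stays in a compact subset of `Ω` extends beyond the end of its interval. -/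
theorem SolvesOn.exists_extension (hΩ : IsOpen Ω) (hX : ContDiffOn ℝ 1 X Ω) {C : Set E}
    (hC : IsCompact C) (hCΩ : C ⊆ Ω) {a b c : ℝ} (hac : a < c) (hcb : c ≤ b) {u : ℝ → E}
    (hu : SolvesOn X Ω a b u) (huC : ∀ t ∈ Ioo a c, u t ∈ C) :
    ∃ a' < a, ∃ v, EqOn v u (Ioo a b) ∧ (∀ t, c ≤ t → v t = u t) ∧ SolvesOn X Ω a' b v := by
  obtain ⟨Y, K, M, U, hK, hM, hU, hCU, hUΩ, hYX⟩ := exists_cutoff hΩ hX hC hCΩ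
  obtain ⟨t₀, ht₀⟩ := exists_between hac
  obtain ⟨w, hw0, hw⟩ := exists_global_solution hK hM t₀ (u t₀) (T := t₀ - a + 1)
    (by linarith [ht₀.1])
  set b' := min c (t₀ + (t₀ - a + 1)) with hb'
  have ht₀b : t₀ < b' := lt_min ht₀.2 (by linarith [ht₀.1])
  have hYu : ∀ t ∈ Ioo a b', HasDerivAt u (Y (u t)) t ∧ u t ∈ univ := fun t ht => by
    have htc : t < c := ht.2.trans_le (min_le_left _ _)
    rw [hYX _ (hCU (huC t ⟨ht.1, htc⟩))]
    exact ⟨(hu t ⟨ht.1, htc.trans_le hcb⟩).1, mem_univ _⟩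
  have heq : EqOn u w (Ioo a b') :=
    ODE_solution_unique_of_mem_Ioo (v := fun _ => Y) (s := fun _ => univ) (K := K)
      (fun _ _ => hK.lipschitzOnWith) ⟨ht₀.1, ht₀b⟩ hYu
      (fun t ht => ⟨hw t ⟨by linarith [ht.1], ht.2.trans_le (min_le_right _ _)⟩, mem_univ _⟩)
      hw0.symm
  have hwa : ContinuousAt w a := (hw a ⟨by linarith, by linarith [ht₀.1]⟩).continuousAt
  have hwaC : w a ∈ C := by
    refine hC.isClosed.mem_of_tendsto (hwa.tendsto.mono_left nhdsWithin_le_nhds)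
      (f := w) (b := 𝓝[>] a) ?_
    filter_upwards [Ioo_mem_nhdsGT (ht₀.1.trans ht₀b)] with t ht
    rw [← heq ht]
    exact huC t ⟨ht.1, ht.2.trans_le (min_le_left _ _)⟩
  have hev : ∀ᶠ t in 𝓝 a, w t ∈ U := hwa.eventually (hU.mem_nhds (hCU hwaC))
  obtain ⟨ε, hε, hball⟩ := Metric.eventually_nhds_iff.mp hev
  refine ⟨a - min ε (1 / 2), by have : 0 < min ε (1 / 2) := by positivity
                                linarith, fun t => if t ≤ t₀ then w t else u t, ?_, ?_, ?_⟩
  · intro t ht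
    by_cases h : t ≤ t₀
    · simp only [h, if_true]
      exact (heq ⟨ht.1, h.trans_lt ht₀b⟩).symm
    · simp only [h, if_false]
  · intro t ht
    have : ¬ t ≤ t₀ := not_le.mpr (ht₀.2.trans_le ht)
    simp only [this, if_false]
  · intro t ht
    rcases lt_or_ge a t with h | h
    · have e : EqOn (fun t => if t ≤ t₀ then w t else u t) u (Ioo a b) := by
        intro t ht
        by_cases h : t ≤ t₀
        · simp only [h, if_true]
          exact (heq ⟨ht.1, h.trans_lt ht₀b⟩).symm
        · simp only [h, if_false]
      exact hu.congr e t ⟨h, ht.2⟩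
    · have h0 : t < t₀ := h.trans_lt ht₀.1
      have h1 : (fun t => if t ≤ t₀ then w t else u t) =ᶠ[𝓝 t] w := by
        filter_upwards [isOpen_Iio.mem_nhds h0] with s hs
        have : s ≤ t₀ := le_of_lt hs
        simp only [this, if_true]
      have hm1 := min_le_left ε (1 / 2)
      have hm2 := min_le_right ε (1 / 2)
      have h2 : w t ∈ U := hball (by
        rw [Real.dist_eq, abs_of_nonpos (by linarith)]; linarith [ht.1])
      simp only [h0.le, if_true]
      rw [← hYX _ h2]
      refine ⟨(hw t ⟨by linarith [ht.1], by linarith⟩).congr_of_eventuallyEq h1, hUΩ h2⟩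

/-- Continuous dependence on the final value. -/
theorem SolvesOn.exists_near (hΩ : IsOpen Ω) (hX : ContDiffOn ℝ 1 X Ω) {a b a₁ b₁ ε : ℝ}
    (ha : a < a₁) (hab : a₁ ≤ b₁) (hb : b₁ < b) (hε : 0 < ε) {u : ℝ → E}
    (hu : SolvesOn X Ω a b u) :
    ∃ δ > 0, ∀ x, dist x (u b₁) < δ → ∃ v, v b₁ = x ∧
      (∃ η > 0, SolvesOn X Ω (a₁ - η) (b₁ + η) v) ∧
      ∀ t ∈ Icc a₁ b₁, dist (v t) (u t) < ε ∧ dist (X (v t)) (X (u t)) < ε := by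
  have hsub : Icc a₁ b₁ ⊆ Ioo a b := fun s hs => ⟨ha.trans_le hs.1, hs.2.trans_lt hb⟩
  have hC : IsCompact (u '' Icc a₁ b₁) :=
    isCompact_Icc.image_of_continuousOn (hu.continuousOn.mono hsub)
  have hCΩ : u '' Icc a₁ b₁ ⊆ Ω := by
    rintro _ ⟨s, hs, rfl⟩
    exact (hu s (hsub hs)).2
  obtain ⟨Y, K, M, U, hK, hM, hU, hCU, hUΩ, hYX⟩ := exists_cutoff hΩ hX hC hCΩ
  obtain ⟨d, hd, hdU⟩ := hC.exists_thickening_subset_open hU hCU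
  set L := Real.exp (K * (b₁ - a₁)) with hL
  have hL0 : 0 < L := Real.exp_pos _
  -- Closeness d keeps the perturbed curve inside U, where the cut-off field is X. Closeness ε/(K+1)
  -- makes the field values ε-close. Dividing by the Grönwall factor L later gives the tolerance on
  -- the final value.
  set m := min (min ε d) (ε / (K + 1)) with hm
  have hm0 : 0 < m := by positivity
  refine ⟨m / L, by positivity, fun x hx => ?_⟩
  obtain ⟨v, hv0, hv⟩ := exists_global_solution hK hM b₁ x (T := b₁ - a₁ + 1) (by linarith)
  have hdist : ∀ t ∈ Icc a₁ b₁, dist (v t) (u t) < m := by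
    intro t ht
    have hrev : ∀ s : ℝ, HasDerivAt (fun s : ℝ => b₁ - s) (-1) s := fun s =>
      (hasDerivAt_id s).const_sub b₁
    have hv' : ∀ s ∈ Icc 0 (b₁ - a₁), HasDerivAt (fun s => v (b₁ - s)) (-Y (v (b₁ - s))) s :=
      fun s hs => by
        have := (hv (b₁ - s) ⟨by linarith [hs.2], by linarith [hs.1]⟩).scomp s (hrev s)
        simpa [Function.comp_def] using this
    have hu' : ∀ s ∈ Icc 0 (b₁ - a₁), HasDerivAt (fun s => u (b₁ - s)) (-Y (u (b₁ - s))) s :=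
      fun s hs => by
        have hs' : b₁ - s ∈ Icc a₁ b₁ := ⟨by linarith [hs.2], by linarith [hs.1]⟩
        have := (hu (b₁ - s) (hsub hs')).1.scomp s (hrev s)
        rw [hYX _ (hCU ⟨_, hs', rfl⟩)]
        simpa [Function.comp_def] using this
    have key := dist_le_of_trajectories_ODE (v := fun _ x => -Y x) (K := K) (δ := dist x (u b₁))
      (fun _ => hK.neg)
      (fun s hs => (hv' s hs).continuousAt.continuousWithinAt)
      (fun s hs => (hv' s (Ico_subset_Icc_self hs)).hasDerivWithinAt)
      (fun s hs => (hu' s hs).continuousAt.continuousWithinAt)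
      (fun s hs => (hu' s (Ico_subset_Icc_self hs)).hasDerivWithinAt)
      (by simp [hv0]) (b₁ - t) ⟨by linarith [ht.2], by linarith [ht.1]⟩
    simp only [sub_sub_cancel, sub_zero] at key
    calc dist (v t) (u t) ≤ dist x (u b₁) * Real.exp (K * (b₁ - t)) := key
      _ ≤ dist x (u b₁) * L := by
        rw [hL]; gcongr; exact ht.1
      _ < m / L * L := by gcongr
      _ = m := by field_simp
  have hvU : ∀ t ∈ Icc a₁ b₁, v t ∈ U := fun t ht => hdU (Metric.mem_thickening_iff.mpr
    ⟨u t, ⟨t, ht, rfl⟩, (hdist t ht).trans_le ((min_le_left _ _).trans (min_le_right _ _))⟩)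
  have hc1 : ∀ᶠ t in 𝓝 a₁, v t ∈ U :=
    (hv a₁ ⟨by linarith, by linarith⟩).continuousAt.eventually
      (hU.mem_nhds (hvU a₁ ⟨le_rfl, hab⟩))
  have hc2 : ∀ᶠ t in 𝓝 b₁, v t ∈ U :=
    (hv b₁ ⟨by linarith, by linarith⟩).continuousAt.eventually
      (hU.mem_nhds (hvU b₁ ⟨hab, le_rfl⟩))
  obtain ⟨ε₁, hε₁, h1⟩ := Metric.eventually_nhds_iff.mp hc1
  obtain ⟨ε₂, hε₂, h2⟩ := Metric.eventually_nhds_iff.mp hc2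
  refine ⟨v, hv0, ⟨min (min ε₁ ε₂) 1, by positivity, fun t ht => ?_⟩, fun t ht => ⟨?_, ?_⟩⟩
  · have hm1 : min (min ε₁ ε₂) 1 ≤ ε₁ := (min_le_left _ _).trans (min_le_left _ _)
    have hm2 : min (min ε₁ ε₂) 1 ≤ ε₂ := (min_le_left _ _).trans (min_le_right _ _)
    have hm3 : min (min ε₁ ε₂) 1 ≤ 1 := min_le_right _ _
    have hvt : v t ∈ U := by
      rcases lt_or_ge t a₁ with h | h
      · exact h1 (by rw [Real.dist_eq, abs_of_neg (by linarith)]; linarith [ht.1])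
      · rcases lt_or_ge b₁ t with h' | h'
        · exact h2 (by rw [Real.dist_eq, abs_of_pos (by linarith)]; linarith [ht.2])
        · exact hvU t ⟨h, h'⟩
    rw [← hYX _ hvt]
    exact ⟨hv t ⟨by linarith [ht.1], by linarith [ht.2]⟩, hUΩ hvt⟩
  · exact (hdist t ht).trans_le ((min_le_left _ _).trans (min_le_left _ _))
  · rw [← hYX _ (hvU t ht), ← hYX _ (hCU ⟨t, ht, rfl⟩)]
    have h3 := (hdist t ht).trans_le (min_le_right _ _)
    have hK0 : (0 : ℝ) ≤ K := K.2
    calc dist (Y (v t)) (Y (u t)) ≤ K * dist (v t) (u t) := hK.dist_le_mul _ _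
      _ ≤ K * (ε / (K + 1)) := by gcongr
      _ < (K + 1) * (ε / (K + 1)) := by gcongr; linarith
      _ = ε := by field_simp

end Flow

/-! ### The autonomous system in logarithmic time -/

/-- The subsonic region in the variables `(ρ, ω, q)`, where `q = γ ρ^(γ-1) / y²`. -/
def subsonicRegion : Set (ℝ × ℝ × ℝ) := {u | 0 < u.1 ∧ u.2.1 ^ 2 < u.2.2}

/-- The logarithmic derivative `y ρ' / ρ`. -/
def rate (γ : ℝ) (u : ℝ × ℝ × ℝ) : ℝ := h γ u.1 u.2.1 / (u.2.2 - u.2.1 ^ 2)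

/-- The vector field of the system in logarithmic time. -/
def field (γ : ℝ) (u : ℝ × ℝ × ℝ) : ℝ × ℝ × ℝ := slopeField γ u (rate γ u)

/-- The derivative `y ω'`. -/
def vel (γ : ℝ) (u : ℝ × ℝ × ℝ) : ℝ := relVel γ u.2.1 (rate γ u)

/-- The derivative of `rate` along the flow. -/
def rateDeriv (γ : ℝ) (u : ℝ × ℝ × ℝ) : ℝ :=
  excess γ u.1 u.2.1 u.2.2 (rate γ u) / (u.2.2 - u.2.1 ^ 2)

/-- The derivative of `vel` along the flow. -/
def accel (γ : ℝ) (u : ℝ × ℝ × ℝ) : ℝ :=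
  -(3 * vel γ u) - (vel γ u * rate γ u + u.2.1 * rateDeriv γ u)

theorem isOpen_subsonicRegion : IsOpen subsonicRegion :=
  IsOpen.and (isOpen_lt continuous_const continuous_fst)
    (isOpen_lt ((continuous_fst.comp continuous_snd).pow 2) (continuous_snd.comp continuous_snd))

theorem contDiffOn_rate (γ : ℝ) : ContDiffOn ℝ 1 (rate γ) subsonicRegion := by
  unfold rate h
  refine ContDiffOn.div (ContDiff.contDiffOn (by fun_prop)) (ContDiff.contDiffOn (by fun_prop))
    fun u hu => (sub_pos.mpr hu.2).ne'

theorem contDiffOn_field (γ : ℝ) : ContDiffOn ℝ 1 (field γ) subsonicRegion := by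
  have hs : ContDiff ℝ 1 fun p : (ℝ × ℝ × ℝ) × ℝ => slopeField γ p.1 p.2 := by
    unfold slopeField relVel; fun_prop
  exact hs.comp_contDiffOn (contDiff_id.contDiffOn.prodMk (contDiffOn_rate γ))

theorem gap_mul_rate {γ : ℝ} {u : ℝ × ℝ × ℝ} (hu : u ∈ subsonicRegion) :
    (u.2.2 - u.2.1 ^ 2) * rate γ u = h γ u.1 u.2.1 := by
  have : u.2.2 - u.2.1 ^ 2 ≠ 0 := (sub_pos.mpr hu.2).ne'
  unfold rate
  field_simp

/-- The second derivative of `ω` in terms of `ω`, its first derivative and the gap. -/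
theorem accel_eq {γ : ℝ} {u : ℝ × ℝ × ℝ} (hu : u ∈ subsonicRegion) (hω : u.2.1 ≠ 0) :
    accel γ u = (3 * u.2.1 - (4 - 3 * γ)) * (2 - γ - u.2.1) *
        ((4 - 3 * γ) / u.2.1 - (γ - 1) * (3 * u.2.1 + 1) / (u.2.2 - u.2.1 ^ 2))
      + vel γ u * (((γ - 1) * (3 * u.2.1 - (4 - 3 * γ)) - (4 - 3 * γ) * (u.2.1 - (1 - γ)))
          / u.2.1 - u.2.1 * (2 * u.2.1 + γ - 1 - 2 * γ * (3 * u.2.1 - (4 - 3 * γ))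
          - (γ + 1) * vel γ u) / (u.2.2 - u.2.1 ^ 2))
      + γ * vel γ u ^ 2 / u.2.1 := by
  obtain ⟨ρ, ω, q⟩ := u
  have hg : q - ω ^ 2 ≠ 0 := (sub_pos.mpr hu.2).ne'
  have e1 := gap_mul_rate (γ := γ) hu
  simp only at hω e1 ⊢
  have e2 : vel γ (ρ, ω, q) = relVel γ ω (rate γ (ρ, ω, q)) := rfl
  rw [h_eq] at e1
  unfold accel rateDeriv excess hRate gRate
  simp only
  rw [← e2]
  set R := rate γ (ρ, ω, q)
  set W := vel γ (ρ, ω, q)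
  set k := 4 * Real.pi / (4 - 3 * γ)
  -- R is eliminated through the definition of W, and ρ through the constraint (q-ω²)R = h. What
  -- remains is a rational identity in ω, W and the gap.
  have hR : R = (4 - 3 * γ - 3 * ω - W) / ω := by
    rw [e2]; unfold relVel; field_simp; ring
  have hk : k * ρ = (2 * ω ^ 2 + (γ - 1) * ω + (γ - 1) * (2 - γ) - (q - ω ^ 2) * R) / ω := by
    field_simp; linarith
  have e3 : -k * ρ * ω * R + (4 * ω + (γ - 1) - k * ρ) * W
      = -(k * ρ) * ω * R + (4 * ω + (γ - 1) - k * ρ) * W := by ring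
  rw [e3, hk, hR]
  clear_value R W k
  field_simp
  ring

namespace SolvesOn

variable {γ a b t : ℝ} {v : ℝ → ℝ × ℝ × ℝ}

theorem hasDerivAt_rho (hv : SolvesOn (field γ) subsonicRegion a b v) (ht : t ∈ Ioo a b) :
    HasDerivAt (fun s => (v s).1) ((v t).1 * rate γ (v t)) t :=
  (ContinuousLinearMap.fst ℝ ℝ (ℝ × ℝ)).hasFDerivAt.comp_hasDerivAt t (hv t ht).1

theorem hasDerivAt_omega (hv : SolvesOn (field γ) subsonicRegion a b v) (ht : t ∈ Ioo a b) :
    HasDerivAt (fun s => (v s).2.1) (vel γ (v t)) t :=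
  (ContinuousLinearMap.fst ℝ ℝ ℝ ∘L .snd ℝ ℝ (ℝ × ℝ)).hasFDerivAt.comp_hasDerivAt t (hv t ht).1

theorem hasDerivAt_q (hv : SolvesOn (field γ) subsonicRegion a b v) (ht : t ∈ Ioo a b) :
    HasDerivAt (fun s => (v s).2.2) ((v t).2.2 * ((γ - 1) * rate γ (v t) - 2)) t :=
  (ContinuousLinearMap.snd ℝ ℝ ℝ ∘L .snd ℝ ℝ (ℝ × ℝ)).hasFDerivAt.comp_hasDerivAt t (hv t ht).1

theorem hasDerivAt_gap (hv : SolvesOn (field γ) subsonicRegion a b v) (ht : t ∈ Ioo a b) :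
    HasDerivAt (fun s => (v s).2.2 - (v s).2.1 ^ 2)
      (gRate γ (v t).2.1 (v t).2.2 (rate γ (v t))) t :=
  hasDerivAt_gap_slope (hv t ht).1

theorem hasDerivAt_rate (hv : SolvesOn (field γ) subsonicRegion a b v) (ht : t ∈ Ioo a b) :
    HasDerivAt (fun s => rate γ (v s)) (rateDeriv γ (v t)) t := by
  have hg : (v t).2.2 - (v t).2.1 ^ 2 ≠ 0 := (sub_pos.mpr (hv t ht).2.2).ne'
  refine ((hasDerivAt_h_slope (hv t ht).1).fun_div (hv.hasDerivAt_gap ht) hg).congr_deriv ?_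
  rw [← gap_mul_rate (hv t ht).2]
  unfold rateDeriv excess
  field_simp

theorem hasDerivAt_vel (hv : SolvesOn (field γ) subsonicRegion a b v) (ht : t ∈ Ioo a b) :
    HasDerivAt (fun s => vel γ (v s)) (accel γ (v t)) t := by
  refine ((((hv.hasDerivAt_omega ht).const_mul 3).const_sub (4 - 3 * γ)).fun_sub
    ((hv.hasDerivAt_omega ht).fun_mul (hv.hasDerivAt_rate ht))).congr_deriv ?_
  unfold accel
  ring

/-- When W and R' both vanish, so does `accel`, and only one term of the product rule survives. Its
factored form has a visible sign, which settles the degenerate case of `accel_pos`. -/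
theorem hasDerivAt_accel (hv : SolvesOn (field γ) subsonicRegion a b v) (ht : t ∈ Ioo a b)
    (hW : vel γ (v t) = 0) (hR : rateDeriv γ (v t) = 0) :
    HasDerivAt (fun s => accel γ (v s)) (-((v t).2.1 * ((v t).2.2 * rate γ (v t) *
      ((γ - 1) * rate γ (v t) - 2) * ((2 - γ) * rate γ (v t) + 2) /
        ((v t).2.2 - (v t).2.1 ^ 2)))) t := by
  have hg : (v t).2.2 - (v t).2.1 ^ 2 ≠ 0 := (sub_pos.mpr (hv t ht).2.2).ne'
  have h1 := hv.hasDerivAt_rho ht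
  have h2 := hv.hasDerivAt_omega ht
  have h3 := hv.hasDerivAt_q ht
  have h4 := hv.hasDerivAt_rate ht
  have h5 := hv.hasDerivAt_vel ht
  have hA : accel γ (v t) = 0 := by unfold accel; rw [hW, hR]; ring
  have hE : excess γ (v t).1 (v t).2.1 (v t).2.2 (rate γ (v t)) = 0 := by
    have := hR; unfold rateDeriv at this
    exact (div_eq_zero_iff.mp this).resolve_right hg
  have h6 : HasDerivAt (fun s => excess γ (v s).1 (v s).2.1 (v s).2.2 (rate γ (v s)))
      ((v t).2.2 * rate γ (v t) *
      ((γ - 1) * rate γ (v t) - 2) * ((2 - γ) * rate γ (v t) + 2)) t := by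
    have hh : HasDerivAt (fun s => hRate γ (v s).1 (v s).2.1 (rate γ (v s))) _ t :=
      (((h1.const_mul (-(4 * Real.pi / (4 - 3 * γ)))).fun_mul h2).fun_mul h4).fun_add
        ((((h2.const_mul 4).add_const (γ - 1)).fun_sub
          (h1.const_mul (4 * Real.pi / (4 - 3 * γ)))).fun_mul h5)
    have hgr : HasDerivAt (fun s => gRate γ (v s).2.1 (v s).2.2 (rate γ (v s))) _ t :=
      (h3.fun_mul ((h4.const_mul (γ - 1)).sub_const 2)).fun_sub
        (((h2.const_mul 2)).fun_mul h5)
    have h7 : HasDerivAt (fun s => excess γ (v s).1 (v s).2.1 (v s).2.2 (rate γ (v s))) _ t :=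
      hh.fun_sub (hgr.fun_mul h4)
    refine h7.congr_deriv ?_
    have hW' : relVel γ (v t).2.1 (rate γ (v t)) = 0 := hW
    unfold excess hRate gRate at hE
    rw [hW'] at hE
    simp only [hW, hR, hA]
    linear_combination rate γ (v t) * hE
      - 4 * Real.pi / (4 - 3 * γ) * (v t).1 * rate γ (v t) * hW'
  have h7 := h6.fun_div (hv.hasDerivAt_gap ht) hg
  have h8 : HasDerivAt (fun s => accel γ (v s)) _ t :=
    ((h5.const_mul 3).fun_neg).fun_sub ((h5.fun_mul h4).fun_add (h2.fun_mul h7))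
  refine h8.congr_deriv ?_
  simp only [hA, hW, hR, hE]
  field_simp
  ring

/-- At a zero of `ω'` in the relevant range, the second derivative of `ω` is positive if `ω'`
is positive to the right. -/
theorem accel_pos (hγ : γ ∈ Ioo (1 : ℝ) (4 / 3)) (hv : SolvesOn (field γ) subsonicRegion a b v)
    (ht : t ∈ Ioo a b) (hW : vel γ (v t) = 0) (hpos : ∀ s ∈ Ioo t b, 0 < vel γ (v s))
    (h1 : omegaF γ < (v t).2.1) (h2 : (v t).2.1 < 2 - γ) : 0 < accel γ (v t) := by
  have hω : 0 < (v t).2.1 := (omegaF_pos hγ).trans h1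
  have hg : 0 < (v t).2.2 - (v t).2.1 ^ 2 := sub_pos.mpr (hv t ht).2.2
  have hright : ∀ᶠ s in 𝓝[>] t, 0 < vel γ (v s) :=
    mem_of_superset (Ioo_mem_nhdsGT ht.2) hpos
  rcases lt_trichotomy (accel γ (v t)) 0 with h | h | h
  · have := eventually_gt_right (hv.hasDerivAt_vel ht).fun_neg (by linarith)
    obtain ⟨s, hs1, hs2⟩ := (this.and hright).exists
    linarith
  -- If `accel` vanishes as well, then R' = 0 and `hasDerivAt_accel` applies. At this point R < 0,
  -- and (2-γ)R + 2 = (4-3γ)(2-γ-ω)/ω > 0, so the derivative of `accel` is negative. Then W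
  -- decreases from 0 to the right, against `hpos`.
  · exfalso
    have hR : rateDeriv γ (v t) = 0 := by
      have h := h
      unfold accel at h
      rw [hW] at h
      have : (v t).2.1 * rateDeriv γ (v t) = 0 := by linarith
      exact (mul_eq_zero.mp this).resolve_left hω.ne'
    have hd := (hv.hasDerivAt_accel ht hW hR).fun_neg
    have hr : rate γ (v t) = (4 - 3 * γ - 3 * (v t).2.1) / (v t).2.1 := by
      have h := hW
      unfold vel relVel at h
      field_simp; linarith
    have hr0 : rate γ (v t) < 0 := by
      rw [hr]
      refine div_neg_of_neg_of_pos ?_ hω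
      unfold omegaF at h1; linarith
    have hr1 : 0 < (2 - γ) * rate γ (v t) + 2 := by
      have : (2 - γ) * rate γ (v t) + 2 = (4 - 3 * γ) * (2 - γ - (v t).2.1) / (v t).2.1 := by
        rw [hr]; field_simp; ring
      rw [this]
      have : 0 < 2 - γ - (v t).2.1 := by linarith
      have : 0 < 4 - 3 * γ := by linarith [hγ.2]
      positivity
    have hr2 : (γ - 1) * rate γ (v t) - 2 < 0 := by nlinarith [hγ.1]
    have hq : 0 < (v t).2.2 := by nlinarith
    have h3 : 0 < (v t).2.2 * rate γ (v t) * ((γ - 1) * rate γ (v t) - 2) *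
        ((2 - γ) * rate γ (v t) + 2) :=
      mul_pos (mul_pos_of_neg_of_neg (mul_neg_of_pos_of_neg hq hr0) hr2) hr1
    have hev := eventually_gt_right hd (by rw [neg_neg]; positivity)
    obtain ⟨c, hc, hcs⟩ := mem_nhdsGT_iff_exists_Ioo_subset.mp hev
    have hc' : t < min c b := lt_min hc ht.2
    obtain ⟨s, hs1, hs2⟩ := exists_between hc'
    have hanti : StrictAntiOn (fun s => vel γ (v s)) (Icc t s) := by
      refine strictAntiOn_of_deriv_neg (convex_Icc _ _) (fun x hx => ?_) fun x hx => ?_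
      · exact (hv.hasDerivAt_vel ⟨ht.1.trans_le hx.1, hx.2.trans_lt
          (hs2.trans_le (min_le_right _ _))⟩).continuousAt.continuousWithinAt
      · rw [interior_Icc] at hx
        rw [(hv.hasDerivAt_vel ⟨ht.1.trans hx.1, hx.2.trans
          (hs2.trans_le (min_le_right _ _))⟩).deriv]
        have := hcs (show x ∈ Ioo t c from ⟨hx.1, hx.2.trans (hs2.trans_le (min_le_left _ _))⟩)
        simp only [mem_ofPred_eq, h] at this
        linarith
    have h4 := hanti (left_mem_Icc.mpr hs1.le) (right_mem_Icc.mpr hs1.le) hs1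
    simp only [hW] at h4
    linarith [hpos s ⟨hs1, hs2.trans_le (min_le_right _ _)⟩]
  · exact h

/-- The velocity `ω'` cannot vanish at the Friedman value of `ω`. -/
theorem vel_ne_zero_of_eq_omegaF (hγ : γ ∈ Ioo (1 : ℝ) (4 / 3))
    (hv : SolvesOn (field γ) subsonicRegion a b v)
    (ht : t ∈ Ioo a b) (hpos : ∀ s ∈ Ioo t b, 0 < vel γ (v s))
    (h1 : (v t).2.1 = omegaF γ) : vel γ (v t) ≠ 0 := by
  intro hW
  have ha := omegaF_pos hγ
  have hr : rate γ (v t) = 0 := by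
    have h := hW
    unfold vel relVel at h
    rw [h1] at h
    have : omegaF γ * rate γ (v t) = 0 := by
      unfold omegaF at h ⊢; linarith
    exact (mul_eq_zero.mp this).resolve_left ha.ne'
  have hh : h γ (v t).1 (omegaF γ) = 0 := by
    have := gap_mul_rate (γ := γ) (hv t ht).2
    rw [hr, mul_zero, h1] at this
    exact this.symm
  -- The Friedman solution through this point: W = 0 at ω = ω_F forces R = 0, so ρ and ω are
  -- constant and q decays like e^(-2t). By uniqueness v coincides with it near t, where W = 0.
  let z : ℝ → ℝ × ℝ × ℝ := fun s => ((v t).1, omegaF γ, (v t).2.2 * Real.exp (-2 * (s - t)))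
  have hzr : ∀ s, rate γ (z s) = 0 := fun s => by simp only [rate, z, hh, zero_div]
  have hq : ∀ᶠ s in 𝓝 t, omegaF γ ^ 2 < (z s).2.2 := by
    have hc : ContinuousAt (fun s => (z s).2.2) t := by simp only [z]; fun_prop
    refine hc.eventually (lt_mem_nhds ?_)
    have := (hv t ht).2.2
    simpa [z, h1] using this
  obtain ⟨δ, hδ, hball⟩ := Metric.eventually_nhds_iff.mp
    (hq.and (isOpen_Ioo.mem_nhds ht))
  have hz : SolvesOn (field γ) subsonicRegion (t - δ) (t + δ) z := by
    intro s hs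
    have hs' := hball (y := s) (by rw [Real.dist_eq, abs_lt]; constructor <;> linarith [hs.1, hs.2])
    refine ⟨?_, (hv t ht).2.1, hs'.1⟩
    have h3 : HasDerivAt (fun s => (v t).2.2 * Real.exp (-2 * (s - t)))
        ((v t).2.2 * (Real.exp (-2 * (s - t)) * (-2 * 1))) s :=
      ((((hasDerivAt_id s).sub_const t).const_mul (-2)).exp).const_mul _
    refine ((hasDerivAt_const s (v t).1).prodMk
      ((hasDerivAt_const s (omegaF γ)).prodMk h3)).congr_deriv ?_
    simp only [field, slopeField, hzr, relVel, z, Prod.mk.injEq]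
    refine ⟨by ring, by unfold omegaF; ring, by ring⟩
  have hsub : ∀ s ∈ Ioo (t - δ) (t + δ), s ∈ Ioo a b := fun s hs =>
    (hball (by rw [Real.dist_eq, abs_lt]; constructor <;> linarith [hs.1, hs.2])).2
  have hv' : SolvesOn (field γ) subsonicRegion (t - δ) (t + δ) v := fun s hs => hv s (hsub s hs)
  have heq := hv'.eqOn isOpen_subsonicRegion (contDiffOn_field γ) hz
    (show t ∈ Ioo (t - δ) (t + δ) from ⟨by linarith, by linarith⟩)
    (by simp [z, ← h1])
  have hs : t + δ / 2 ∈ Ioo (t - δ) (t + δ) := ⟨by linarith, by linarith⟩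
  have h5 := hpos (t + δ / 2) ⟨by linarith, (hsub _ hs).2⟩
  rw [heq hs] at h5
  unfold vel at h5
  rw [hzr] at h5
  simp only [z, relVel, omegaF] at h5
  linarith

end SolvesOn

/-! ### Orbits emanating from the sonic curve -/

theorem SolvesOn.glue {E : Type*} [NormedAddCommGroup E] [NormedSpace ℝ E]
    [FiniteDimensional ℝ E] {X : E → E} {Ω : Set E} (hΩ : IsOpen Ω) (hX : ContDiffOn ℝ 1 X Ω)
    {a b a' b' c : ℝ} {v w : ℝ → E} (hv : SolvesOn X Ω a b v) (hw : SolvesOn X Ω a' b' w)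
    (hc : c ∈ Ioo a b) (hc' : c ∈ Ioo a' b') (h : v c = w c) :
    SolvesOn X Ω a b' (fun t => if t < c then v t else w t) := by
  have heq : EqOn v w (Ioo (max a a') (min b b')) :=
    (hv.mono (le_max_left _ _) (min_le_left _ _)).eqOn hΩ hX
      (hw.mono (le_max_right _ _) (min_le_right _ _))
      ⟨max_lt hc.1 hc'.1, lt_min hc.2 hc'.2⟩ h
  have h1 : SolvesOn X Ω a (min b b') (fun t => if t < c then v t else w t) := by
    refine (hv.mono le_rfl (min_le_left _ _)).congr fun t ht => ?_
    by_cases htc : t < c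
    · simp only [htc, if_true]
    · simp only [htc, if_false]
      exact (heq ⟨(max_lt hc.1 hc'.1).trans_le (not_lt.mp htc), ht.2⟩).symm
  have h2 : SolvesOn X Ω (max a a') b' (fun t => if t < c then v t else w t) := by
    refine (hw.mono (le_max_right _ _) le_rfl).congr fun t ht => ?_
    by_cases htc : t < c
    · simp only [htc, if_true]
      exact heq ⟨ht.1, htc.trans (lt_min hc.2 hc'.2)⟩
    · simp only [htc, if_false]
  intro t ht
  by_cases htc : t < c
  · exact h1 t ⟨ht.1, htc.trans (lt_min hc.2 hc'.2)⟩
  · exact h2 t ⟨(max_lt hc.1 hc'.1).trans_le (not_lt.mp htc), ht.2⟩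

/-- A family of solutions near the sonic curve, parametrized by the relative velocity. -/
structure IsSonicFamily (γ r : ℝ) (U : ℝ → ℝ → ℝ × ℝ × ℝ) (S : ℝ → ℝ → ℝ) : Prop where
  r_pos : 0 < r
  cont : ContinuousOn (fun p : ℝ × ℝ => U p.1 p.2) (univ ×ˢ Icc (-r) r)
  cont_slope : ContinuousOn (fun p : ℝ × ℝ => S p.1 p.2) (univ ×ˢ Icc (-r) r)
  analytic_rho : ∀ w ∈ Icc (omegaF γ) (2 - γ), AnalyticAt ℝ (fun t => (U w t).1) 0
  analytic_omega : ∀ w ∈ Icc (omegaF γ) (2 - γ), AnalyticAt ℝ (fun t => (U w t).2.1) 0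
  analytic_slope : ∀ w ∈ Icc (omegaF γ) (2 - γ), AnalyticAt ℝ (S w) 0
  init : ∀ w ∈ Icc (omegaF γ) (2 - γ), U w 0 = (rhoS γ w, w, w ^ 2)
  init_slope : ∀ w ∈ Icc (omegaF γ) (2 - γ), S w 0 = R1 γ w
  ode : ∀ w ∈ Icc (omegaF γ) (2 - γ), ∀ t ∈ Ioo (-r) r,
    HasDerivAt (U w) (slopeField γ (U w t) (S w t)) t
  slope : ∀ w ∈ Icc (omegaF γ) (2 - γ), ∀ t ∈ Ioo (-r) r,
    ((U w t).2.2 - (U w t).2.1 ^ 2) * S w t = h γ (U w t).1 (U w t).2.1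
  rho_pos : ∀ w ∈ Icc (omegaF γ) (2 - γ), ∀ t ∈ Ioo (-r) r, 0 < (U w t).1
  subsonic : ∀ w ∈ Icc (omegaF γ) (2 - γ), ∀ t ∈ Ioo (-r) 0, (U w t).2.1 ^ 2 < (U w t).2.2

theorem exists_isSonicFamily {γ : ℝ} (hγ : γ ∈ Ioo (1 : ℝ) (4 / 3)) :
    ∃ r U S, IsSonicFamily γ r U S := by
  obtain ⟨r, hr, U, S, h1, h2, h3⟩ := exists_sonic_family hγ
  exact ⟨r, U, S, hr, h1, h2, fun w hw => (h3 w hw).1, fun w hw => (h3 w hw).2.1,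
    fun w hw => (h3 w hw).2.2.1, fun w hw => (h3 w hw).2.2.2.1, fun w hw => (h3 w hw).2.2.2.2.1,
    fun w hw t ht => ((h3 w hw).2.2.2.2.2 t ht).1, fun w hw t ht => ((h3 w hw).2.2.2.2.2 t ht).2.1,
    fun w hw t ht => ((h3 w hw).2.2.2.2.2 t ht).2.2.1,
    fun w hw t ht => ((h3 w hw).2.2.2.2.2 t ⟨ht.1, ht.2.trans hr⟩).2.2.2 ht.2⟩

/-- `u` continues the member `U w` of the family down to the logarithmic time `T`. -/
structure IsOrbit (γ r : ℝ) (U : ℝ → ℝ → ℝ × ℝ × ℝ) (w T : ℝ) (u : ℝ → ℝ × ℝ × ℝ) : Prop where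
  lt : T < -(r / 2)
  -- Agreement up to and including the sonic time selects the branch, since the field is singular
  -- there. Stopping at r/2 instead of r leaves room for gluing with `U w`.
  eq : EqOn u (U w) (Icc (-(r / 2)) 0)
  solves : SolvesOn (field γ) subsonicRegion T 0 u

/-! ### Uniqueness, gluing and continuous dependence of orbits. -/

namespace IsSonicFamily

variable {γ r w : ℝ} {U : ℝ → ℝ → ℝ × ℝ × ℝ} {S : ℝ → ℝ → ℝ}

theorem sonicGerm (H : IsSonicFamily γ r U S) (hw : w ∈ Icc (omegaF γ) (2 - γ)) :
    SonicGerm γ w (U w) (S w) where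
  analytic := H.analytic_slope w hw
  init := H.init w hw
  init_slope := H.init_slope w hw
  ode := by
    filter_upwards [Ioo_mem_nhds (neg_lt_zero.mpr H.r_pos) H.r_pos] with t ht using H.ode w hw t ht
  slope := by
    filter_upwards [Ioo_mem_nhds (neg_lt_zero.mpr H.r_pos) H.r_pos] with t ht
      using H.slope w hw t ht

theorem rate_eq (H : IsSonicFamily γ r U S) (hw : w ∈ Icc (omegaF γ) (2 - γ)) {t : ℝ}
    (ht : t ∈ Ioo (-r) 0) : rate γ (U w t) = S w t := by
  have h1 := H.slope w hw t ⟨ht.1, ht.2.trans H.r_pos⟩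
  have h2 := sub_pos.mpr (H.subsonic w hw t ht)
  unfold rate
  rw [← h1, mul_div_cancel_left₀ _ h2.ne']

theorem solvesOn (H : IsSonicFamily γ r U S) (hw : w ∈ Icc (omegaF γ) (2 - γ)) :
    SolvesOn (field γ) subsonicRegion (-r) 0 (U w) := fun t ht => by
  have ht' : t ∈ Ioo (-r) r := ⟨ht.1, ht.2.trans H.r_pos⟩
  refine ⟨?_, H.rho_pos w hw t ht', H.subsonic w hw t ht⟩
  unfold field
  rw [H.rate_eq hw ht]
  exact H.ode w hw t ht'

theorem isOrbit (H : IsSonicFamily γ r U S) (hw : w ∈ Icc (omegaF γ) (2 - γ)) :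
    IsOrbit γ r U w (-r) (U w) :=
  ⟨by linarith [H.r_pos], fun _ _ => rfl, H.solvesOn hw⟩

theorem eqOn_orbit (H : IsSonicFamily γ r U S) {T T' : ℝ}
    {u u' : ℝ → ℝ × ℝ × ℝ} (h : IsOrbit γ r U w T u) (h' : IsOrbit γ r U w T' u') :
    EqOn u u' (Ioc (max T T') 0) := by
  intro t ht
  have hr := H.r_pos
  have h0 : -(r / 2) ∈ Icc (-(r / 2)) 0 := ⟨le_rfl, by linarith⟩
  rcases ht.2.eq_or_lt with h1 | h1
  · have h2 : t ∈ Icc (-(r / 2)) 0 := by rw [h1]; exact ⟨by linarith, le_rfl⟩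
    rw [h.eq h2, h'.eq h2]
  · exact (h.solves.mono (le_max_left T T') le_rfl).eqOn isOpen_subsonicRegion (contDiffOn_field γ)
      (h'.solves.mono (le_max_right T T') le_rfl)
      ⟨max_lt h.lt h'.lt, by linarith⟩ (by rw [h.eq h0, h'.eq h0]) ⟨ht.1, h1⟩

theorem exists_glued (H : IsSonicFamily γ r U S) (A : Set ℝ)
    (hA : ∀ T ∈ A, ∃ u, IsOrbit γ r U w T u) :
    ∃ u, ∀ T ∈ A, IsOrbit γ r U w T u := by
  classical
  have hr := H.r_pos
  choose! v hv using hA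
  let u : ℝ → ℝ × ℝ × ℝ := fun t => if h : ∃ T ∈ A, T < t then v h.choose t else U w t
  have hu : ∀ T ∈ A, EqOn u (v T) (Ioc T 0) := by
    intro T hT t ht
    have h : ∃ T ∈ A, T < t := ⟨T, hT, ht.1⟩
    simp only [u, h, dif_pos]
    exact H.eqOn_orbit (hv _ h.choose_spec.1) (hv T hT) ⟨max_lt h.choose_spec.2 ht.1, ht.2⟩
  refine ⟨u, fun T hT => ⟨(hv T hT).lt, fun t ht => ?_, ?_⟩⟩
  · rw [hu T hT ⟨(hv T hT).lt.trans_le ht.1, ht.2⟩, (hv T hT).eq ht]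
  · exact (hv T hT).solves.congr ((hu T hT).mono Ioo_subset_Ioc_self)

/-- Continuous dependence of orbits on the sonic point. -/
theorem eventually_near (H : IsSonicFamily γ r U S) {T t₁ δ : ℝ}
    {u : ℝ → ℝ × ℝ × ℝ} (hw : w ∈ Icc (omegaF γ) (2 - γ)) (ho : IsOrbit γ r U w T u)
    (ht₁ : t₁ ∈ Ioo T 0) (hδ : 0 < δ) :
    ∀ᶠ w' in 𝓝[Icc (omegaF γ) (2 - γ)] w, ∃ u' T', IsOrbit γ r U w' T' u' ∧ T' < t₁ ∧
      ∀ s ∈ Ico t₁ 0, dist (u' s) (u s) < δ ∧ dist (vel γ (u' s)) (vel γ (u s)) < δ := by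
  have hr := H.r_pos
  obtain ⟨a₁, ha₁, ha₁'⟩ := exists_between (lt_min ho.lt ht₁.1)
  have ha₂ : a₁ < -(r / 2) := ha₁'.trans_le (min_le_left _ _)
  have h0 : -(r / 2) ∈ Icc (-(r / 2)) 0 := ⟨le_rfl, by linarith⟩
  obtain ⟨d, hd, hnear⟩ := ho.solves.exists_near isOpen_subsonicRegion (contDiffOn_field γ) ha₁
    ha₂.le (by linarith : -(r / 2) < 0) hδ
  have hsub : (univ : Set ℝ) ×ˢ Icc (-(r / 2)) 0 ⊆ univ ×ˢ Icc (-r) r :=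
    prod_mono_right (Icc_subset_Icc (by linarith) hr.le)
  have hc1 : ∀ᶠ w' in 𝓝 w, ∀ s ∈ Icc (-(r / 2)) 0, dist (U w' s) (U w s) < min d δ := by
    obtain ⟨V, hV, h⟩ := isCompact_Icc.mem_uniformity_of_prod (f := U) (s := univ)
      (k := Icc (-(r / 2)) 0) (q := w) (H.cont.mono hsub) (mem_univ _)
      (Metric.dist_mem_uniformity (lt_min hd hδ))
    rw [nhdsWithin_univ] at hV
    filter_upwards [hV] with w' hw' s hs using h w' hw' s hs
  -- Near the sonic time `rate` is a quotient of two quantities tending to 0, so its closeness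
  -- cannot be deduced from that of the states. It is taken from the slope S of the family, which is
  -- continuous up to t = 0.
  have hc2 : ∀ᶠ w' in 𝓝 w, ∀ s ∈ Icc (-(r / 2)) 0,
      dist (relVel γ (U w' s).2.1 (S w' s)) (relVel γ (U w s).2.1 (S w s)) < δ := by
    have hc : ContinuousOn (fun p : ℝ × ℝ => relVel γ (U p.1 p.2).2.1 (S p.1 p.2))
        (univ ×ˢ Icc (-(r / 2)) 0) := by
      have hre : Continuous fun x : ℝ × ℝ => relVel γ x.1 x.2 := by unfold relVel; fun_prop
      exact hre.comp_continuousOn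
        (((continuous_fst.comp continuous_snd).comp_continuousOn (H.cont.mono hsub)).prodMk
          (H.cont_slope.mono hsub))
    obtain ⟨V, hV, h⟩ := isCompact_Icc.mem_uniformity_of_prod
      (f := fun w s => relVel γ (U w s).2.1 (S w s)) (s := univ)
      (k := Icc (-(r / 2)) 0) (q := w) hc (mem_univ _) (Metric.dist_mem_uniformity hδ)
    rw [nhdsWithin_univ] at hV
    filter_upwards [hV] with w' hw' s hs using h w' hw' s hs
  have hrel : ∀ w' ∈ Icc (omegaF γ) (2 - γ), ∀ s ∈ Ico (-(r / 2)) 0,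
      vel γ (U w' s) = relVel γ (U w' s).2.1 (S w' s) := fun w' hw' s hs => by
    unfold vel
    rw [H.rate_eq hw' ⟨by linarith [hs.1], hs.2⟩]
  filter_upwards [nhdsWithin_le_nhds hc1, nhdsWithin_le_nhds hc2, self_mem_nhdsWithin]
    with w' h1 h2 hw'
  obtain ⟨v, hv0, ⟨η, hη, hvs⟩, hvn⟩ := hnear (U w' (-(r / 2))) (by
    rw [ho.eq h0]; exact (h1 _ h0).trans_le (min_le_left _ _))
  refine ⟨fun t => if t < -(r / 2) then v t else U w' t, a₁ - η, ⟨by linarith, fun t ht => ?_, ?_⟩,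
    by linarith [ha₁'.trans_le (min_le_right _ _)], fun s hs => ?_⟩
  · simp only [not_lt.mpr ht.1, if_false]
  · exact hvs.glue isOpen_subsonicRegion (contDiffOn_field γ) (H.solvesOn hw')
      ⟨by linarith, by linarith⟩ ⟨by linarith, by linarith⟩ hv0
  · by_cases h : s < -(r / 2)
    · simp only [h, if_true]
      have h3 := hvn s ⟨(ha₁'.trans_le (min_le_right _ _)).le.trans hs.1, h.le⟩
      refine ⟨h3.1, lt_of_le_of_lt ?_ h3.2⟩
      -- W is the middle component of the field, so closeness of the fields suffices.
      change dist (field γ (v s)).2.1 (field γ (u s)).2.1 ≤ _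
      exact (le_max_left _ _).trans (le_max_right _ _)
    · simp only [h, if_false]
      have hs' : s ∈ Icc (-(r / 2)) 0 := ⟨not_lt.mp h, hs.2.le⟩
      rw [ho.eq hs', hrel w' hw' s ⟨hs'.1, hs.2⟩, hrel w hw s ⟨hs'.1, hs.2⟩]
      exact ⟨(h1 s hs').trans_le (min_le_right _ _), h2 s hs'⟩

theorem tendsto_vel (H : IsSonicFamily γ r U S) (hw : w ∈ Icc (omegaF γ) (2 - γ)) {T : ℝ}
    {u : ℝ → ℝ × ℝ × ℝ} (ho : IsOrbit γ r U w T u) :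
    Tendsto (fun t => vel γ (u t)) (𝓝[<] 0) (𝓝 (relVel γ w (R1 γ w))) := by
  have hr := H.r_pos
  have hc : ContinuousAt (fun t => relVel γ (U w t).2.1 (S w t)) 0 := by
    have hre : Continuous fun x : ℝ × ℝ => relVel γ x.1 x.2 := by unfold relVel; fun_prop
    exact hre.continuousAt.comp ((H.analytic_omega w hw).continuousAt.prodMk
      (H.analytic_slope w hw).continuousAt)
  have h1 := hc.tendsto.mono_left (nhdsWithin_le_nhds (s := Iio 0))
  simp only [H.init w hw, H.init_slope w hw] at h1
  refine h1.congr' ?_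
  filter_upwards [Ioo_mem_nhdsLT (by linarith : -(r / 2) < 0)] with t ht
  rw [ho.eq (Ioo_subset_Icc_self ht)]
  unfold vel
  rw [H.rate_eq hw ⟨by linarith [ht.1], ht.2⟩]

theorem tendsto_orbit (H : IsSonicFamily γ r U S) (hw : w ∈ Icc (omegaF γ) (2 - γ)) {T : ℝ}
    {u : ℝ → ℝ × ℝ × ℝ} (ho : IsOrbit γ r U w T u) :
    Tendsto u (𝓝[<] 0) (𝓝 (rhoS γ w, w, w ^ 2)) := by
  have hr := H.r_pos
  have h1 := (H.ode w hw 0 ⟨by linarith, hr⟩).continuousAt.tendsto.mono_left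
    (nhdsWithin_le_nhds (s := Iio 0))
  rw [H.init w hw] at h1
  refine h1.congr' ?_
  filter_upwards [Ioo_mem_nhdsLT (by linarith : -(r / 2) < 0)] with t ht
  rw [ho.eq (Ioo_subset_Icc_self ht)]

/-- While the velocity is positive, `ω` increases to its value `w` at the sonic point. -/
theorem strictMonoOn_omega (H : IsSonicFamily γ r U S) (hw : w ∈ Icc (omegaF γ) (2 - γ)) {T t : ℝ}
    {u : ℝ → ℝ × ℝ × ℝ} (ho : IsOrbit γ r U w T u) (hT : T ≤ t)
    (hpos : ∀ s ∈ Ioo t 0, 0 < vel γ (u s)) :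
    StrictMonoOn (fun s => (u s).2.1) (Ioo t 0) ∧ ∀ s ∈ Ioo t 0, (u s).2.1 < w := by
  have hd : ∀ s ∈ Ioo t 0, HasDerivAt (fun s => (u s).2.1) (vel γ (u s)) s := fun s hs =>
    ho.solves.hasDerivAt_omega ⟨hT.trans_lt hs.1, hs.2⟩
  have hm : StrictMonoOn (fun s => (u s).2.1) (Ioo t 0) := by
    refine strictMonoOn_of_deriv_pos (convex_Ioo _ _)
      (fun s hs => (hd s hs).continuousAt.continuousWithinAt) fun s hs => ?_
    rw [interior_Ioo] at hs
    rw [(hd s hs).deriv]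
    exact hpos s hs
  refine ⟨hm, fun s hs => ?_⟩
  obtain ⟨s', hs'⟩ := exists_between hs.2
  have hs'' : s' ∈ Ioo t 0 := ⟨hs.1.trans hs'.1, hs'.2⟩
  refine (hm hs hs'' hs'.1).trans_le ?_
  have h1 : Tendsto (fun s => (u s).2.1) (𝓝[<] 0) (𝓝 w) :=
    ((continuous_fst.comp continuous_snd).tendsto _).comp (H.tendsto_orbit hw ho)
  refine ge_of_tendsto h1 ?_
  filter_upwards [Ioo_mem_nhdsLT hs'.2] with x hx
  exact (hm hs'' ⟨hs''.1.trans hx.1, hx.2⟩ hx.1).le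

end IsSonicFamily

/-! ### Shooting from the sonic curve -/

theorem rate_neg {γ : ℝ} {u : ℝ × ℝ × ℝ} (hγ : γ ∈ Ioo (1 : ℝ) (4 / 3)) (h1 : 0 < vel γ u)
    (h2 : omegaF γ ≤ u.2.1) : rate γ u < 0 := by
  have hω := (omegaF_pos hγ).trans_le h2
  unfold vel relVel at h1
  unfold omegaF at h2
  have : u.2.1 * rate γ u < 0 := by linarith
  exact neg_of_mul_neg_right this hω.le

theorem monotoneOn_Ioc_of_hasDerivAt {f f' : ℝ → ℝ} {a c : ℝ}
    (hf : ∀ t ∈ Ioc a c, HasDerivAt f (f' t) t) (h : ∀ t ∈ Ioc a c, 0 ≤ f' t) :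
    MonotoneOn f (Ioc a c) := by
  refine monotoneOn_of_deriv_nonneg (convex_Ioc _ _)
    (fun t ht => (hf t ht).continuousAt.continuousWithinAt) (fun t ht => ?_) fun t ht => ?_
  · rw [interior_Ioc] at ht
    exact (hf t (Ioo_subset_Ioc_self ht)).differentiableAt.differentiableWithinAt
  · rw [interior_Ioc] at ht
    rw [(hf t (Ioo_subset_Ioc_self ht)).deriv]
    exact h t (Ioo_subset_Ioc_self ht)

namespace SolvesOn

variable {γ a b c : ℝ} {v : ℝ → ℝ × ℝ × ℝ}

/-- There is no blow-up at finite t while W > 0 and ω stays in range. Here R < 0, so ρ and the gap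
decrease in t and are bounded below by their values at c. Since R + W/ω = (4-3γ)/ω - 3 > -3, the
quantities ρωe^(3t) and qω^(γ-1)e^(5t) increase in t, which bounds ρ and q above. The exponent 5 is
merely a convenient value above 2 + 3(γ-1). -/
theorem exists_compact (hγ : γ ∈ Ioo (1 : ℝ) (4 / 3))
    (hv : SolvesOn (field γ) subsonicRegion a b v) (hc : c ∈ Ioo a b)
    (h : ∀ t ∈ Ioc a c, 0 < vel γ (v t) ∧ omegaF γ ≤ (v t).2.1 ∧ (v t).2.1 ≤ 2 - γ) :
    ∃ C, IsCompact C ∧ C ⊆ subsonicRegion ∧ ∀ t ∈ Ioc a c, v t ∈ C := by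
  have ha := omegaF_pos hγ
  have hsub : ∀ t ∈ Ioc a c, t ∈ Ioo a b := fun t ht => ⟨ht.1, ht.2.trans_lt hc.2⟩
  have hω : ∀ t ∈ Ioc a c, 0 < (v t).2.1 := fun t ht => ha.trans_le (h t ht).2.1
  have hR : ∀ t ∈ Ioc a c, rate γ (v t) < 0 := fun t ht => rate_neg hγ (h t ht).1 (h t ht).2.1
  have hρ : ∀ t ∈ Ioc a c, 0 < (v t).1 := fun t ht => (hv t (hsub t ht)).2.1
  have hg : ∀ t ∈ Ioc a c, 0 < (v t).2.2 - (v t).2.1 ^ 2 := fun t ht =>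
    sub_pos.mpr (hv t (hsub t ht)).2.2
  have hq : ∀ t ∈ Ioc a c, 0 < (v t).2.2 := fun t ht =>
    (sq_nonneg _).trans_lt (hv t (hsub t ht)).2.2
  have hcc : c ∈ Ioc a c := ⟨hc.1, le_rfl⟩
  have h1 := hγ.1
  have hα : 0 < 4 - 3 * γ := by linarith [hγ.2]
  have key : ∀ t ∈ Ioc a c, rate γ (v t) + vel γ (v t) / (v t).2.1
      = (4 - 3 * γ) / (v t).2.1 - 3 := fun t ht => by
    have := (hω t ht).ne'
    unfold vel relVel
    field_simp
    ring
  have m1 := monotoneOn_Ioc_of_hasDerivAt (fun t ht => (hv.hasDerivAt_rho (hsub t ht)).fun_neg)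
    (fun t ht => by
      have := mul_neg_of_pos_of_neg (hρ t ht) (hR t ht)
      linarith)
  have m2 := monotoneOn_Ioc_of_hasDerivAt (fun t ht => (hv.hasDerivAt_gap (hsub t ht)).fun_neg)
    (fun t ht => by
      have h3 : (γ - 1) * rate γ (v t) - 2 < 0 := by nlinarith [hR t ht]
      have h4 := mul_neg_of_pos_of_neg (hq t ht) h3
      have h5 := mul_pos (hω t ht) (h t ht).1
      unfold gRate
      change 0 ≤ -(_ - 2 * (v t).2.1 * vel γ (v t))
      linarith)
  have m3 := monotoneOn_Ioc_of_hasDerivAt (fun t ht =>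
    (((hv.hasDerivAt_rho (hsub t ht)).log (hρ t ht).ne').fun_add
      ((hv.hasDerivAt_omega (hsub t ht)).log (hω t ht).ne')).fun_add
      ((hasDerivAt_id t).const_mul 3))
    (fun t ht => by
      have h3 := key t ht
      have h4 : 0 < (4 - 3 * γ) / (v t).2.1 := div_pos hα (hω t ht)
      rw [mul_div_cancel_left₀ _ (hρ t ht).ne']
      linarith)
  have m4 := monotoneOn_Ioc_of_hasDerivAt (fun t ht =>
    (((hv.hasDerivAt_q (hsub t ht)).log (hq t ht).ne').fun_add
      (((hv.hasDerivAt_omega (hsub t ht)).log (hω t ht).ne').const_mul (γ - 1))).fun_add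
      ((hasDerivAt_id t).const_mul 5))
    (fun t ht => by
      have h3 := key t ht
      have h4 : 0 < (4 - 3 * γ) / (v t).2.1 := div_pos hα (hω t ht)
      rw [mul_div_cancel_left₀ _ (hq t ht).ne']
      have h5 : (γ - 1) * rate γ (v t) - 2 + (γ - 1) * (vel γ (v t) / (v t).2.1) + 5 * 1
        = (γ - 1) * ((4 - 3 * γ) / (v t).2.1) + 3 * (2 - γ) := by
        linear_combination (γ - 1) * h3
      rw [h5]
      have : 0 < (γ - 1) * ((4 - 3 * γ) / (v t).2.1) := mul_pos (by linarith) h4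
      nlinarith)
  set g₀ := (v c).2.2 - (v c).2.1 ^ 2 with hg₀
  set A := Real.log (v c).1 + Real.log (v c).2.1 + 3 * c - Real.log (omegaF γ) - 3 * a with hA
  set B := Real.log (v c).2.2 + (γ - 1) * Real.log (v c).2.1 + 5 * c
    - (γ - 1) * Real.log (omegaF γ) - 5 * a with hB
  refine ⟨(Icc (v c).1 (Real.exp A) ×ˢ (Icc (omegaF γ) (2 - γ) ×ˢ Icc 0 (Real.exp B))) ∩
    {u | g₀ ≤ u.2.2 - u.2.1 ^ 2}, ?_, ?_, ?_⟩
  · exact (isCompact_Icc.prod (isCompact_Icc.prod isCompact_Icc)).inter_right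
      (isClosed_le continuous_const ((continuous_snd.comp continuous_snd).sub
        ((continuous_fst.comp continuous_snd).pow 2)))
  · rintro u ⟨hu1, hu2⟩
    have hu2 : g₀ ≤ u.2.2 - u.2.1 ^ 2 := hu2
    exact ⟨(hρ c hcc).trans_le hu1.1.1, by linarith [hg c hcc]⟩
  · intro t ht
    have n1 := m1 ht hcc ht.2
    have n2 := m2 ht hcc ht.2
    have n3 := m3 ht hcc ht.2
    have n4 := m4 ht hcc ht.2
    simp only [id] at n1 n2 n3 n4
    have n5 := Real.log_le_log ha (h t ht).2.1
    have n6 : (γ - 1) * Real.log (omegaF γ) ≤ (γ - 1) * Real.log (v t).2.1 :=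
      mul_le_mul_of_nonneg_left n5 (by linarith)
    have ht1 := ht.1
    refine ⟨⟨⟨by linarith, ?_⟩, ⟨(h t ht).2.1, (h t ht).2.2⟩, (hq t ht).le, ?_⟩, ?_⟩
    · rw [← Real.log_le_iff_le_exp (hρ t ht), hA]; linarith
    · rw [← Real.log_le_iff_le_exp (hq t ht), hB]; linarith
    · change g₀ ≤ _
      linarith

end SolvesOn

theorem IsOrbit.mono {γ r w T T' : ℝ} {U : ℝ → ℝ → ℝ × ℝ × ℝ} {u : ℝ → ℝ × ℝ × ℝ}
    (h : IsOrbit γ r U w T u) (hT : T ≤ T') (hT' : T' < -(r / 2)) : IsOrbit γ r U w T' u :=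
  ⟨hT', h.eq, h.solves.mono hT le_rfl⟩

/-- The orbit from the sonic point with relative velocity `w` crosses the Friedman value of `ω`
while `ω` is still monotone. -/
def Crosses (γ r : ℝ) (U : ℝ → ℝ → ℝ × ℝ × ℝ) (w : ℝ) : Prop :=
  ∃ T u t, IsOrbit γ r U w T u ∧ t ∈ Ioo T 0 ∧ (∀ s ∈ Ico t 0, 0 < vel γ (u s)) ∧
    (u t).2.1 < omegaF γ

namespace IsSonicFamily

variable {γ r w : ℝ} {U : ℝ → ℝ → ℝ × ℝ × ℝ} {S : ℝ → ℝ → ℝ}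

theorem exists_vel_pos (hγ : γ ∈ Ioo (1 : ℝ) (4 / 3)) (H : IsSonicFamily γ r U S)
    (hw : w ∈ Ico (omegaF γ) (2 - γ)) :
    ∃ t ∈ Ioo (-r) 0, ∀ s ∈ Ioo t 0, 0 < vel γ (U w s) := by
  have hw' := Ico_subset_Icc_self hw
  have h1 := (H.tendsto_vel hw' (H.isOrbit hw')).eventually (lt_mem_nhds (relVel_R1_pos hγ hw))
  obtain ⟨l, hl, hs⟩ := mem_nhdsLT_iff_exists_Ioo_subset.mp h1
  have hr := H.r_pos
  have hl : l < 0 := hl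
  obtain ⟨t, ht⟩ := exists_between (max_lt hl (neg_lt_zero.mpr hr))
  exact ⟨t, ⟨(le_max_right _ _).trans_lt ht.1, ht.2⟩,
    fun s h => hs ⟨((le_max_left _ _).trans_lt ht.1).trans h.1, h.2⟩⟩

/-- With w = ω_F the velocity W is positive at the sonic point, so ω is below ω_F immediately before
it. -/
theorem crosses_omegaF (hγ : γ ∈ Ioo (1 : ℝ) (4 / 3)) (H : IsSonicFamily γ r U S) :
    Crosses γ r U (omegaF γ) := by
  have hw : omegaF γ ∈ Ico (omegaF γ) (2 - γ) := ⟨le_rfl, omegaF_lt hγ⟩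
  have hw' := Ico_subset_Icc_self hw
  obtain ⟨t, ht, hs⟩ := H.exists_vel_pos hγ hw
  have h2 := (H.strictMonoOn_omega hw' (H.isOrbit hw') ht.1.le hs).2
  have := ht.2
  have := ht.1
  exact ⟨-r, U (omegaF γ), t / 2, H.isOrbit hw', ⟨by linarith, by linarith⟩,
    fun s h => hs s ⟨by linarith [h.1], h.2⟩, h2 _ ⟨by linarith, by linarith⟩⟩

/-- On [t, 0) the velocity has a positive lower bound: by compactness away from 0, and near 0 by its
positive limit. Both conditions of crossing then survive a small change of w. At w = 2-γ that limit
is 0 and the argument is unavailable. -/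
theorem eventually_crosses (hγ : γ ∈ Ioo (1 : ℝ) (4 / 3)) (H : IsSonicFamily γ r U S)
    (hw : w ∈ Ico (omegaF γ) (2 - γ)) (h : Crosses γ r U w) :
    ∀ᶠ w' in 𝓝[Icc (omegaF γ) (2 - γ)] w, Crosses γ r U w' := by
  obtain ⟨T, u, t, ho, ht, hv, hlt⟩ := h
  have hw' := Ico_subset_Icc_self hw
  have hL := relVel_R1_pos hγ hw
  set L := relVel γ w (R1 γ w)
  obtain ⟨l, hl, hs⟩ := mem_nhdsLT_iff_exists_Ioo_subset.mp
    ((H.tendsto_vel hw' ho).eventually (lt_mem_nhds (half_lt_self hL)))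
  have hl : l < 0 := hl
  obtain ⟨s₀, hs₀⟩ := exists_between (max_lt hl ht.2)
  have hts₀ : t ≤ s₀ := ((le_max_right _ _).trans_lt hs₀.1).le
  have hcont : ContinuousOn (fun s => vel γ (u s)) (Icc t s₀) := fun s h =>
    (ho.solves.hasDerivAt_vel ⟨ht.1.trans_le h.1, h.2.trans_lt hs₀.2⟩).continuousAt.continuousWithinAt
  obtain ⟨s₁, hs₁, hmin⟩ := isCompact_Icc.exists_isMinOn (nonempty_Icc.mpr hts₀) hcont
  have hm0 : 0 < vel γ (u s₁) := hv s₁ ⟨hs₁.1, hs₁.2.trans_lt hs₀.2⟩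
  set m := min (L / 2) (vel γ (u s₁)) with hm
  have hm1 : ∀ s ∈ Ico t 0, m ≤ vel γ (u s) := fun s h => by
    rcases le_or_gt s s₀ with h' | h'
    · exact (min_le_right _ _).trans (hmin ⟨h.1, h'⟩)
    · exact (min_le_left _ _).trans
        (le_of_lt (hs ⟨((le_max_left _ _).trans_lt hs₀.1).trans h', h.2⟩))
  have hmpos : 0 < m := lt_min (by linarith) hm0
  filter_upwards [H.eventually_near hw' ho ht (lt_min hmpos (sub_pos.mpr hlt))] with w' hh
  obtain ⟨u', T', ho', hT', hn⟩ := hh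
  refine ⟨T', u', t, ho', ⟨hT', ht.2⟩, fun s h => ?_, ?_⟩
  · have h1 := (hn s h).2.trans_le (min_le_left _ _)
    rw [Real.dist_eq] at h1
    linarith [(abs_lt.mp h1).1, hm1 s h]
  · have h1 := (hn t ⟨le_rfl, ht.2⟩).1.trans_le (min_le_right _ _)
    have h2 : dist (u' t).2.1 (u t).2.1 ≤ dist (u' t) (u t) :=
      (le_max_left _ _).trans (le_max_right _ _)
    have h3 := h2.trans_lt h1
    rw [Real.dist_eq] at h3
    linarith [(abs_lt.mp h3).2]

/-- The value sought is the supremum of all w such that everything in [ω_F, w] crosses. If the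
supremum is below 2-γ and crosses, openness pushes it further. -/
theorem exists_critical (hγ : γ ∈ Ioo (1 : ℝ) (4 / 3)) (H : IsSonicFamily γ r U S) :
    ∃ w ∈ Ioc (omegaF γ) (2 - γ), (∀ w' ∈ Ico (omegaF γ) w, Crosses γ r U w') ∧
      (w < 2 - γ → ¬ Crosses γ r U w) := by
  have hab := omegaF_lt hγ
  set Z := {w | w ∈ Ico (omegaF γ) (2 - γ) ∧ ∀ w' ∈ Icc (omegaF γ) w, Crosses γ r U w'} with hZ
  have haZ : omegaF γ ∈ Z := ⟨⟨le_rfl, hab⟩, fun w' hw' => by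
    rw [le_antisymm hw'.2 hw'.1]; exact H.crosses_omegaF hγ⟩
  have hbdd : BddAbove Z := ⟨2 - γ, fun w hw => hw.1.2.le⟩
  set W := sSup Z with hW
  have h1 : omegaF γ ≤ W := le_csSup hbdd haZ
  have h2 : W ≤ 2 - γ := csSup_le ⟨_, haZ⟩ fun w hw => hw.1.2.le
  have h3 : ∀ w' ∈ Ico (omegaF γ) W, Crosses γ r U w' := fun w' hw' => by
    obtain ⟨w, hw, hlt⟩ := exists_lt_of_lt_csSup ⟨_, haZ⟩ hw'.2
    exact hw.2 w' ⟨hw'.1, hlt.le⟩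
  have h4 : W < 2 - γ → ¬ Crosses γ r U W := by
    intro hlt hc
    have h5 := H.eventually_crosses hγ ⟨h1, hlt⟩ hc
    rw [eventually_nhdsWithin_iff, Metric.eventually_nhds_iff] at h5
    obtain ⟨η, hη, h5⟩ := h5
    obtain ⟨w, hw1, hw2⟩ := exists_between (lt_min hlt (by linarith : W < W + η))
    have : w ∈ Z := by
      refine ⟨⟨h1.trans hw1.le, hw2.trans_le (min_le_left _ _)⟩, fun w' hw' => ?_⟩
      rcases lt_or_ge w' W with h | h
      · exact h3 w' ⟨hw'.1, h⟩
      · refine h5 ?_ ⟨hw'.1, hw'.2.trans (hw2.trans_le (min_le_left _ _)).le⟩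
        rw [Real.dist_eq, abs_of_nonneg (by linarith)]
        linarith [hw'.2, hw2.trans_le (min_le_right (2 - γ) (W + η))]
    linarith [le_csSup hbdd this]
  refine ⟨W, ⟨?_, h2⟩, h3, h4⟩
  rcases h1.eq_or_lt with h | h
  · exfalso
    rw [← h] at h4
    exact h4 hab (H.crosses_omegaF hγ)
  · exact h

/-- A limit of crossing orbits which does not cross itself is global. -/
theorem exists_global (hγ : γ ∈ Ioo (1 : ℝ) (4 / 3)) (H : IsSonicFamily γ r U S)
    (hw : w ∈ Ioo (omegaF γ) (2 - γ)) (hnc : ¬ Crosses γ r U w)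
    (happ : ∃ᶠ w' in 𝓝[Icc (omegaF γ) (2 - γ)] w, Crosses γ r U w') :
    ∃ u, (∀ T < -(r / 2), IsOrbit γ r U w T u) ∧
      ∀ t < 0, 0 < vel γ (u t) ∧ omegaF γ < (u t).2.1 ∧ (u t).2.1 < w := by
  have hr := H.r_pos
  have hwI : w ∈ Ico (omegaF γ) (2 - γ) := Ioo_subset_Ico_self hw
  have hwC := Ico_subset_Icc_self hwI
  let Good : ℝ → Prop := fun T => ∃ u T', IsOrbit γ r U w T' u ∧ T' ≤ T ∧
    ∀ s ∈ Ioo T 0, 0 < vel γ (u s) ∧ omegaF γ < (u s).2.1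
  -- the good properties hold for every orbit
  have hprop : ∀ T T' u s, Good T → IsOrbit γ r U w T' u → T' < s → s ∈ Ioo T 0 →
      0 < vel γ (u s) ∧ omegaF γ < (u s).2.1 := by
    rintro T T' u s ⟨v, T'', hv, hT'', hvs⟩ hu hs hsT
    rw [H.eqOn_orbit hu hv ⟨max_lt hs (hT''.trans_lt hsT.1), hsT.2.le⟩]
    exact hvs s hsT
  have hall : ∀ T < 0, Good T := by
    by_contra! hbad
    obtain ⟨T₁, hT₁, hbad⟩ := hbad
    set A := {T | T < 0 ∧ Good T} with hA
    have hA₁ : ∃ T₀ ∈ A, T₀ ∈ Ioo (-r) 0 := by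
      obtain ⟨t, ht, hs⟩ := H.exists_vel_pos hγ hwI
      have h1 : ∀ᶠ s in 𝓝[<] 0, omegaF γ < (U w s).2.1 :=
        (((continuous_fst.comp continuous_snd).tendsto _).comp
          (H.tendsto_orbit hwC (H.isOrbit hwC))).eventually (lt_mem_nhds hw.1)
      obtain ⟨l, hl, hs'⟩ := mem_nhdsLT_iff_exists_Ioo_subset.mp h1
      have hl : l < 0 := hl
      refine ⟨max l t, ⟨max_lt hl ht.2, U w, -r, H.isOrbit hwC, ht.1.le.trans (le_max_right _ _),
        fun s h => ⟨hs s ⟨(le_max_right _ _).trans_lt h.1, h.2⟩,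
          hs' ⟨(le_max_left _ _).trans_lt h.1, h.2⟩⟩⟩,
        ht.1.trans_le (le_max_right _ _), max_lt hl ht.2⟩
    obtain ⟨T₀, hT₀, hT₀'⟩ := hA₁
    have hbdd : BddBelow A := by
      refine ⟨T₁, fun T hT => ?_⟩
      by_contra! hlt
      obtain ⟨-, u, T', hu, hT', hs⟩ := hT
      exact hbad ⟨u, T', hu, hT'.trans hlt.le, fun s h => hs s ⟨hlt.trans h.1, h.2⟩⟩
    set τ := sInf A with hτ
    have hτ0 : τ < 0 := (csInf_le hbdd hT₀).trans_lt hT₀.1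
    have hgood : ∀ T ∈ Ioo τ 0, Good T := fun T hT => by
      obtain ⟨T', ⟨-, u, T'', hu, hT'', hs⟩, hlt⟩ := exists_lt_of_csInf_lt ⟨_, hT₀⟩ hT.1
      exact ⟨u, T'', hu, hT''.trans hlt.le, fun s h => hs s ⟨hlt.trans h.1, h.2⟩⟩
    have hprop' : ∀ T' u s, IsOrbit γ r U w T' u → T' < s → s ∈ Ioo τ 0 →
        0 < vel γ (u s) ∧ omegaF γ < (u s).2.1 := fun T' u s hu hs hsτ => by
      obtain ⟨T, hT⟩ := exists_between hsτ.1
      exact hprop T T' u s (hgood T ⟨hT.1, hT.2.trans hsτ.2⟩) hu hs ⟨hT.2, hsτ.2⟩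
    -- If τ lies beyond the range of the local family, the orbits reaching down to times above τ are
    -- glued. They stay in the compact set of `exists_compact`, hence extend past τ.
    have hext : ∃ u T, IsOrbit γ r U w T u ∧ T < τ := by
      rcases lt_or_ge (-r) τ with h | h
      · exact ⟨U w, -r, H.isOrbit hwC, h⟩
      · have hτr : τ < -(r / 2) := by linarith
        obtain ⟨u, hu⟩ := H.exists_glued (w := w) (Ioo τ (-(r / 2))) fun T hT => by
          obtain ⟨u, T', hu, hT', -⟩ := hgood T ⟨hT.1, by linarith [hT.2]⟩
          exact ⟨u, hu.mono hT' hT.2⟩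
        have hsol : SolvesOn (field γ) subsonicRegion τ 0 u := fun t ht => by
          obtain ⟨T, hT⟩ := exists_between (lt_min ht.1 hτr)
          exact (hu T ⟨hT.1, hT.2.trans_le (min_le_right _ _)⟩).solves t
            ⟨hT.2.trans_le (min_le_left _ _), ht.2⟩
        have hpu : ∀ s ∈ Ioo τ 0, 0 < vel γ (u s) ∧ omegaF γ < (u s).2.1 := fun s hs => by
          obtain ⟨T, hT⟩ := exists_between (lt_min hs.1 hτr)
          exact hprop' T u s (hu T ⟨hT.1, hT.2.trans_le (min_le_right _ _)⟩)
            (hT.2.trans_le (min_le_left _ _)) hs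
        have hωlt : ∀ s ∈ Ioo τ 0, (u s).2.1 < w := fun s hs => by
          obtain ⟨T, hT⟩ := exists_between (lt_min hs.1 hτr)
          exact (H.strictMonoOn_omega hwC (hu T ⟨hT.1, hT.2.trans_le (min_le_right _ _)⟩) le_rfl
            fun x hx => (hpu x ⟨hT.1.trans hx.1, hx.2⟩).1).2 s
              ⟨hT.2.trans_le (min_le_left _ _), hs.2⟩
        have hc : -(r / 2) ∈ Ioo τ 0 := ⟨hτr, by linarith⟩
        obtain ⟨C, hC, hCΩ, huC⟩ := hsol.exists_compact hγ hc fun t ht => by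
          have ht' : t ∈ Ioo τ 0 := ⟨ht.1, by linarith [ht.2]⟩
          exact ⟨(hpu t ht').1, (hpu t ht').2.le, ((hωlt t ht').trans hw.2).le⟩
        obtain ⟨T', hT', v, hv1, hv2, hv3⟩ := hsol.exists_extension isOpen_subsonicRegion
          (contDiffOn_field γ) hC hCΩ hτr hc.2.le fun t ht => huC t (Ioo_subset_Ioc_self ht)
        refine ⟨v, T', ⟨hT'.trans hτr, fun t ht => ?_, hv3⟩, hT'⟩
        obtain ⟨T, hT⟩ := exists_between hτr
        rw [hv2 t ht.1, (hu T hT).eq ht]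
    obtain ⟨u, T, hu, hTτ⟩ := hext
    have hpu : ∀ s ∈ Ioo τ 0, 0 < vel γ (u s) ∧ omegaF γ < (u s).2.1 := fun s hs =>
      hprop' T u s hu (hTτ.trans hs.1) hs
    have hτT : τ ∈ Ioo T 0 := ⟨hTτ, hτ0⟩
    have hdω := hu.solves.hasDerivAt_omega hτT
    have hdv := hu.solves.hasDerivAt_vel hτT
    have hv0 : 0 ≤ vel γ (u τ) := by
      refine ge_of_tendsto (hdv.continuousAt.tendsto.mono_left (nhdsWithin_le_nhds (s := Ioi τ))) ?_
      filter_upwards [Ioo_mem_nhdsGT hτ0] with s hs using (hpu s hs).1.le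
    have hω0 : omegaF γ ≤ (u τ).2.1 := by
      refine ge_of_tendsto (hdω.continuousAt.tendsto.mono_left (nhdsWithin_le_nhds (s := Ioi τ))) ?_
      filter_upwards [Ioo_mem_nhdsGT hτ0] with s hs using (hpu s hs).2.le
    obtain ⟨hmono, hltw⟩ := H.strictMonoOn_omega hwC hu hTτ.le fun s hs => (hpu s hs).1
    have hωs : ∀ s ∈ Ioo τ 0, (u τ).2.1 ≤ (u s).2.1 := fun s hs => by
      refine le_of_tendsto (hdω.continuousAt.tendsto.mono_left
        (nhdsWithin_le_nhds (s := Ioi τ))) ?_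
      filter_upwards [Ioo_mem_nhdsGT hs.1] with x hx
      exact (hmono ⟨hx.1, hx.2.trans hs.2⟩ hs hx.2).le
    have hωw : (u τ).2.1 < 2 - γ := by
      have hs : τ / 2 ∈ Ioo τ 0 := ⟨by linarith, by linarith⟩
      linarith [hωs _ hs, hltw _ hs, hw.2]
    rcases hv0.eq_or_lt with h0 | h0
    · -- the velocity vanishes
      have h1 : omegaF γ < (u τ).2.1 := hω0.lt_of_ne fun e =>
        hu.solves.vel_ne_zero_of_eq_omegaF hγ hτT (fun s hs => (hpu s hs).1) e.symm h0.symm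
      have hacc := hu.solves.accel_pos hγ hτT h0.symm (fun s hs => (hpu s hs).1) h1 hωw
      have e1 := eventually_lt_left hdv hacc
      rw [← h0] at e1
      set μ := (omegaF γ + (u τ).2.1) / 2 with hμ
      have e2 : ∀ᶠ s in 𝓝[<] τ, μ < (u s).2.1 :=
        (hdω.continuousAt.tendsto.mono_left nhdsWithin_le_nhds).eventually
          (lt_mem_nhds (by linarith))
      obtain ⟨l, hl, hls⟩ := mem_nhdsLT_iff_exists_Ioo_subset.mp (e1.and e2)
      have hl : l < τ := hl
      obtain ⟨t₂, ht₂⟩ := exists_between (max_lt hl hTτ)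
      have ht₂l : l < t₂ := (le_max_left _ _).trans_lt ht₂.1
      have hneg : vel γ (u t₂) < 0 := (hls ⟨ht₂l, ht₂.2⟩).1
      have hμs : ∀ s ∈ Ico t₂ 0, μ ≤ (u s).2.1 := fun s hs => by
        rcases lt_trichotomy s τ with h | h | h
        · exact (hls ⟨ht₂l.trans_le hs.1, h⟩).2.le
        · rw [h]; linarith
        · linarith [hωs s ⟨h, hs.2⟩]
      have hδ : 0 < min (μ - omegaF γ) (-vel γ (u t₂)) := lt_min (by linarith) (by linarith)
      have hev := H.eventually_near hwC hu
        (t₁ := t₂) ⟨(le_max_right _ _).trans_lt ht₂.1, ht₂.2.trans hτ0⟩ hδ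
      obtain ⟨w', ⟨T'', v, t, hov, htv, hvv, hvt⟩, u', T', ho', hT', hn⟩ :=
        (happ.and_eventually hev).exists
      have heq := H.eqOn_orbit ho' hov
      -- A nearby orbit crossing before t₂ would need W > 0 at t₂, but W is negative there. One
      -- crossing at or after t₂ would have ω < ω_F where ω is still close to values at least μ >
      -- ω_F.
      rcases lt_or_ge t t₂ with h | h
      · have h2 := hn t₂ ⟨le_rfl, ht₂.2.trans hτ0⟩
        have h3 := h2.2.trans_le (min_le_right _ _)
        rw [Real.dist_eq] at h3
        have h4 := hvv t₂ ⟨h.le, ht₂.2.trans hτ0⟩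
        rw [← heq ⟨max_lt hT' (htv.1.trans h), (ht₂.2.trans hτ0).le⟩] at h4
        linarith [(abs_lt.mp h3).2]
      · have h2 := (hn t ⟨h, htv.2⟩).1.trans_le (min_le_left _ _)
        have h3 : dist (u' t).2.1 (u t).2.1 ≤ dist (u' t) (u t) :=
          (le_max_left _ _).trans (le_max_right _ _)
        have h4 := h3.trans_lt h2
        rw [Real.dist_eq] at h4
        rw [← heq ⟨max_lt (hT'.trans_le h) htv.1, htv.2.le⟩] at hvt
        linarith [(abs_lt.mp h4).1, hμs t ⟨h, htv.2⟩]
    · have e1 : ∀ᶠ s in 𝓝[<] τ, 0 < vel γ (u s) :=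
        (hdv.continuousAt.tendsto.mono_left nhdsWithin_le_nhds).eventually (lt_mem_nhds h0)
      -- With W(τ) > 0, the value ω(τ) = ω_F would make the orbit cross just before τ, and ω(τ) >
      -- ω_F would keep the orbit good below the infimum τ.
      rcases hω0.eq_or_lt with h1 | h1
      · have e2 := eventually_lt_left hdω h0
        rw [← h1] at e2
        obtain ⟨l, hl, hls⟩ := mem_nhdsLT_iff_exists_Ioo_subset.mp (e1.and e2)
        have hl : l < τ := hl
        obtain ⟨t₂, ht₂⟩ := exists_between (max_lt hl hTτ)
        have ht₂l : l < t₂ := (le_max_left _ _).trans_lt ht₂.1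
        refine hnc ⟨T, u, t₂, hu, ⟨(le_max_right _ _).trans_lt ht₂.1, ht₂.2.trans hτ0⟩,
          fun s hs => ?_, (hls ⟨ht₂l, ht₂.2⟩).2⟩
        rcases lt_trichotomy s τ with h | h | h
        · exact (hls ⟨ht₂l.trans_le hs.1, h⟩).1
        · rw [h]; exact h0
        · exact (hpu s ⟨h, hs.2⟩).1
      · have e2 : ∀ᶠ s in 𝓝[<] τ, omegaF γ < (u s).2.1 :=
          (hdω.continuousAt.tendsto.mono_left nhdsWithin_le_nhds).eventually (lt_mem_nhds h1)
        obtain ⟨l, hl, hls⟩ := mem_nhdsLT_iff_exists_Ioo_subset.mp (e1.and e2)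
        have hl : l < τ := hl
        obtain ⟨t₂, ht₂⟩ := exists_between (max_lt hl hTτ)
        have ht₂l : l < t₂ := (le_max_left _ _).trans_lt ht₂.1
        have : t₂ ∈ A := by
          refine ⟨ht₂.2.trans hτ0, u, T, hu, ((le_max_right _ _).trans_lt ht₂.1).le,
            fun s hs => ?_⟩
          rcases lt_trichotomy s τ with h | h | h
          · exact hls ⟨ht₂l.trans hs.1, h⟩
          · rw [h]; exact ⟨h0, h1⟩
          · exact hpu s ⟨h, hs.2⟩
        linarith [csInf_le hbdd this, ht₂.2]
  obtain ⟨u, hu⟩ := H.exists_glued (w := w) (Iio (-(r / 2))) fun T hT => by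
    have hT : T < -(r / 2) := hT
    obtain ⟨u, T', hu, hT', -⟩ := hall T (by linarith)
    exact ⟨u, hu.mono hT' hT⟩
  have hpu : ∀ t < 0, 0 < vel γ (u t) ∧ omegaF γ < (u t).2.1 := fun t ht => by
    obtain ⟨T, hT⟩ := exists_lt (min t (-(r / 2)))
    exact hprop T T u t (hall T (by linarith [hT.trans_le (min_le_right t (-(r / 2)))]))
      (hu T (hT.trans_le (min_le_right _ _))) (hT.trans_le (min_le_left _ _))
      ⟨hT.trans_le (min_le_left _ _), ht⟩
  refine ⟨u, fun T hT => hu T hT, fun t ht => ⟨(hpu t ht).1, (hpu t ht).2, ?_⟩⟩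
  obtain ⟨T, hT⟩ := exists_lt (min t (-(r / 2)))
  exact (H.strictMonoOn_omega hwC (hu T (hT.trans_le (min_le_right _ _))) le_rfl
    fun s hs => (hpu s hs.2).1).2 t ⟨hT.trans_le (min_le_left _ _), ht⟩

end IsSonicFamily

/-! ### Orbits near the far-field solution -/

/-- The far-field solution. -/
def farField (γ t : ℝ) : ℝ × ℝ × ℝ :=
  (rhoS γ (2 - γ) * Real.exp (-2 / (2 - γ) * t), 2 - γ,
    (2 - γ) ^ 2 * Real.exp (-2 / (2 - γ) * t))

section FarField

variable {γ : ℝ}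

theorem hasDerivAt_farField (hγ : γ ∈ Ioo (1 : ℝ) (4 / 3)) (t : ℝ) :
    HasDerivAt (farField γ) (slopeField γ (farField γ t) (-2 / (2 - γ))) t := by
  have hb : 2 - γ ≠ 0 := by linarith [hγ.2]
  have he : HasDerivAt (fun t => Real.exp (-2 / (2 - γ) * t))
      (Real.exp (-2 / (2 - γ) * t) * (-2 / (2 - γ) * 1)) t :=
    ((hasDerivAt_id t).const_mul _).exp
  refine ((he.const_mul (rhoS γ (2 - γ))).prodMk ((hasDerivAt_const t (2 - γ)).prodMk
    (he.const_mul ((2 - γ) ^ 2)))).congr_deriv ?_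
  simp only [slopeField, farField, relVel, Prod.mk.injEq]
  refine ⟨by ring, by field_simp; ring, by field_simp; ring⟩

theorem gap_mul_farField (hγ : γ ∈ Ioo (1 : ℝ) (4 / 3)) (t : ℝ) :
    ((farField γ t).2.2 - (farField γ t).2.1 ^ 2) * (-2 / (2 - γ))
      = h γ (farField γ t).1 (farField γ t).2.1 := by
  have hb : 2 - γ ≠ 0 := by linarith [hγ.2]
  have e := rhoS_mul hγ hb
  rw [h_eq]
  simp only [farField]
  have : 4 * Real.pi / (4 - 3 * γ) * (rhoS γ (2 - γ) * Real.exp (-2 / (2 - γ) * t)) * (2 - γ)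
    = (4 * Real.pi / (4 - 3 * γ) * rhoS γ (2 - γ) * (2 - γ)) * Real.exp (-2 / (2 - γ) * t) := by
    ring
  rw [this, e]
  field_simp
  ring

theorem farField_zero (γ : ℝ) : farField γ 0 = (rhoS γ (2 - γ), 2 - γ, (2 - γ) ^ 2) := by
  simp [farField]

theorem farField_germ (hγ : γ ∈ Ioo (1 : ℝ) (4 / 3)) :
    SonicGerm γ (2 - γ) (farField γ) (fun _ => -2 / (2 - γ)) where
  analytic := analyticAt_const
  init := farField_zero γ
  init_slope := (R1_far hγ).symm
  ode := Eventually.of_forall (hasDerivAt_farField hγ)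
  slope := Eventually.of_forall (gap_mul_farField hγ)

theorem farField_mem (hγ : γ ∈ Ioo (1 : ℝ) (4 / 3)) {t : ℝ} (ht : t < 0) :
    farField γ t ∈ subsonicRegion := by
  have hb : 0 < 2 - γ := by linarith [hγ.2]
  refine ⟨mul_pos (rhoS_pos hγ hb) (Real.exp_pos _), ?_⟩
  have : 1 < Real.exp (-2 / (2 - γ) * t) := by
    rw [Real.one_lt_exp_iff]
    exact mul_pos_of_neg_of_neg (div_neg_of_neg_of_pos (by norm_num) hb) ht
  simp only [farField]
  have hb2 : 0 < (2 - γ) ^ 2 := by positivity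
  nlinarith

theorem rate_farField (hγ : γ ∈ Ioo (1 : ℝ) (4 / 3)) {t : ℝ} (ht : t < 0) :
    rate γ (farField γ t) = -2 / (2 - γ) := by
  unfold rate
  rw [← gap_mul_farField hγ, mul_div_cancel_left₀ _ (sub_pos.mpr (farField_mem hγ ht).2).ne']

theorem vel_farField (hγ : γ ∈ Ioo (1 : ℝ) (4 / 3)) {t : ℝ} (ht : t < 0) :
    vel γ (farField γ t) = 0 := by
  have hb : 2 - γ ≠ 0 := by linarith [hγ.2]
  unfold vel relVel
  rw [rate_farField hγ ht]
  simp only [farField]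
  field_simp
  ring

theorem solvesOn_farField (hγ : γ ∈ Ioo (1 : ℝ) (4 / 3)) (T : ℝ) :
    SolvesOn (field γ) subsonicRegion T 0 (farField γ) := fun t ht => by
  refine ⟨?_, farField_mem hγ ht.2⟩
  unfold field
  rw [rate_farField hγ ht.2]
  exact hasDerivAt_farField hγ t

/-- Uniqueness at the sonic point identifies the member w = 2-γ of the family with the explicit
far-field solution. Continuous dependence then places the orbits with w near 2-γ close to it. -/
theorem IsSonicFamily.isOrbit_farField (hγ : γ ∈ Ioo (1 : ℝ) (4 / 3)) {r : ℝ}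
    {U : ℝ → ℝ → ℝ × ℝ × ℝ} {S : ℝ → ℝ → ℝ} (H : IsSonicFamily γ r U S) {T : ℝ}
    (hT : T < -(r / 2)) : IsOrbit γ r U (2 - γ) T (farField γ) := by
  have hw : 2 - γ ∈ Icc (omegaF γ) (2 - γ) := ⟨(omegaF_lt hγ).le, le_rfl⟩
  have hr := H.r_pos
  refine ⟨hT, fun t ht => ?_, solvesOn_farField hγ T⟩
  rcases ht.2.eq_or_lt with h | h
  · rw [h, farField_zero, H.init _ hw]
  · have h1 := ((farField_germ hγ).eventually_eq hγ hw (H.sonicGerm hw)).filter_mono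
      (nhdsWithin_mono 0 Iio_subset_Iic_self)
    obtain ⟨s, hs, hs'⟩ := (h1.and (Ioo_mem_nhdsLT (neg_lt_zero.mpr hr))).exists
    exact (solvesOn_farField hγ (-r)).eqOn isOpen_subsonicRegion (contDiffOn_field γ)
      (H.solvesOn hw) hs' hs.1 ⟨by linarith [ht.1], h⟩

/-- For p ≤ 0 the coefficient B may be lowered to some C ≤ B with C² < 4A, either 0 or B itself.
Then p² - Cp + A is positive definite and dominates σ(1+p²). The factor 2/5 pays for perturbing A
and B, since -p ≤ (1+p²)/2. -/
theorem exists_quadratic_bound {A B : ℝ} (hA : 0 < A) (hB : 0 ≤ B ∨ B ^ 2 < 4 * A) :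
    ∃ δ > 0, ∀ A' B' p : ℝ, |A' - A| < δ → |B' - B| < δ → p ≤ 0 →
      p * B' - A' - p ^ 2 ≤ -(δ * (1 + p ^ 2)) := by
  obtain ⟨C, hC1, hC2⟩ : ∃ C ≤ B, C ^ 2 < 4 * A := by
    rcases hB with h | h
    · exact ⟨0, h, by linarith⟩
    · exact ⟨B, le_rfl, h⟩
  set σ := (4 * A - C ^ 2) / (4 * (1 + A)) with hσ
  have hσ0 : 0 < σ := div_pos (by linarith) (by linarith)
  have hσ1 : σ < 1 := by
    rw [hσ, div_lt_one (by linarith)]; nlinarith [sq_nonneg C]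
  have hσ2 : 4 * (1 + A) * σ = 4 * A - C ^ 2 := by rw [hσ]; field_simp
  have hquad : ∀ p : ℝ, 0 ≤ (1 - σ) * p ^ 2 - C * p + (A - σ) := fun p => by
    have h1 : 0 ≤ (4 * (1 - σ)) * ((1 - σ) * p ^ 2 - C * p + (A - σ)) := by
      nlinarith [sq_nonneg (2 * (1 - σ) * p - C), sq_nonneg σ]
    exact nonneg_of_mul_nonneg_right h1 (by linarith)
  refine ⟨σ * (2 / 5), by positivity, fun A' B' p h1 h2 hp => ?_⟩
  have h3 := (abs_lt.mp h1).1
  have h4 := (abs_lt.mp h2).1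
  have h5 : p * B' ≤ p * (C - σ * (2 / 5)) :=
    mul_le_mul_of_nonpos_left (by linarith) hp
  nlinarith [hquad p, mul_nonneg hσ0.le (sq_nonneg (p + 1))]

/-- Orbits close to the far-field solution do not all cross. -/
theorem IsSonicFamily.exists_not_crosses (hγ : γ ∈ Ioo (1 : ℝ) (4 / 3)) {r : ℝ}
    {U : ℝ → ℝ → ℝ × ℝ × ℝ} {S : ℝ → ℝ → ℝ} (H : IsSonicFamily γ r U S) :
    ∃ w ∈ Ico (omegaF γ) (2 - γ), ¬ Crosses γ r U w := by
  by_contra! hcr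
  have hr := H.r_pos
  have h1 := hγ.1
  have hb : 0 < 2 - γ := by linarith [hγ.2]
  have hα : 0 < 4 - 3 * γ := by linarith [hγ.2]
  have hab := omegaF_lt hγ
  have ha := omegaF_pos hγ
  -- coefficients of the Riccati inequality
  let Bf : ℝ × ℝ × ℝ → ℝ := fun x =>
    ((γ - 1) * (3 * x.1 - (4 - 3 * γ)) - (4 - 3 * γ) * (x.1 - (1 - γ))) / x.1
      - x.1 * (2 * x.1 + γ - 1 - 2 * γ * (3 * x.1 - (4 - 3 * γ)) - (γ + 1) * x.2.1) * x.2.2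
  let Af : ℝ × ℝ × ℝ → ℝ := fun x => (3 * x.1 - (4 - 3 * γ)) *
    ((4 - 3 * γ) / x.1 - (γ - 1) * (3 * x.1 + 1) * x.2.2)
  have hA0 : 0 < Af (2 - γ, 0, 0) := by
    have : Af (2 - γ, 0, 0) = 2 * (4 - 3 * γ) / (2 - γ) := by simp only [Af]; field_simp; ring
    rw [this]; positivity
  -- When 5γ < 6 the condition B² < 4A amounts to (5γ-6)² < 8(4-3γ)(2-γ), which holds in this range
  -- of γ.
  have hB0 : 0 ≤ Bf (2 - γ, 0, 0) ∨ Bf (2 - γ, 0, 0) ^ 2 < 4 * Af (2 - γ, 0, 0) := by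
    have e1 : Bf (2 - γ, 0, 0) = (5 * γ - 6) / (2 - γ) := by simp only [Bf]; field_simp; ring
    have e2 : Af (2 - γ, 0, 0) = 2 * (4 - 3 * γ) / (2 - γ) := by simp only [Af]; field_simp; ring
    rw [e1, e2]
    rcases le_or_gt 6 (5 * γ) with h | h
    · exact Or.inl (div_nonneg (by linarith) hb.le)
    · right
      rw [div_pow, div_lt_iff₀ (by positivity)]
      have : 4 * (2 * (4 - 3 * γ) / (2 - γ)) * (2 - γ) ^ 2 = 8 * (4 - 3 * γ) * (2 - γ) := by
        field_simp; ring
      rw [this]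
      nlinarith
  obtain ⟨δ, hδ, hquad⟩ := exists_quadratic_bound hA0 hB0
  have hne : ((2 - γ, 0, 0) : ℝ × ℝ × ℝ).1 ≠ 0 := hb.ne'
  have cA : ContinuousAt Af (2 - γ, 0, 0) := by
    simp only [Af]
    refine ContinuousAt.mul (by fun_prop) (ContinuousAt.sub ?_ (by fun_prop))
    exact continuousAt_const.div continuousAt_fst hne
  have cB : ContinuousAt Bf (2 - γ, 0, 0) := by
    simp only [Bf]
    refine ContinuousAt.sub ?_ (by fun_prop)
    exact ContinuousAt.div (by fun_prop) continuousAt_fst hne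
  obtain ⟨η, hη, hAB⟩ := Metric.eventually_nhds_iff.mp
    ((Metric.tendsto_nhds.mp cA.tendsto δ hδ).and (Metric.tendsto_nhds.mp cB.tendsto δ hδ))
  -- the time interval
  set M := 2 + 1 / η with hM
  have hMpos : 0 < M := by positivity
  set t₂ := -(M / (2 * (2 - γ))) with ht₂
  have ht₂0 : t₂ < 0 := by rw [ht₂, neg_lt_zero]; positivity
  -- The function arctan p decreases at rate at least δ but has range of length π, so a time π/δ is
  -- too long. The additional 1 covers the margins of 1/2 given up at both ends.
  set t₁ := t₂ - (Real.pi / δ + 1) with ht₁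
  have hpi : 0 < Real.pi / δ := div_pos Real.pi_pos hδ
  have ht₁₂ : t₁ < t₂ := by linarith
  have hq : ∀ t ≤ t₂, (2 - γ) ^ 2 + M ≤ (farField γ t).2.2 := fun t ht => by
    simp only [farField]
    have h2 := Real.add_one_le_exp (-2 / (2 - γ) * t)
    have h3 : (2 - γ) ^ 2 * (-2 / (2 - γ) * t + 1) = (2 - γ) ^ 2 - 2 * (2 - γ) * t := by
      field_simp; ring
    have h4 : 2 * (2 - γ) * t ≤ -M := by
      calc 2 * (2 - γ) * t ≤ 2 * (2 - γ) * t₂ := by gcongr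
        _ = -M := by rw [ht₂]; field_simp
    have h5 := mul_le_mul_of_nonneg_left h2 (sq_nonneg (2 - γ))
    linarith
  obtain ⟨T, hT⟩ := exists_lt (min t₁ (-(r / 2)))
  have hw : 2 - γ ∈ Icc (omegaF γ) (2 - γ) := ⟨hab.le, le_rfl⟩
  have hev := H.eventually_near hw (H.isOrbit_farField hγ (hT.trans_le (min_le_right _ _)))
    (t₁ := t₁) ⟨hT.trans_le (min_le_left _ _), by linarith⟩
    (δ := min (min η 1) (2 - γ - omegaF γ)) (by
      have : 0 < 2 - γ - omegaF γ := by linarith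
      positivity)
  have hev' := hev.filter_mono (nhdsWithin_mono (2 - γ) Ico_subset_Icc_self)
  have := right_nhdsWithin_Ico_neBot hab
  obtain ⟨w, ⟨u, T', hu, hT', hn⟩, hwI⟩ := (hev'.and self_mem_nhdsWithin).exists
  have hwC := Ico_subset_Icc_self hwI
  have hn1 : ∀ s ∈ Ico t₁ 0, |(u s).2.1 - (2 - γ)| < η ∧ omegaF γ < (u s).2.1 ∧
      |vel γ (u s)| < η ∧ (farField γ s).2.2 - 1 < (u s).2.2 := fun s hs => by
    obtain ⟨h2, h3⟩ := hn s hs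
    have d1 : dist (u s).2.1 (farField γ s).2.1 < min (min η 1) (2 - γ - omegaF γ) :=
      lt_of_le_of_lt ((le_max_left _ _).trans (le_max_right _ _)) h2
    have d2 : dist (u s).2.2 (farField γ s).2.2 < min (min η 1) (2 - γ - omegaF γ) :=
      lt_of_le_of_lt ((le_max_right _ _).trans (le_max_right _ _)) h2
    rw [vel_farField hγ hs.2] at h3
    rw [Real.dist_eq] at d1 d2 h3
    rw [sub_zero] at h3
    have d1' : |(u s).2.1 - (2 - γ)| < min (min η 1) (2 - γ - omegaF γ) := d1
    have m1 : min (min η 1) (2 - γ - omegaF γ) ≤ η := (min_le_left _ _).trans (min_le_left _ _)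
    have m2 : min (min η 1) (2 - γ - omegaF γ) ≤ 1 := (min_le_left _ _).trans (min_le_right _ _)
    have m3 := min_le_right (min η 1) (2 - γ - omegaF γ)
    exact ⟨d1'.trans_le m1, by linarith [(abs_lt.mp d1').1], h3.trans_le m1,
      by linarith [(abs_lt.mp d2).1]⟩
  obtain ⟨T'', v, t, hv, htv, hvv, hvt⟩ := hcr w hwI
  have heq := H.eqOn_orbit hu hv
  have htt : t < t₁ := by
    by_contra! h
    rw [← heq ⟨max_lt (hT'.trans_le h) htv.1, htv.2.le⟩] at hvt
    linarith [(hn1 t ⟨h, htv.2⟩).2.1]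
  have hpos : ∀ s ∈ Ico t₁ 0, 0 < vel γ (u s) := fun s hs => by
    rw [heq ⟨max_lt (hT'.trans_le hs.1) (htv.1.trans (htt.trans_le hs.1)), hs.2.le⟩]
    exact hvv s ⟨htt.le.trans hs.1, hs.2⟩
  have hlt : ∀ s ∈ Ioo t₁ 0, (u s).2.1 < 2 - γ := fun s hs =>
    ((H.strictMonoOn_omega hwC hu hT'.le fun x hx => hpos x ⟨hx.1.le, hx.2⟩).2 s hs).trans hwI.2
  -- the Riccati inequality
  have hI : ∀ s ∈ Ioo t₁ t₂, s ∈ Ioo T' 0 := fun s hs => ⟨hT'.trans hs.1, hs.2.trans ht₂0⟩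
  let p : ℝ → ℝ := fun s => vel γ (u s) / ((u s).2.1 - (2 - γ))
  have hd : ∀ s ∈ Ioo t₁ t₂, HasDerivAt p
      (accel γ (u s) / ((u s).2.1 - (2 - γ)) - p s ^ 2) s := fun s hs => by
    have h2 : (u s).2.1 - (2 - γ) ≠ 0 :=
      (sub_neg.mpr (hlt s ⟨hs.1, hs.2.trans ht₂0⟩)).ne
    refine ((hu.solves.hasDerivAt_vel (hI s hs)).fun_div
      ((hu.solves.hasDerivAt_omega (hI s hs)).sub_const (2 - γ)) h2).congr_deriv ?_
    simp only [p]
    field_simp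
  have hbound : ∀ s ∈ Ioo t₁ t₂,
      accel γ (u s) / ((u s).2.1 - (2 - γ)) - p s ^ 2 ≤ -(δ * (1 + p s ^ 2)) := fun s hs => by
    have hs0 : s ∈ Ico t₁ 0 := ⟨hs.1.le, hs.2.trans ht₂0⟩
    obtain ⟨n1, n2, n3, n4⟩ := hn1 s hs0
    have n5 := hlt s ⟨hs.1, hs0.2⟩
    have n6 := hpos s hs0
    have n7 := hq s hs.2.le
    have hω : 0 < (u s).2.1 := ha.trans n2
    have hz : (u s).2.1 - (2 - γ) < 0 := sub_neg.mpr n5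
    have hgap : 1 / η < (u s).2.2 - (u s).2.1 ^ 2 := by
      have : (u s).2.1 ^ 2 ≤ (2 - γ) ^ 2 := by gcongr
      linarith
    have hη' : 0 < 1 / η := by positivity
    have hk0 : 0 < ((u s).2.2 - (u s).2.1 ^ 2)⁻¹ := inv_pos.mpr (hη'.trans hgap)
    have hk1 : ((u s).2.2 - (u s).2.1 ^ 2)⁻¹ < η := by
      rw [inv_lt_comm₀ (hη'.trans hgap) hη, ← one_div]; exact hgap
    have hp0 : p s ≤ 0 := div_nonpos_of_nonneg_of_nonpos n6.le hz.le
    have hx := hAB (y := ((u s).2.1, vel γ (u s), ((u s).2.2 - (u s).2.1 ^ 2)⁻¹)) (by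
      rw [Prod.dist_eq, Prod.dist_eq]
      simp only [Real.dist_eq, sub_zero]
      rw [abs_of_pos hk0]
      exact max_lt n1 (max_lt n3 hk1))
    simp only [Real.dist_eq] at hx
    refine le_trans ?_ (hquad _ _ (p s) hx.1 hx.2 hp0)
    -- This is `accel_eq` divided by z = ω-(2-γ) < 0. The term γW²/ω turns into γp²z/ω ≤ 0, so it
    -- only helps the inequality.
    have hid : accel γ (u s) / ((u s).2.1 - (2 - γ)) =
        p s * Bf ((u s).2.1, vel γ (u s), ((u s).2.2 - (u s).2.1 ^ 2)⁻¹)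
        - Af ((u s).2.1, vel γ (u s), ((u s).2.2 - (u s).2.1 ^ 2)⁻¹)
        + γ * p s ^ 2 * ((u s).2.1 - (2 - γ)) / (u s).2.1 := by
      rw [accel_eq (hu.solves s (hI s hs)).2 hω.ne']
      have hg : (u s).2.2 - (u s).2.1 ^ 2 ≠ 0 := (hη'.trans hgap).ne'
      have hz' := hz.ne
      simp only [p, Af, Bf]
      generalize vel γ (u s) = W at *
      generalize (u s).2.2 - (u s).2.1 ^ 2 = g at *
      generalize (u s).2.1 = ω at *
      field_simp
      ring
    have hneg : γ * p s ^ 2 * ((u s).2.1 - (2 - γ)) / (u s).2.1 ≤ 0 := by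
      refine div_nonpos_of_nonpos_of_nonneg (mul_nonpos_of_nonneg_of_nonpos ?_ hz.le) hω.le
      have : 0 < γ := by linarith
      positivity
    rw [hid]
    linarith
  obtain ⟨s₁, hs₁⟩ := exists_between (show t₁ < t₁ + 1 / 2 by linarith)
  obtain ⟨s₂, hs₂⟩ := exists_between (show t₂ - 1 / 2 < t₂ by linarith)
  have hanti : AntitoneOn (fun s => Real.arctan (p s) + δ * s) (Icc s₁ s₂) := by
    have hsub : ∀ s ∈ Icc s₁ s₂, s ∈ Ioo t₁ t₂ := fun s hs =>
      ⟨hs₁.1.trans_le hs.1, hs.2.trans_lt hs₂.2⟩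
    have hd' : ∀ s ∈ Icc s₁ s₂, HasDerivAt (fun s => Real.arctan (p s) + δ * s) _ s := fun s hs =>
      (hd s (hsub s hs)).arctan.fun_add ((hasDerivAt_id s).const_mul δ)
    refine antitoneOn_of_deriv_nonpos (convex_Icc _ _)
      (fun s hs => (hd' s hs).continuousAt.continuousWithinAt) (fun s hs => ?_) fun s hs => ?_
    · exact (hd' s (interior_subset hs)).differentiableAt.differentiableWithinAt
    · have hs := interior_subset hs
      rw [(hd' s hs).deriv]
      have h2 := hbound s (hsub s hs)
      have h3 : 0 < 1 + p s ^ 2 := by positivity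
      have h4 : 1 / (1 + p s ^ 2) * (accel γ (u s) / ((u s).2.1 - (2 - γ)) - p s ^ 2) ≤ -δ := by
        rw [one_div, inv_mul_le_iff₀ h3]
        linarith
      linarith
  have hs₁₂ : s₁ ≤ s₂ := by linarith [hs₁.2, hs₂.1]
  have hfin := hanti (left_mem_Icc.mpr hs₁₂) (right_mem_Icc.mpr hs₁₂) hs₁₂
  simp only at hfin
  have e1 := Real.neg_pi_div_two_lt_arctan (p s₂)
  have e2 := Real.arctan_lt_pi_div_two (p s₁)
  have e3 : δ * (Real.pi / δ) = Real.pi := by field_simp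
  have e4 : δ * (Real.pi / δ) ≤ δ * (s₂ - s₁) := by
    gcongr
    linarith [hs₁.2, hs₂.1]
  linarith [Real.pi_pos]

/-- The critical w is below 2-γ, for otherwise every w in [ω_F, 2-γ) would cross, against
`exists_not_crosses`. It is therefore a non-crossing limit of crossing values from the left, as
`exists_global` requires. -/
theorem IsSonicFamily.exists_global_orbit (hγ : γ ∈ Ioo (1 : ℝ) (4 / 3)) {r : ℝ}
    {U : ℝ → ℝ → ℝ × ℝ × ℝ} {S : ℝ → ℝ → ℝ} (H : IsSonicFamily γ r U S) :
    ∃ w ∈ Ioo (omegaF γ) (2 - γ), (∀ w' ∈ Ico (omegaF γ) w, Crosses γ r U w') ∧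
      ∃ u, (∀ T < -(r / 2), IsOrbit γ r U w T u) ∧
        ∀ t < 0, 0 < vel γ (u t) ∧ omegaF γ < (u t).2.1 ∧ (u t).2.1 < w := by
  obtain ⟨w, hw, h1, h2⟩ := H.exists_critical hγ
  obtain ⟨w', hw', hnc⟩ := H.exists_not_crosses hγ
  have hwb : w < 2 - γ := by
    rcases hw.2.eq_or_lt with h | h
    · exact absurd (h1 w' ⟨hw'.1, by rw [h]; exact hw'.2⟩) hnc
    · exact h
  refine ⟨w, ⟨hw.1, hwb⟩, h1, H.exists_global hγ ⟨hw.1, hwb⟩ (h2 hwb) ?_⟩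
  have := right_nhdsWithin_Ico_neBot hw.1
  have hle : 𝓝[Ico (omegaF γ) w] w ≤ 𝓝[Icc (omegaF γ) (2 - γ)] w :=
    nhdsWithin_mono _ (Ico_subset_Icc_self.trans (Icc_subset_Icc_right hw.2))
  refine Frequently.filter_mono (Eventually.frequently ?_) hle
  filter_upwards [self_mem_nhdsWithin] with x hx using h1 x hx

end FarField

/-! ### Behaviour at the origin -/

/-- The logarithmic slope `y ρ' / ρ` as a function of `y`. -/
def logSlope (γ : ℝ) (ρ ω : ℝ → ℝ) (y : ℝ) : ℝ :=
  y ^ 2 * h γ (ρ y) (ω y) / G γ y (ρ y) (ω y)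

/-- A subsonic solution on `(0, Y)` with increasing relative velocity between the Friedman value
and `w`. -/
structure IsMonotoneFlow (γ Y w : ℝ) (ρ ω : ℝ → ℝ) : Prop where
  pos : 0 < Y
  solves : ∀ y ∈ Ioo 0 Y, SolvesAt γ ρ ω y
  subsonic : ∀ y ∈ Ioo 0 Y, 0 < G γ y (ρ y) (ω y)
  rho_pos : ∀ y ∈ Ioo 0 Y, 0 < ρ y
  vel_pos : ∀ y ∈ Ioo 0 Y, 0 < relVel γ (ω y) (logSlope γ ρ ω y)
  lt_omega : ∀ y ∈ Ioo 0 Y, omegaF γ < ω y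
  omega_lt : ∀ y ∈ Ioo 0 Y, ω y < w

theorem exists_Ioc_of_eventually {P : ℝ → Prop} {Y : ℝ} (hY : 0 < Y)
    (h : ∀ᶠ y in 𝓝[>] 0, P y) : ∃ y₀ ∈ Ioo 0 Y, ∀ y ∈ Ioc 0 y₀, P y := by
  obtain ⟨l, hl, hs⟩ := mem_nhdsGT_iff_exists_Ioo_subset.mp h
  have hl : 0 < l := hl
  obtain ⟨y₀, h0, h1⟩ := exists_between (lt_min hl hY)
  exact ⟨y₀, ⟨h0, h1.trans_le (min_le_right _ _)⟩,
    fun y hy => hs ⟨hy.1, hy.2.trans_lt (h1.trans_le (min_le_left _ _))⟩⟩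

namespace IsMonotoneFlow

variable {γ Y w : ℝ} {ρ ω : ℝ → ℝ}

theorem hasDerivAt_rho (F : IsMonotoneFlow γ Y w ρ ω) {y : ℝ} (hy : y ∈ Ioo 0 Y) :
    HasDerivAt ρ (ρ y * logSlope γ ρ ω y / y) y := by
  refine (F.solves y hy).1.congr_deriv ?_
  have := hy.1.ne'
  have := (F.subsonic y hy).ne'
  unfold logSlope
  field_simp

theorem hasDerivAt_omega (F : IsMonotoneFlow γ Y w ρ ω) {y : ℝ} (hy : y ∈ Ioo 0 Y) :
    HasDerivAt ω (relVel γ (ω y) (logSlope γ ρ ω y) / y) y := by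
  refine (F.solves y hy).2.congr_deriv ?_
  have := hy.1.ne'
  have := (F.subsonic y hy).ne'
  unfold logSlope relVel
  field_simp

theorem slope_neg (hγ : γ ∈ Ioo (1 : ℝ) (4 / 3)) (F : IsMonotoneFlow γ Y w ρ ω) {y : ℝ}
    (hy : y ∈ Ioo 0 Y) : logSlope γ ρ ω y < 0 := by
  have h1 := F.vel_pos y hy
  have h2 := F.lt_omega y hy
  have hω := (omegaF_pos hγ).trans h2
  unfold relVel at h1
  unfold omegaF at h2
  exact neg_of_mul_neg_right (by linarith : ω y * logSlope γ ρ ω y < 0) hω.le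

theorem h_neg (hγ : γ ∈ Ioo (1 : ℝ) (4 / 3)) (F : IsMonotoneFlow γ Y w ρ ω) {y : ℝ}
    (hy : y ∈ Ioo 0 Y) : h γ (ρ y) (ω y) < 0 := by
  have h1 := F.slope_neg hγ hy
  unfold logSlope at h1
  have h2 := (div_neg_iff.mp h1).resolve_left fun h => (h.2.trans (F.subsonic y hy)).false
  have h3 : (0 : ℝ) < y ^ 2 := pow_pos hy.1 2
  exact neg_of_mul_neg_right h2.1 h3.le

/-- A rearrangement of W > 0. It controls the distance of ω from its Friedman value by the
logarithmic slope alone, so only the decay of the slope has to be studied. -/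
theorem omega_sub_lt (F : IsMonotoneFlow γ Y w ρ ω) {y : ℝ} (hy : y ∈ Ioo 0 Y) :
    3 * (ω y - omegaF γ) < ω y * -logSlope γ ρ ω y := by
  have h1 := F.vel_pos y hy
  unfold relVel at h1
  unfold omegaF
  linarith

theorem strictAntiOn_rho (hγ : γ ∈ Ioo (1 : ℝ) (4 / 3)) (F : IsMonotoneFlow γ Y w ρ ω) :
    StrictAntiOn ρ (Ioo 0 Y) := by
  refine strictAntiOn_of_deriv_neg (convex_Ioo _ _)
    (fun y hy => (F.hasDerivAt_rho hy).continuousAt.continuousWithinAt) fun y hy => ?_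
  rw [interior_Ioo] at hy
  rw [(F.hasDerivAt_rho hy).deriv]
  exact div_neg_of_neg_of_pos (mul_neg_of_pos_of_neg (F.rho_pos y hy) (F.slope_neg hγ hy)) hy.1

theorem w_pos (hγ : γ ∈ Ioo (1 : ℝ) (4 / 3)) (F : IsMonotoneFlow γ Y w ρ ω) : 0 < w := by
  have hy : Y / 2 ∈ Ioo 0 Y := ⟨by linarith [F.pos], by linarith [F.pos]⟩
  linarith [F.lt_omega _ hy, F.omega_lt _ hy, omegaF_pos hγ]

theorem eventually_mem (F : IsMonotoneFlow γ Y w ρ ω) : ∀ᶠ y in 𝓝[>] (0 : ℝ), y ∈ Ioo 0 Y :=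
  Ioo_mem_nhdsGT F.pos

/-- Near the origin `G` is comparable to `ρ ^ (γ - 1)`. -/
theorem eventually_le_G (hγ : γ ∈ Ioo (1 : ℝ) (4 / 3)) (F : IsMonotoneFlow γ Y w ρ ω) :
    ∀ᶠ y in 𝓝[>] 0, γ / 2 * ρ y ^ (γ - 1) ≤ G γ y (ρ y) (ω y) := by
  have h1 := hγ.1
  have hy₁ : Y / 2 ∈ Ioo 0 Y := ⟨by linarith [F.pos], by linarith [F.pos]⟩
  have hρ₁ := F.rho_pos _ hy₁
  set A := γ / 2 * ρ (Y / 2) ^ (γ - 1) with hA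
  have hA0 : 0 < A := by have : 0 < ρ (Y / 2) ^ (γ - 1) := Real.rpow_pos_of_pos hρ₁ _
                         rw [hA]; positivity
  have h2 : Tendsto (fun y : ℝ => y ^ 2 * w ^ 2) (𝓝[>] 0) (𝓝 0) := by
    have : Continuous fun y : ℝ => y ^ 2 * w ^ 2 := by fun_prop
    simpa using (this.tendsto 0).mono_left nhdsWithin_le_nhds
  filter_upwards [Ioo_mem_nhdsGT hy₁.1, h2.eventually (gt_mem_nhds hA0)] with y hy hyA
  have hy' : y ∈ Ioo 0 Y := ⟨hy.1, hy.2.trans hy₁.2⟩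
  have h3 : ρ (Y / 2) ^ (γ - 1) ≤ ρ y ^ (γ - 1) :=
    Real.rpow_le_rpow hρ₁.le (F.strictAntiOn_rho hγ hy' hy₁ hy.2).le (by linarith)
  have h4 : y ^ 2 * ω y ^ 2 ≤ y ^ 2 * w ^ 2 := by
    have := (omegaF_pos hγ).trans (F.lt_omega y hy')
    have := (F.omega_lt y hy').le
    gcongr
  have h5 : A ≤ γ / 2 * ρ y ^ (γ - 1) := by rw [hA]; gcongr
  unfold G
  linarith

theorem neg_h_le (hγ : γ ∈ Ioo (1 : ℝ) (4 / 3)) (F : IsMonotoneFlow γ Y w ρ ω) {y : ℝ}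
    (hy : y ∈ Ioo 0 Y) : -h γ (ρ y) (ω y) ≤ 4 * Real.pi / (4 - 3 * γ) * w * ρ y := by
  have hα : 0 < 4 - 3 * γ := by linarith [hγ.2]
  have h1 := hγ.1
  have h2 : 0 < 2 - γ := by linarith [hγ.2]
  have hω := (omegaF_pos hγ).trans (F.lt_omega y hy)
  have hρ := F.rho_pos y hy
  have hpi := Real.pi_pos
  have h3 : 4 * Real.pi / (4 - 3 * γ) * ρ y * ω y ≤ 4 * Real.pi / (4 - 3 * γ) * ρ y * w := by
    have := (F.omega_lt y hy).le
    gcongr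
  rw [h_eq]
  nlinarith [mul_pos (sub_pos.mpr h1) h2, mul_pos (sub_pos.mpr h1) hω, sq_nonneg (ω y)]

/-- In -R = y²(-h)/G, the numerator -h is at most a multiple of ρ and G is at least a multiple of
ρ^(γ-1). -/
theorem eventually_neg_slope_le (hγ : γ ∈ Ioo (1 : ℝ) (4 / 3)) (F : IsMonotoneFlow γ Y w ρ ω) :
    ∃ C > 0, ∀ᶠ y in 𝓝[>] 0, -logSlope γ ρ ω y ≤ C * (y ^ 2 * ρ y ^ (2 - γ)) := by
  have hα : 0 < 4 - 3 * γ := by linarith [hγ.2]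
  have h0 : 0 < γ := by linarith [hγ.1]
  have hw := F.w_pos hγ
  have hpi := Real.pi_pos
  refine ⟨4 * Real.pi / (4 - 3 * γ) * w / (γ / 2), by positivity, ?_⟩
  filter_upwards [F.eventually_mem, F.eventually_le_G hγ] with y hy hG
  have hρ := F.rho_pos y hy
  have hp : 0 < ρ y ^ (γ - 1) := Real.rpow_pos_of_pos hρ _
  have h1 := F.neg_h_le hγ hy
  have h2 := F.h_neg hγ hy
  have e : ρ y ^ (2 - γ) = ρ y / ρ y ^ (γ - 1) := by
    rw [show (2 : ℝ) - γ = 1 - (γ - 1) by ring, Real.rpow_sub hρ, Real.rpow_one]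
  calc -logSlope γ ρ ω y = y ^ 2 * -h γ (ρ y) (ω y) / G γ y (ρ y) (ω y) := by
        unfold logSlope; ring
    _ ≤ y ^ 2 * (4 * Real.pi / (4 - 3 * γ) * w * ρ y) / (γ / 2 * ρ y ^ (γ - 1)) := by
        gcongr
    _ = _ := by rw [e]; field_simp

/-- In logarithmic time, log(ρω) has derivative (4-3γ)/ω - 3 ≥ -κ. So ρωy^κ increases near the
origin, while ω is bounded below by ω_F. -/
theorem eventually_rho_le (hγ : γ ∈ Ioo (1 : ℝ) (4 / 3)) (F : IsMonotoneFlow γ Y w ρ ω) {κ : ℝ}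
    (hκ : ∀ᶠ y in 𝓝[>] 0, 3 - (4 - 3 * γ) / ω y ≤ κ) :
    ∃ C > 0, ∀ᶠ y in 𝓝[>] 0, ρ y ≤ C * y ^ (-κ) := by
  obtain ⟨y₀, hy₀, hk⟩ := exists_Ioc_of_eventually F.pos hκ
  have hsub : ∀ y ∈ Ioc 0 y₀, y ∈ Ioo 0 Y := fun y hy => ⟨hy.1, hy.2.trans_lt hy₀.2⟩
  have hω : ∀ y ∈ Ioc 0 y₀, 0 < ω y := fun y hy =>
    (omegaF_pos hγ).trans (F.lt_omega y (hsub y hy))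
  have hm := monotoneOn_Ioc_of_hasDerivAt (fun y hy =>
    (((F.hasDerivAt_rho (hsub y hy)).log (F.rho_pos y (hsub y hy)).ne').fun_add
      ((F.hasDerivAt_omega (hsub y hy)).log (hω y hy).ne')).fun_add
      ((Real.hasDerivAt_log hy.1.ne').const_mul κ)) (fun y hy => by
      have h1 := (F.rho_pos y (hsub y hy)).ne'
      have h2 := (hω y hy).ne'
      have h3 := hy.1.ne'
      have : ρ y * logSlope γ ρ ω y / y / ρ y + relVel γ (ω y) (logSlope γ ρ ω y) / y / ω y
          + κ * y⁻¹ = (κ - (3 - (4 - 3 * γ) / ω y)) / y := by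
        unfold relVel; field_simp; ring
      rw [this]
      exact div_nonneg (sub_nonneg.mpr (hk y hy)) hy.1.le)
  set K := Real.log (ρ y₀) + Real.log (ω y₀) + κ * Real.log y₀ - Real.log (omegaF γ) with hK
  refine ⟨Real.exp K, Real.exp_pos _, ?_⟩
  filter_upwards [Ioc_mem_nhdsGT hy₀.1] with y hy
  have h1 := hm hy ⟨hy₀.1, le_rfl⟩ hy.2
  simp only at h1
  have h2 := Real.log_le_log (omegaF_pos hγ) (F.lt_omega y (hsub y hy)).le
  rw [Real.rpow_def_of_pos hy.1, ← Real.exp_add,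
    ← Real.log_le_iff_le_exp (F.rho_pos y (hsub y hy))]
  linarith

theorem eventually_neg_slope_le_rpow (hγ : γ ∈ Ioo (1 : ℝ) (4 / 3))
    (F : IsMonotoneFlow γ Y w ρ ω) {κ : ℝ} (hκ : ∀ᶠ y in 𝓝[>] 0, 3 - (4 - 3 * γ) / ω y ≤ κ) :
    ∃ C > 0, ∀ᶠ y in 𝓝[>] 0, -logSlope γ ρ ω y ≤ C * y ^ (2 - κ * (2 - γ)) := by
  obtain ⟨C, hC, h1⟩ := F.eventually_neg_slope_le hγ
  obtain ⟨C', hC', h2⟩ := F.eventually_rho_le hγ hκ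
  refine ⟨C * C' ^ (2 - γ), by positivity, ?_⟩
  filter_upwards [h1, h2, F.eventually_mem] with y h1 h2 hy
  have hy0 := hy.1
  refine h1.trans ?_
  have h3 : ρ y ^ (2 - γ) ≤ (C' * y ^ (-κ)) ^ (2 - γ) :=
    Real.rpow_le_rpow (F.rho_pos y hy).le h2 (by linarith [hγ.2])
  have h4 : (C' * y ^ (-κ)) ^ (2 - γ) = C' ^ (2 - γ) * y ^ (-κ * (2 - γ)) := by
    rw [Real.mul_rpow hC'.le (by positivity), ← Real.rpow_mul hy0.le]
  have h5 : y ^ (2 - κ * (2 - γ)) = y ^ 2 * y ^ (-κ * (2 - γ)) := by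
    rw [← Real.rpow_natCast y 2, ← Real.rpow_add hy0]
    congr 1
    push_cast
    ring
  rw [h5]
  calc C * (y ^ 2 * ρ y ^ (2 - γ)) ≤ C * (y ^ 2 * (C' ^ (2 - γ) * y ^ (-κ * (2 - γ)))) := by
        rw [← h4]; gcongr
    _ = _ := by ring

/-- With only ω < w known, κ = 3-(4-3γ)/w is admissible. The resulting exponent of y is
(4-3γ)(2-γ-w)/w, positive exactly because w < 2-γ. -/
theorem tendsto_slope (hγ : γ ∈ Ioo (1 : ℝ) (4 / 3)) (F : IsMonotoneFlow γ Y w ρ ω)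
    (hw : w < 2 - γ) : Tendsto (logSlope γ ρ ω) (𝓝[>] 0) (𝓝 0) := by
  have hα : 0 < 4 - 3 * γ := by linarith [hγ.2]
  have hw0 := F.w_pos hγ
  obtain ⟨C, hC, h1⟩ := F.eventually_neg_slope_le_rpow hγ (κ := 3 - (4 - 3 * γ) / w) (by
    filter_upwards [F.eventually_mem] with y hy
    have := (omegaF_pos hγ).trans (F.lt_omega y hy)
    have := (F.omega_lt y hy).le
    gcongr)
  have hp : 0 < 2 - (3 - (4 - 3 * γ) / w) * (2 - γ) := by
    have : 2 - (3 - (4 - 3 * γ) / w) * (2 - γ) = (4 - 3 * γ) * (2 - γ - w) / w := by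
      field_simp; ring
    rw [this]
    have : 0 < 2 - γ - w := by linarith
    positivity
  have h2 : Tendsto (fun y : ℝ => C * y ^ (2 - (3 - (4 - 3 * γ) / w) * (2 - γ))) (𝓝[>] 0) (𝓝 0) := by
    have := (Real.continuousAt_rpow_const 0 _ (Or.inr hp.le)).tendsto.const_mul C
    rw [Real.zero_rpow hp.ne', mul_zero] at this
    exact this.mono_left nhdsWithin_le_nhds
  have h3 : Tendsto (fun y => -logSlope γ ρ ω y) (𝓝[>] 0) (𝓝 0) := by
    refine squeeze_zero' ?_ h1 h2
    filter_upwards [F.eventually_mem] with y hy using (neg_pos.mpr (F.slope_neg hγ hy)).le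
  simpa using h3.neg

theorem tendsto_omega (hγ : γ ∈ Ioo (1 : ℝ) (4 / 3)) (F : IsMonotoneFlow γ Y w ρ ω)
    (hw : w < 2 - γ) : Tendsto ω (𝓝[>] 0) (𝓝 (omegaF γ)) := by
  have h1 : Tendsto (fun y => omegaF γ + w * -logSlope γ ρ ω y) (𝓝[>] 0) (𝓝 (omegaF γ)) := by
    have := ((F.tendsto_slope hγ hw).neg.const_mul w).const_add (omegaF γ)
    simpa using this
  refine tendsto_of_tendsto_of_tendsto_of_le_of_le' tendsto_const_nhds h1 ?_ ?_
  · filter_upwards [F.eventually_mem] with y hy using (F.lt_omega y hy).le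
  · filter_upwards [F.eventually_mem] with y hy
    have h2 := F.omega_sub_lt hy
    have h3 := F.slope_neg hγ hy
    have h4 := F.omega_lt y hy
    have h5 := F.lt_omega y hy
    nlinarith

/-- Bootstrap: once ω → ω_F, every κ > 0 is admissible, and κ = 1/(2-γ) gives -R ≤ Cy. Then dρ/dy =
ρR/y makes log ρ + Cy increasing, so ρ is bounded, and `eventually_neg_slope_le` improves to order
y². -/
theorem eventually_neg_slope_le_sq (hγ : γ ∈ Ioo (1 : ℝ) (4 / 3)) (F : IsMonotoneFlow γ Y w ρ ω)
    (hw : w < 2 - γ) :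
    ∃ C > 0, ∃ M > 0, ∀ᶠ y in 𝓝[>] 0, -logSlope γ ρ ω y ≤ C * y ^ 2 ∧ ρ y ≤ M := by
  have hb : 0 < 2 - γ := by linarith [hγ.2]
  have ha := omegaF_pos hγ
  obtain ⟨C, hC, h1⟩ := F.eventually_neg_slope_le_rpow hγ (κ := 1 / (2 - γ)) (by
    have h2 : Tendsto (fun y => 3 - (4 - 3 * γ) / ω y) (𝓝[>] 0) (𝓝 0) := by
      have := ((tendsto_const_nhds (x := 4 - 3 * γ)).div (F.tendsto_omega hγ hw) ha.ne').const_sub 3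
      have e : 3 - (4 - 3 * γ) / omegaF γ = 0 := by
        unfold omegaF at ha ⊢
        have : 4 - 3 * γ ≠ 0 := by linarith
        field_simp
        ring
      rw [e] at this
      exact this
    filter_upwards [h2.eventually (gt_mem_nhds (by positivity : 0 < 1 / (2 - γ)))] with y hy
      using hy.le)
  have e : 2 - 1 / (2 - γ) * (2 - γ) = 1 := by field_simp; ring
  simp only [e, Real.rpow_one] at h1
  obtain ⟨y₀, hy₀, h2⟩ := exists_Ioc_of_eventually F.pos h1
  have hsub : ∀ y ∈ Ioc 0 y₀, y ∈ Ioo 0 Y := fun y hy => ⟨hy.1, hy.2.trans_lt hy₀.2⟩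
  have hm := monotoneOn_Ioc_of_hasDerivAt (fun y hy =>
    ((F.hasDerivAt_rho (hsub y hy)).log (F.rho_pos y (hsub y hy)).ne').fun_add
      ((hasDerivAt_id y).const_mul C)) (fun y hy => by
      have h3 := (F.rho_pos y (hsub y hy)).ne'
      have h4 := hy.1.ne'
      have : ρ y * logSlope γ ρ ω y / y / ρ y + C * 1 = (C * y - -logSlope γ ρ ω y) / y := by
        field_simp; ring
      rw [this]
      exact div_nonneg (sub_nonneg.mpr (h2 y hy)) hy.1.le)
  obtain ⟨C', hC', h3⟩ := F.eventually_neg_slope_le hγ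
  set M := Real.exp (Real.log (ρ y₀) + C * y₀) with hM
  have hM0 : 0 < M := Real.exp_pos _
  refine ⟨C' * M ^ (2 - γ), by positivity, M, hM0, ?_⟩
  filter_upwards [h3, Ioc_mem_nhdsGT hy₀.1] with y h3 hy
  have h4 := hm hy ⟨hy₀.1, le_rfl⟩ hy.2
  simp only [id] at h4
  have hρ := F.rho_pos y (hsub y hy)
  have h5 : ρ y ≤ M := by
    rw [hM, ← Real.log_le_iff_le_exp hρ]
    have := mul_pos hC hy.1
    linarith
  refine ⟨?_, h5⟩
  have h6 : ρ y ^ (2 - γ) ≤ M ^ (2 - γ) := Real.rpow_le_rpow hρ.le h5 hb.le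
  calc -logSlope γ ρ ω y ≤ C' * (y ^ 2 * ρ y ^ (2 - γ)) := h3
    _ ≤ C' * (y ^ 2 * M ^ (2 - γ)) := by gcongr
    _ = _ := by ring

theorem exists_tendsto_rho (hγ : γ ∈ Ioo (1 : ℝ) (4 / 3)) (F : IsMonotoneFlow γ Y w ρ ω)
    (hw : w < 2 - γ) :
    ∃ ρ₀, Tendsto ρ (𝓝[>] 0) (𝓝 ρ₀) ∧ ∀ y ∈ Ioo 0 Y, ρ y ≤ ρ₀ := by
  obtain ⟨C, hC, M, hM, h1⟩ := F.eventually_neg_slope_le_sq hγ hw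
  obtain ⟨y₀, hy₀, h2⟩ := exists_Ioc_of_eventually F.pos h1
  have hanti := F.strictAntiOn_rho hγ
  have hbdd : BddBelow ((fun y => -ρ y) '' Ioo 0 Y) := by
    refine ⟨-M, ?_⟩
    rintro _ ⟨y, hy, rfl⟩
    simp only [neg_le_neg_iff]
    rcases le_or_gt y y₀ with h | h
    · exact (h2 y ⟨hy.1, h⟩).2
    · exact (hanti hy₀ hy h).le.trans (h2 y₀ ⟨hy₀.1, le_rfl⟩).2
  have hm : MonotoneOn (fun y => -ρ y) (Ioo 0 Y) := fun x hx y hy hxy =>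
    neg_le_neg (hanti.antitoneOn hx hy hxy)
  have ht := (hm.tendsto_nhdsWithin_Ioo_right (nonempty_Ioo.mpr F.pos) hbdd).neg
  simp only [neg_neg] at ht
  refine ⟨_, ht, fun y hy => ?_⟩
  have := csInf_le hbdd ⟨y, hy, rfl⟩
  simp only at this
  linarith

end IsMonotoneFlow

theorem hasDerivWithinAt_update_of_le_sq {f : ℝ → ℝ} {L C : ℝ}
    (hf : ∀ᶠ y in 𝓝[>] 0, |f y - L| ≤ C * y ^ 2) :
    HasDerivWithinAt (Function.update f 0 L) 0 (Ici 0) 0 := by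
  rw [hasDerivWithinAt_iff_tendsto_slope, Ici_sdiff_left]
  have h1 : Tendsto (fun y : ℝ => C * y) (𝓝[>] 0) (𝓝 0) := by
    have : Continuous fun y : ℝ => C * y := by fun_prop
    simpa using (this.tendsto 0).mono_left nhdsWithin_le_nhds
  refine squeeze_zero_norm' ?_ h1
  filter_upwards [hf, self_mem_nhdsWithin] with y hy hy0
  have hy0 : 0 < y := hy0
  rw [slope_def_field, Function.update_self, Function.update_of_ne hy0.ne', sub_zero,
    Real.norm_eq_abs, abs_div, abs_of_pos hy0, div_le_iff₀ hy0]
  linarith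

theorem contDiffOn_add_one_of_hasDerivWithinAt {f f' : ℝ → ℝ} {s : Set ℝ} {n : ℕ}
    (hs : UniqueDiffOn ℝ s) (hf : ∀ x ∈ s, HasDerivWithinAt f (f' x) s x)
    (hf' : ContDiffOn ℝ n f' s) : ContDiffOn ℝ (n + 1) f s := by
  rw [contDiffOn_succ_iff_derivWithin hs]
  refine ⟨fun x hx => (hf x hx).differentiableWithinAt, by simp, hf'.congr fun x hx => ?_⟩
  exact (hf x hx).derivWithin (hs x hx)

/-! ### The limit of the density and regularity at the origin. -/

namespace IsMonotoneFlow

variable {γ Y w ρ₀ : ℝ} {ρ ω : ℝ → ℝ}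

theorem exists_le_G (hγ : γ ∈ Ioo (1 : ℝ) (4 / 3)) (F : IsMonotoneFlow γ Y w ρ ω) :
    ∃ c > 0, ∀ᶠ y in 𝓝[>] 0, c ≤ G γ y (ρ y) (ω y) := by
  have h1 := hγ.1
  have hy₁ : Y / 2 ∈ Ioo 0 Y := ⟨by linarith [F.pos], by linarith [F.pos]⟩
  have hρ₁ := F.rho_pos _ hy₁
  refine ⟨γ / 2 * ρ (Y / 2) ^ (γ - 1), by positivity, ?_⟩
  filter_upwards [Ioo_mem_nhdsGT hy₁.1, F.eventually_le_G hγ] with y hy hG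
  have h3 : ρ (Y / 2) ^ (γ - 1) ≤ ρ y ^ (γ - 1) :=
    Real.rpow_le_rpow hρ₁.le (F.strictAntiOn_rho hγ ⟨hy.1, hy.2.trans hy₁.2⟩ hy₁ hy.2).le
      (by linarith)
  refine le_trans ?_ hG
  gcongr

/-- Letting y → 0 in h < 0 gives ρ₀ ≥ 1/(6π). In case of equality h vanishes at (ρ₀, ω_F), and ρ ≤
ρ₀ gives -h ≤ const·(ω-ω_F). Hence ω·(-R) ≤ const·y²(ω-ω_F), which for small y contradicts ω·(-R) >
3(ω-ω_F). -/
theorem lt_limit (hγ : γ ∈ Ioo (1 : ℝ) (4 / 3)) (F : IsMonotoneFlow γ Y w ρ ω) (hw : w < 2 - γ)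
    (h0 : Tendsto ρ (𝓝[>] 0) (𝓝 ρ₀)) (hle : ∀ y ∈ Ioo 0 Y, ρ y ≤ ρ₀) :
    1 / (6 * Real.pi) < ρ₀ := by
  have ha := omegaF_pos hγ
  have hα : 0 < 4 - 3 * γ := by linarith [hγ.2]
  have h1 := hγ.1
  have hpi := Real.pi_pos
  have hw0 := F.w_pos hγ
  have hF : h γ (1 / (6 * Real.pi)) (omegaF γ) = 0 := by
    rw [← rhoS_omegaF hγ]; exact h_rhoS hγ ha.ne'
  have hge : 1 / (6 * Real.pi) ≤ ρ₀ := by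
    have hc : Continuous fun x : ℝ × ℝ => h γ x.1 x.2 := by unfold h; fun_prop
    have h1' := h0.prodMk_nhds (F.tendsto_omega hγ hw)
    have h2 := (hc.tendsto (ρ₀, omegaF γ)).comp h1'
    simp only [Function.comp_def] at h2
    have h3 : h γ ρ₀ (omegaF γ) ≤ 0 := by
      refine le_of_tendsto h2 ?_
      filter_upwards [F.eventually_mem] with y hy using (F.h_neg hγ hy).le
    rw [h_eq] at h3 hF
    have h4 : 0 < 4 * Real.pi / (4 - 3 * γ) * omegaF γ := by positivity
    by_contra! h5
    have h6 := mul_lt_mul_of_pos_left h5 h4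
    linarith
  refine hge.lt_of_ne fun e => ?_
  obtain ⟨c, hc, hG⟩ := F.exists_le_G hγ
  set k := 4 * Real.pi / (4 - 3 * γ) with hk
  have hk0 : 0 < k := by positivity
  have hρ₀ : 0 < ρ₀ := by rw [← e]; positivity
  have h2 : Tendsto (fun y : ℝ => w * (y ^ 2 * (k * ρ₀) / c)) (𝓝[>] 0) (𝓝 0) := by
    have : Continuous fun y : ℝ => w * (y ^ 2 * (k * ρ₀) / c) := by fun_prop
    simpa using (this.tendsto 0).mono_left nhdsWithin_le_nhds
  obtain ⟨y, hy, hGy, hsm⟩ := (F.eventually_mem.and (hG.and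
    (h2.eventually (gt_mem_nhds (show (0 : ℝ) < 3 by norm_num))))).exists
  have hωa := F.lt_omega y hy
  have hω := ha.trans hωa
  have hR := F.omega_sub_lt hy
  have hR0 := F.slope_neg hγ hy
  have hh : -h γ (ρ y) (ω y) ≤ k * ρ₀ * (ω y - omegaF γ) := by
    rw [e, h_eq] at hF
    rw [h_eq]
    have h3 : k * ρ y * ω y ≤ k * ρ₀ * ω y := by have := hle y hy; gcongr
    nlinarith [mul_pos (sub_pos.mpr h1) (sub_pos.mpr hωa)]
  have h4 : -logSlope γ ρ ω y ≤ y ^ 2 * (k * ρ₀ * (ω y - omegaF γ)) / c := by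
    have h5 := F.h_neg hγ hy
    have : -logSlope γ ρ ω y = y ^ 2 * -h γ (ρ y) (ω y) / G γ y (ρ y) (ω y) := by
      unfold logSlope; ring
    rw [this]
    have h6 : 0 ≤ k * ρ₀ * (ω y - omegaF γ) := by linarith
    gcongr
  have h5 : ω y * -logSlope γ ρ ω y ≤ w * (y ^ 2 * (k * ρ₀ * (ω y - omegaF γ)) / c) := by
    have := (F.omega_lt y hy).le
    have h7 : 0 ≤ -logSlope γ ρ ω y := by linarith
    gcongr
  have h6 : w * (y ^ 2 * (k * ρ₀ * (ω y - omegaF γ)) / c)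
      = w * (y ^ 2 * (k * ρ₀) / c) * (ω y - omegaF γ) := by ring
  have h7 := mul_lt_mul_of_pos_right hsm (sub_pos.mpr hωa)
  linarith

/-- Quadratic bounds at the origin. -/
theorem eventually_bounds (hγ : γ ∈ Ioo (1 : ℝ) (4 / 3)) (F : IsMonotoneFlow γ Y w ρ ω)
    (hw : w < 2 - γ) (h0 : Tendsto ρ (𝓝[>] 0) (𝓝 ρ₀)) (hle : ∀ y ∈ Ioo 0 Y, ρ y ≤ ρ₀) :
    ∃ C, ∀ᶠ y in 𝓝[>] 0, |ρ y - ρ₀| ≤ C * y ^ 2 ∧ |ω y - omegaF γ| ≤ C * y ^ 2 ∧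
      |deriv ρ y| ≤ C * y ∧ |deriv ω y| ≤ C * y := by
  obtain ⟨C, hC, M, hM, h1⟩ := F.eventually_neg_slope_le_sq hγ hw
  have hw0 := F.w_pos hγ
  obtain ⟨y₀, hy₀, h2⟩ := exists_Ioc_of_eventually F.pos h1
  have hsub : ∀ y ∈ Ioc 0 y₀, y ∈ Ioo 0 Y := fun y hy => ⟨hy.1, hy.2.trans_lt hy₀.2⟩
  have hρR : ∀ y ∈ Ioc 0 y₀, ρ y * -logSlope γ ρ ω y ≤ M * (C * y ^ 2) := fun y hy => by
    have h3 := h2 y hy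
    have h4 := F.slope_neg hγ (hsub y hy)
    exact mul_le_mul h3.2 h3.1 (by linarith) hM.le
  have hωR : ∀ y ∈ Ioc 0 y₀, ω y * -logSlope γ ρ ω y ≤ w * (C * y ^ 2) := fun y hy => by
    have h3 := h2 y hy
    have h4 := F.slope_neg hγ (hsub y hy)
    exact mul_le_mul (F.omega_lt y (hsub y hy)).le h3.1 (by linarith) hw0.le
  have hm := monotoneOn_Ioc_of_hasDerivAt (fun y hy =>
    (F.hasDerivAt_rho (hsub y hy)).fun_add ((hasDerivAt_pow 2 y).const_mul (M * C)))
    (fun y hy => by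
      have h3 := hρR y hy
      have h4 := hy.1
      have : ρ y * logSlope γ ρ ω y / y + M * C * (((2 : ℕ) : ℝ) * y ^ (2 - 1))
          = (2 * (M * (C * y ^ 2)) - ρ y * -logSlope γ ρ ω y) / y := by
        field_simp; push_cast; ring
      rw [this]
      have : 0 < M * (C * y ^ 2) := by positivity
      exact div_nonneg (by linarith) hy.1.le)
  refine ⟨M * C + w * C, ?_⟩
  have hMC : 0 < M * C := by positivity
  have hwC : 0 < w * C := by positivity
  filter_upwards [Ioc_mem_nhdsGT hy₀.1] with y hy
  have hyY := hsub y hy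
  have hy0 := hy.1
  have hp1 : 0 < M * C * y ^ 2 := by positivity
  have hp2 : 0 < w * C * y ^ 2 := by positivity
  have hR := F.slope_neg hγ hyY
  have hω := (omegaF_pos hγ).trans (F.lt_omega y hyY)
  have hωR' : 0 < ω y * -logSlope γ ρ ω y := mul_pos hω (by linarith)
  have hρR' : 0 < ρ y * -logSlope γ ρ ω y := mul_pos (F.rho_pos y hyY) (by linarith)
  refine ⟨?_, ?_, ?_, ?_⟩
  · have h3 : ρ₀ ≤ ρ y + M * C * y ^ 2 := by
      have h4 : Tendsto (fun s => ρ s + M * C * s ^ 2) (𝓝[>] 0) (𝓝 ρ₀) := by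
        have : Continuous fun s : ℝ => M * C * s ^ 2 := by fun_prop
        have := h0.add ((this.tendsto 0).mono_left (nhdsWithin_le_nhds (s := Ioi 0)))
        simpa using this
      refine le_of_tendsto h4 ?_
      filter_upwards [Ioc_mem_nhdsGT hy.1] with s hs
      exact hm ⟨hs.1, hs.2.trans hy.2⟩ hy hs.2
    rw [abs_of_nonpos (by linarith [hle y hyY])]
    linarith
  · have h3 := F.omega_sub_lt hyY
    rw [abs_of_pos (by linarith [F.lt_omega y hyY])]
    linarith [hωR y hy, F.lt_omega y hyY]
  · rw [(F.hasDerivAt_rho hyY).deriv, abs_div, abs_of_pos hy.1, div_le_iff₀ hy.1,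
      abs_of_neg (by linarith)]
    linarith [hρR y hy]
  · rw [(F.hasDerivAt_omega hyY).deriv, abs_div, abs_of_pos hy.1, div_le_iff₀ hy.1,
      abs_of_pos (F.vel_pos y hyY)]
    have h3 := F.lt_omega y hyY
    have h4 := hωR y hy
    unfold omegaF at h3
    unfold relVel
    linarith

/-- On [0, Y) one has ρ' = y·F with F = ρh/G, which is as smooth as the pair (ρ, ω) because G > 0.
Both functions are C¹ up to 0, so F and hence ρ' are C¹. At the sonic point Y, where G vanishes,
analyticity takes over. -/
theorem contDiffOn (hγ : γ ∈ Ioo (1 : ℝ) (4 / 3)) (F : IsMonotoneFlow γ Y w ρ ω)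
    (hw : w < 2 - γ) (h0 : Tendsto ρ (𝓝[>] 0) (𝓝 ρ₀)) (hle : ∀ y ∈ Ioo 0 Y, ρ y ≤ ρ₀)
    (hA : AnalyticAt ℝ ρ Y) : ContDiffOn ℝ 2 (Function.update ρ 0 ρ₀) (Icc 0 Y) := by
  obtain ⟨C, hC⟩ := F.eventually_bounds hγ hw h0 hle
  have hY := F.pos
  have hγ0 : 0 < γ := by linarith [hγ.1]
  set P := Function.update ρ 0 ρ₀ with hP
  set Q := Function.update ω 0 (omegaF γ) with hQ
  set s := Ico 0 Y with hs
  have hu : UniqueDiffOn ℝ s := uniqueDiffOn_Ico 0 Y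
  have hρ₀ : 0 < ρ₀ := (by have := Real.pi_pos; positivity : (0 : ℝ) < 1 / (6 * Real.pi)).trans
    (F.lt_limit hγ hw h0 hle)
  have hPy : ∀ y ∈ Ioo 0 Y, P y = ρ y := fun y hy => Function.update_of_ne hy.1.ne' _ _
  have hQy : ∀ y ∈ Ioo 0 Y, Q y = ω y := fun y hy => Function.update_of_ne hy.1.ne' _ _
  have hP0 : P 0 = ρ₀ := Function.update_self _ _ _
  have hQ0 : Q 0 = omegaF γ := Function.update_self _ _ _
  have hcase : ∀ y ∈ s, y = 0 ∨ y ∈ Ioo 0 Y := fun y hy => by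
    rcases hy.1.eq_or_lt with h | h
    · exact Or.inl h.symm
    · exact Or.inr ⟨h, hy.2⟩
  have hPpos : ∀ y ∈ s, 0 < P y := fun y hy => by
    rcases hcase y hy with rfl | h
    · rw [hP0]; exact hρ₀
    · rw [hPy y h]; exact F.rho_pos y h
  have hGpos : ∀ y ∈ s, 0 < G γ y (P y) (Q y) := fun y hy => by
    rcases hcase y hy with rfl | h
    · rw [hP0]; unfold G
      have := Real.rpow_pos_of_pos hρ₀ (γ - 1)
      have : 0 < γ * ρ₀ ^ (γ - 1) := by positivity
      simpa using this
    · rw [hPy y h, hQy y h]; exact F.subsonic y h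
  have hev : ∀ y ∈ Ioo 0 Y, P =ᶠ[𝓝 y] ρ ∧ Q =ᶠ[𝓝 y] ω := fun y hy =>
    ⟨by filter_upwards [isOpen_Ioo.mem_nhds hy] with z hz using hPy z hz,
      by filter_upwards [isOpen_Ioo.mem_nhds hy] with z hz using hQy z hz⟩
  have hdP : ∀ y ∈ s, HasDerivWithinAt P
      (y * (P y * h γ (P y) (Q y) / G γ y (P y) (Q y))) s y := fun y hy => by
    rcases hcase y hy with rfl | h
    · rw [zero_mul]
      exact (hasDerivWithinAt_update_of_le_sq (hC.mono fun y hy => hy.1)).mono Ico_subset_Ici_self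
    · have := ((F.solves y h).1.congr_of_eventuallyEq (hev y h).1).hasDerivWithinAt (s := s)
      rw [hPy y h, hQy y h]
      refine this.congr_deriv ?_
      ring
  have hdQ : ∀ y ∈ s, HasDerivWithinAt Q (Function.update (deriv ω) 0 0 y) s y := fun y hy => by
    rcases hcase y hy with rfl | h
    · rw [Function.update_self]
      exact (hasDerivWithinAt_update_of_le_sq (hC.mono fun y hy => hy.2.1)).mono Ico_subset_Ici_self
    · rw [Function.update_of_ne h.1.ne']
      exact ((F.solves y h).2.differentiableAt.hasDerivAt.congr_of_eventuallyEq
        (hev y h).2).hasDerivWithinAt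
  have hcP : ContinuousOn P s := fun y hy => (hdP y hy).continuousWithinAt
  have hcQ : ContinuousOn Q s := fun y hy => (hdQ y hy).continuousWithinAt
  -- smoothness of the right-hand side
  have hrhs : ∀ n : ℕ, ContDiffOn ℝ n P s → ContDiffOn ℝ n Q s →
      ContDiffOn ℝ n (fun y => P y * h γ (P y) (Q y) / G γ y (P y) (Q y)) s := by
    intro n h1 h2
    have hh : ContDiffOn ℝ n (fun y => h γ (P y) (Q y)) s := by
      have : ContDiff ℝ n fun x : ℝ × ℝ => h γ x.1 x.2 := by unfold h; fun_prop
      exact this.comp_contDiffOn (h1.prodMk h2)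
    have hG : ContDiffOn ℝ n (fun y => G γ y (P y) (Q y)) s := by
      unfold G
      exact (contDiffOn_const.mul (h1.rpow_const_of_ne fun y hy => (hPpos y hy).ne')).sub
        ((contDiffOn_id.pow 2).mul (h2.pow 2))
    exact (h1.mul hh).div hG fun y hy => (hGpos y hy).ne'
  have hcF := (hrhs 0 (contDiffOn_zero.mpr hcP) (contDiffOn_zero.mpr hcQ)).continuousOn
  -- The equation for ω contains a division by y, so it gives no smoothness at 0. Continuity of ω'
  -- there comes from the bound |ω'| ≤ Cy.
  have hQ1 : ContDiffOn ℝ (0 + 1) Q s := by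
    refine contDiffOn_add_one_of_hasDerivWithinAt (n := 0) hu hdQ (contDiffOn_zero.mpr ?_)
    intro y hy
    rcases hcase y hy with rfl | hyI
    · rw [continuousWithinAt_update_same]
      have : s \ {0} ⊆ Ioi 0 := fun y hy => lt_of_le_of_ne hy.1.1 (Ne.symm hy.2)
      refine Tendsto.mono_left ?_ (nhdsWithin_mono 0 this)
      have h1 : Tendsto (fun y : ℝ => C * y) (𝓝[>] 0) (𝓝 0) := by
        have : Continuous fun y : ℝ => C * y := by fun_prop
        simpa using (this.tendsto 0).mono_left nhdsWithin_le_nhds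
      exact squeeze_zero_norm' (hC.mono fun y hy => hy.2.2.2) h1
    · have hF : ContinuousOn (fun z => (4 - 3 * γ - 3 * Q z) / z
          - z * Q z * (h γ (P z) (Q z) / G γ z (P z) (Q z))) (Ioo 0 Y) := by
        have hsub : Ioo 0 Y ⊆ s := Ioo_subset_Ico_self
        have h1 : ContinuousOn (fun y => h γ (P y) (Q y) / G γ y (P y) (Q y)) (Ioo 0 Y) := by
          refine ((hcF.mono hsub).div (hcP.mono hsub) fun z hz => (hPpos z (hsub hz)).ne').congr
            fun z hz => ?_
          have := (hPpos z (hsub hz)).ne'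
          simp only [Pi.div_apply]
          field_simp
        exact ((continuousOn_const.sub (continuousOn_const.mul (hcQ.mono hsub))).div continuousOn_id
          fun z hz => hz.1.ne').sub ((continuousOn_id.mul (hcQ.mono hsub)).mul h1)
      have hcd : ContinuousAt (deriv ω) y := by
        refine (hF.continuousAt (isOpen_Ioo.mem_nhds hyI)).congr ?_
        filter_upwards [isOpen_Ioo.mem_nhds hyI] with z hz
        rw [(F.solves z hz).2.deriv, hPy z hz, hQy z hz]
        ring
      refine (hcd.congr ?_).continuousWithinAt
      filter_upwards [isOpen_Ioo.mem_nhds hyI] with z hz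
      rw [Function.update_of_ne hz.1.ne']
  have hP1 : ContDiffOn ℝ (0 + 1) P s :=
    contDiffOn_add_one_of_hasDerivWithinAt (n := 0) hu hdP
      (contDiffOn_zero.mpr (continuousOn_id.mul hcF))
  have hP2 : ContDiffOn ℝ 2 P s := by
    have := contDiffOn_add_one_of_hasDerivWithinAt (n := 1) hu hdP
      (contDiffOn_id.mul (hrhs 1 (by simpa using hP1) (by simpa using hQ1)))
    convert this using 1
    norm_num
  intro y hy
  rcases hy.2.eq_or_lt with h | h
  · rw [h]
    have : ContDiffAt ℝ 2 P Y := by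
      refine hA.contDiffAt.congr_of_eventuallyEq ?_
      filter_upwards [lt_mem_nhds hY] with z hz
      exact Function.update_of_ne hz.ne' _ _
    exact this.contDiffWithinAt
  · refine (hP2 y ⟨hy.1, h⟩).mono_of_mem_nhdsWithin ?_
    filter_upwards [self_mem_nhdsWithin, nhdsWithin_le_nhds (gt_mem_nhds h)] with z hz hz'
    exact ⟨hz.1, hz'⟩

theorem regular_origin (hγ : γ ∈ Ioo (1 : ℝ) (4 / 3)) (F : IsMonotoneFlow γ Y w ρ ω)
    (hw : w < 2 - γ) (hA : AnalyticAt ℝ ρ Y) :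
    (∀ y ∈ Ioo 0 Y, 0 < deriv ω y) ∧ Tendsto ω (𝓝[>] 0) (𝓝 ((4 - 3 * γ) / 3)) ∧
      (∀ y ∈ Ioo 0 Y, deriv ρ y < 0) ∧ Tendsto (deriv ρ) (𝓝[>] 0) (𝓝 0) ∧
      Tendsto (deriv ω) (𝓝[>] 0) (𝓝 0) ∧
      HasDerivWithinAt (Function.update ω 0 ((4 - 3 * γ) / 3)) 0 (Ici 0) 0 ∧
      ∃ ρ₀ : ℝ, 1 / (6 * Real.pi) < ρ₀ ∧ Tendsto ρ (𝓝[>] 0) (𝓝 ρ₀) ∧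
        HasDerivWithinAt (Function.update ρ 0 ρ₀) 0 (Ici 0) 0 ∧
        ContDiffOn ℝ 2 (Function.update ρ 0 ρ₀) (Icc 0 Y) := by
  obtain ⟨ρ₀, h0, hle⟩ := F.exists_tendsto_rho hγ hw
  obtain ⟨C, hC⟩ := F.eventually_bounds hγ hw h0 hle
  have h1 : Tendsto (fun y : ℝ => C * y) (𝓝[>] 0) (𝓝 0) := by
    have : Continuous fun y : ℝ => C * y := by fun_prop
    simpa using (this.tendsto 0).mono_left nhdsWithin_le_nhds
  refine ⟨fun y hy => ?_, F.tendsto_omega hγ hw, fun y hy => ?_,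
    squeeze_zero_norm' (hC.mono fun y hy => hy.2.2.1) h1,
    squeeze_zero_norm' (hC.mono fun y hy => hy.2.2.2) h1,
    hasDerivWithinAt_update_of_le_sq (hC.mono fun y hy => hy.2.1), ρ₀, F.lt_limit hγ hw h0 hle, h0,
    hasDerivWithinAt_update_of_le_sq (hC.mono fun y hy => hy.1), F.contDiffOn hγ hw h0 hle hA⟩
  · rw [(F.hasDerivAt_omega hy).deriv]
    exact div_pos (F.vel_pos y hy) hy.1
  · rw [(F.hasDerivAt_rho hy).deriv]
    exact div_neg_of_neg_of_pos (mul_neg_of_pos_of_neg (F.rho_pos y hy) (F.slope_neg hγ hy)) hy.1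

end IsMonotoneFlow

/-! ### Passing between the variable `y` and logarithmic time -/

/-- A pair of functions of `y`, as a curve in logarithmic time `t = log (y / ys)`. -/
def pullback (γ ys : ℝ) (ρ ω : ℝ → ℝ) (t : ℝ) : ℝ × ℝ × ℝ :=
  (ρ (ys * Real.exp t), ω (ys * Real.exp t),
    γ * ρ (ys * Real.exp t) ^ (γ - 1) / (ys * Real.exp t) ^ 2)

theorem hasDerivAt_mul_exp (ys t : ℝ) :
    HasDerivAt (fun t => ys * Real.exp t) (ys * Real.exp t) t :=
  (Real.hasDerivAt_exp t).const_mul ys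

theorem hasDerivAt_pullback {γ ys t R : ℝ} {ρ ω : ℝ → ℝ} (hys : 0 < ys)
    (hpos : 0 < ρ (ys * Real.exp t))
    (h1 : HasDerivAt ρ (ρ (ys * Real.exp t) * R / (ys * Real.exp t)) (ys * Real.exp t))
    (h2 : HasDerivAt ω (relVel γ (ω (ys * Real.exp t)) R / (ys * Real.exp t)) (ys * Real.exp t)) :
    HasDerivAt (pullback γ ys ρ ω) (slopeField γ (pullback γ ys ρ ω t) R) t := by
  have hy : 0 < ys * Real.exp t := by positivity
  have h0 := hasDerivAt_mul_exp ys t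
  have e1 := h1.comp t h0
  have e2 := h2.comp t h0
  have e3 := ((e1.rpow_const (p := γ - 1) (Or.inl hpos.ne')).const_mul γ).fun_div (h0.fun_pow 2)
    (pow_pos hy 2).ne'
  refine (e1.prodMk (e2.prodMk e3)).congr_deriv ?_
  simp only [slopeField, pullback, Function.comp, Prod.mk.injEq]
  have hy' := hy.ne'
  refine ⟨by field_simp, by field_simp, ?_⟩
  rw [Real.rpow_sub_one hpos.ne']
  have := hpos.ne'
  generalize ρ (ys * Real.exp t) = ρ₁ at *
  generalize ys * Real.exp t = y at *
  field_simp
  push_cast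
  ring

theorem sq_mul_gap_pullback {γ ys t : ℝ} {ρ ω : ℝ → ℝ} (hys : 0 < ys) :
    (ys * Real.exp t) ^ 2 * ((pullback γ ys ρ ω t).2.2 - (pullback γ ys ρ ω t).2.1 ^ 2)
      = G γ (ys * Real.exp t) (ρ (ys * Real.exp t)) (ω (ys * Real.exp t)) := by
  have hy : ys * Real.exp t ≠ 0 := by positivity
  simp only [pullback, G]
  field_simp

namespace IsSubsonicExtension

variable {γ ys a : ℝ} {ρ ω : ℝ → ℝ}

/-- Where ρ vanishes, G = -y²ω² ≤ 0, contrary to subsonicity. So ρ cannot change sign on the way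
from the sonic point. -/
theorem rho_pos (hγ : γ ∈ Ioo (1 : ℝ) (4 / 3)) (E : IsSubsonicExtension γ ys a ρ ω) {y : ℝ}
    (hy : y ∈ Ioc a ys) : 0 < ρ y := by
  by_contra! hneg
  have hcont : ContinuousOn ρ (Icc y ys) := fun z hz => by
    rcases hz.2.eq_or_lt with h | h
    · rw [h]; exact E.lph.analytic_rho.continuousAt.continuousWithinAt
    · exact (E.solves z ⟨hy.1.trans_le hz.1, h⟩).1.continuousAt.continuousWithinAt
  obtain ⟨z, hz, hz0⟩ := intermediate_value_Icc hy.2 hcont ⟨hneg, E.lph.rho_pos.le⟩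
  have hzlt : z < ys := hz.2.lt_of_ne fun h => by
    have := E.lph.rho_pos
    rw [← h, hz0] at this
    exact this.false
  have := E.subsonic z ⟨hy.1.trans_le hz.1, hzlt⟩
  unfold G at this
  rw [hz0, Real.zero_rpow (by linarith [hγ.1])] at this
  nlinarith [mul_nonneg (sq_nonneg z) (sq_nonneg (ω z))]

theorem solvesOn (hγ : γ ∈ Ioo (1 : ℝ) (4 / 3)) (E : IsSubsonicExtension γ ys a ρ ω)
    (hys : 0 < ys) {T : ℝ} (hT : a ≤ ys * Real.exp T) :
    SolvesOn (field γ) subsonicRegion T 0 (pullback γ ys ρ ω) := fun t ht => by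
  have hy : 0 < ys * Real.exp t := by positivity
  have hmem : ys * Real.exp t ∈ Ioo a ys := by
    refine ⟨hT.trans_lt ?_, ?_⟩
    · have := Real.exp_lt_exp.mpr ht.1
      gcongr
    · have := Real.exp_lt_one_iff.mpr ht.2
      nlinarith
  have hρ := E.rho_pos hγ (Ioo_subset_Ioc_self hmem)
  have hG := E.subsonic _ hmem
  have hg := sq_mul_gap_pullback (γ := γ) (ρ := ρ) (ω := ω) (t := t) hys
  have hsub : 0 < (pullback γ ys ρ ω t).2.2 - (pullback γ ys ρ ω t).2.1 ^ 2 := by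
    rw [← hg] at hG
    exact pos_of_mul_pos_right hG (by positivity)
  have hR : rate γ (pullback γ ys ρ ω t) = (ys * Real.exp t) ^ 2 *
      h γ (ρ (ys * Real.exp t)) (ω (ys * Real.exp t)) /
        G γ (ys * Real.exp t) (ρ (ys * Real.exp t)) (ω (ys * Real.exp t)) := by
    rw [← hg, mul_div_mul_left _ _ (by positivity)]
    rfl
  refine ⟨hasDerivAt_pullback hys hρ ?_ ?_, hρ, sub_pos.mp hsub⟩
  · refine (E.solves _ hmem).1.congr_deriv ?_
    rw [hR]
    have := hG.ne'
    have := hy.ne'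
    field_simp
  · refine (E.solves _ hmem).2.congr_deriv ?_
    rw [hR]
    have := hG.ne'
    have := hy.ne'
    unfold relVel
    field_simp

/-- Strict monotonicity of `yS` recovers w from the sonic point. The multiplied system gives yω' = W
only where G ≠ 0, in particular on the subsonic left side. The identity theorem for analytic
functions extends it to a full neighbourhood. -/
theorem germ {w : ℝ} (hγ : γ ∈ Ioo (1 : ℝ) (4 / 3)) (hw : 0 < w)
    (E : IsSubsonicExtension γ (yS γ w) a ρ ω) (ha : a < yS γ w) :
    SonicGerm γ w (pullback γ (yS γ w) ρ ω) (fun t => yS γ w * Real.exp t *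
      deriv ρ (yS γ w * Real.exp t) / ρ (yS γ w * Real.exp t)) := by
  set ys := yS γ w with hys
  have hy0 : 0 < ys := yS_pos hγ hw
  obtain ⟨hω, hρ, hy⟩ := eq_sonic hγ hy0 E.lph.rho_pos E.lph.sonic E.lph.constraint
  have hωw : ω ys = w := (yS_strictAnti hγ).injOn hω hw hy.symm
  rw [hωw] at hρ
  have hexp : AnalyticAt ℝ (fun t => ys * Real.exp t) 0 := by fun_prop
  have e0 : ys * Real.exp 0 = ys := by simp
  have hA1 : AnalyticAt ℝ (fun y => y * deriv ρ y / ρ y) ys :=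
    (analyticAt_id.mul E.lph.analytic_rho.deriv).div E.lph.analytic_rho E.lph.rho_pos.ne'
  have hA2 : AnalyticAt ℝ (fun y => y * deriv ω y - (4 - 3 * γ - 3 * ω y)
      + ω y * (y * deriv ρ y / ρ y)) ys :=
    ((analyticAt_id.mul E.lph.analytic_omega.deriv).sub (analyticAt_const.sub
      (analyticAt_const.mul E.lph.analytic_omega))).add (E.lph.analytic_omega.mul hA1)
  have hρev : ∀ᶠ y in 𝓝 ys, 0 < ρ y ∧ 0 < y :=
    (E.lph.analytic_rho.continuousAt.eventually (lt_mem_nhds E.lph.rho_pos)).and (lt_mem_nhds hy0)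
  have hz : ∀ᶠ y in 𝓝 ys, y * deriv ω y - (4 - 3 * γ - 3 * ω y)
      + ω y * (y * deriv ρ y / ρ y) = 0 := by
    rcases hA2.eventually_eq_zero_or_eventually_ne_zero with h | h
    · exact h
    · exfalso
      have h' := h.filter_mono (nhdsWithin_mono ys (s := Iio ys) fun z hz => ne_of_lt hz)
      have h1 := (E.lph.solves.and hρev).filter_mono (nhdsWithin_le_nhds (s := Iio ys))
      obtain ⟨y, ⟨hne, ⟨⟨s1, s2⟩, hρy, hypos⟩⟩, hya⟩ :=
        ((h'.and h1).and (Ioo_mem_nhdsLT ha)).exists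
      have hG := (E.subsonic y hya).ne'
      refine hne (mul_left_cancel₀ hG ?_)
      have e : G γ y (ρ y) (ω y) * (y * deriv ω y - (4 - 3 * γ - 3 * ω y)
          + ω y * (y * deriv ρ y / ρ y)) = y * (G γ y (ρ y) (ω y) * deriv ω y)
          - G γ y (ρ y) (ω y) * (4 - 3 * γ - 3 * ω y)
          + ω y * y * (G γ y (ρ y) (ω y) * deriv ρ y) / ρ y := by ring
      rw [e, s1, s2]
      field_simp
      ring
  have ht : Tendsto (fun t => ys * Real.exp t) (𝓝 0) (𝓝 ys) := by
    have := hexp.continuousAt.tendsto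
    rwa [e0] at this
  refine ⟨?_, ?_, ?_, ?_, ?_⟩
  · have hc : AnalyticAt ℝ (fun y => y * deriv ρ y / ρ y) (ys * Real.exp 0) := by rwa [e0]
    exact hc.comp (f := fun t => ys * Real.exp t) hexp
  · simp only [pullback, e0, hωw, Prod.mk.injEq, true_and]
    refine ⟨hρ, ?_⟩
    have h1 := E.lph.sonic
    unfold G at h1
    rw [hωw] at h1
    field_simp
    linarith
  · simp only [e0]
    rw [E.lph.deriv_rho, hωw]
    have := E.lph.rho_pos.ne'
    field_simp
  · have hd1 := E.lph.analytic_rho.eventually_analyticAt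
    have hd2 := E.lph.analytic_omega.eventually_analyticAt
    filter_upwards [ht.eventually (hd1.and (hd2.and (hz.and hρev)))] with t ⟨d1, d2, hz, hρ, hy⟩
    refine hasDerivAt_pullback hy0 hρ (d1.differentiableAt.hasDerivAt.congr_deriv ?_)
      (d2.differentiableAt.hasDerivAt.congr_deriv ?_)
    · field_simp
    · rw [eq_div_iff hy.ne']
      unfold relVel
      linarith
  · filter_upwards [ht.eventually (E.lph.solves.and hρev)] with t ⟨⟨s1, s2⟩, hρ, hy⟩
    have hg := sq_mul_gap_pullback (γ := γ) (ρ := ρ) (ω := ω) (t := t) hy0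
    change _ = h γ (ρ (ys * Real.exp t)) (ω (ys * Real.exp t))
    refine mul_left_cancel₀ (pow_pos hy 2).ne' ?_
    rw [← mul_assoc, hg]
    have e : G γ (ys * Real.exp t) (ρ (ys * Real.exp t)) (ω (ys * Real.exp t)) *
        (ys * Real.exp t * deriv ρ (ys * Real.exp t) / ρ (ys * Real.exp t))
        = ys * Real.exp t * (G γ (ys * Real.exp t) (ρ (ys * Real.exp t)) (ω (ys * Real.exp t))
          * deriv ρ (ys * Real.exp t)) / ρ (ys * Real.exp t) := by ring
    rw [e, s1]
    have := hρ.ne'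
    generalize ρ (ys * Real.exp t) = ρ₁ at *
    field_simp

end IsSubsonicExtension

/-- `q y² = γ ρ^(γ-1)` is preserved by the flow. -/
theorem sq_mul_eq_of_slopeField {γ a b t₀ ys : ℝ} {v : ℝ → ℝ × ℝ × ℝ} {R : ℝ → ℝ}
    (hv : ∀ t ∈ Ioo a b, HasDerivAt v (slopeField γ (v t) (R t)) t ∧ 0 < (v t).1)
    (ht₀ : t₀ ∈ Ioo a b)
    (h₀ : (ys * Real.exp t₀) ^ 2 * (v t₀).2.2 = γ * (v t₀).1 ^ (γ - 1)) :
    ∀ t ∈ Ioo a b, (ys * Real.exp t) ^ 2 * (v t).2.2 = γ * (v t).1 ^ (γ - 1) := by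
  let f : ℝ → ℝ := fun t => (ys * Real.exp t) ^ 2 * (v t).2.2 * (v t).1 ^ (-(γ - 1))
  have hf : ∀ t ∈ Ioo a b, HasDerivAt f 0 t := fun t ht => by
    obtain ⟨hd, hp⟩ := hv t ht
    have h1 : HasDerivAt (fun s => (v s).1) ((v t).1 * R t) t :=
      (ContinuousLinearMap.fst ℝ ℝ (ℝ × ℝ)).hasFDerivAt.comp_hasDerivAt t hd
    have h2 : HasDerivAt (fun s => (v s).2.2) ((v t).2.2 * ((γ - 1) * R t - 2)) t :=
      (ContinuousLinearMap.snd ℝ ℝ ℝ ∘L .snd ℝ ℝ (ℝ × ℝ)).hasFDerivAt.comp_hasDerivAt t hd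
    refine ((((hasDerivAt_mul_exp ys t).fun_pow 2).fun_mul h2).fun_mul
      (h1.rpow_const (p := -(γ - 1)) (Or.inl hp.ne'))).congr_deriv ?_
    rw [Real.rpow_sub_one hp.ne']
    have := hp.ne'
    field_simp
    push_cast
    ring
  intro t ht
  have hc : f t = f t₀ := isOpen_Ioo.is_const_of_deriv_eq_zero isPreconnected_Ioo
    (fun s hs => (hf s hs).differentiableAt.differentiableWithinAt)
    (fun s hs => (hf s hs).deriv) ht ht₀
  have e : ∀ s ∈ Ioo a b, f s * (v s).1 ^ (γ - 1) = (ys * Real.exp s) ^ 2 * (v s).2.2 :=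
    fun s hs => by
      have := (hv s hs).2
      simp only [f]
      rw [mul_assoc, ← Real.rpow_add this]
      simp
  have hp₀ := Real.rpow_pos_of_pos (hv t₀ ht₀).2 (γ - 1)
  have h2 : f t₀ = γ := by
    refine mul_right_cancel₀ hp₀.ne' ?_
    rw [e t₀ ht₀, h₀]
  rw [← e t ht, hc, h2]

theorem IsLPHType.congr {γ ys : ℝ} {ρ ω ρ' ω' : ℝ → ℝ} (L : IsLPHType γ ys ρ ω)
    (h1 : ρ' =ᶠ[𝓝 ys] ρ) (h2 : ω' =ᶠ[𝓝 ys] ω) : IsLPHType γ ys ρ' ω' where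
  analytic_rho := L.analytic_rho.congr h1.symm
  analytic_omega := L.analytic_omega.congr h2.symm
  rho_pos := by rw [h1.eq_of_nhds]; exact L.rho_pos
  sonic := by rw [h1.eq_of_nhds, h2.eq_of_nhds]; exact L.sonic
  constraint := by rw [h1.eq_of_nhds, h2.eq_of_nhds]; exact L.constraint
  deriv_rho := by rw [h1.deriv_eq, h1.eq_of_nhds, h2.eq_of_nhds]; exact L.deriv_rho
  deriv_omega := by rw [h2.deriv_eq, h2.eq_of_nhds]; exact L.deriv_omega
  solves := by
    filter_upwards [L.solves, h1.eventuallyEq_nhds, h2.eventuallyEq_nhds] with y hy e1 e2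
    unfold SolvesMulAt
    rw [e1.deriv_eq, e2.deriv_eq, e1.eq_of_nhds, e2.eq_of_nhds]
    exact hy

theorem hasDerivAt_log_div {ys y : ℝ} (hys : 0 < ys) (hy : 0 < y) :
    HasDerivAt (fun y => Real.log (y / ys)) (1 / y) y := by
  refine (((hasDerivAt_id y).div_const ys).log (div_pos hy hys).ne').congr_deriv ?_
  simp only [id]
  field_simp

theorem mul_exp_log_div {ys y : ℝ} (hys : 0 < ys) (hy : 0 < y) :
    ys * Real.exp (Real.log (y / ys)) = y := by
  rw [Real.exp_log (div_pos hy hys)]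
  field_simp

namespace IsSonicFamily

variable {γ r w : ℝ} {U : ℝ → ℝ → ℝ × ℝ × ℝ} {S : ℝ → ℝ → ℝ}

theorem sq_mul_eq (hγ : γ ∈ Ioo (1 : ℝ) (4 / 3)) (H : IsSonicFamily γ r U S)
    (hw : w ∈ Icc (omegaF γ) (2 - γ)) :
    ∀ t ∈ Ioo (-r) r, (yS γ w * Real.exp t) ^ 2 * (U w t).2.2 = γ * (U w t).1 ^ (γ - 1) := by
  have hr := H.r_pos
  have hw0 : 0 < w := (omegaF_pos hγ).trans_le hw.1
  refine sq_mul_eq_of_slopeField (R := S w)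
    (fun t ht => ⟨H.ode w hw t ht, H.rho_pos w hw t ht⟩) (t₀ := 0) ⟨by linarith, hr⟩ ?_
  rw [H.init w hw]
  simpa using yS_sq hγ hw0

theorem isLPHType (hγ : γ ∈ Ioo (1 : ℝ) (4 / 3)) (H : IsSonicFamily γ r U S)
    (hw : w ∈ Icc (omegaF γ) (2 - γ)) :
    IsLPHType γ (yS γ w) (fun y => (U w (Real.log (y / yS γ w))).1)
      (fun y => (U w (Real.log (y / yS γ w))).2.1) := by
  have hr := H.r_pos
  have hw0 : 0 < w := (omegaF_pos hγ).trans_le hw.1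
  have hsq := H.sq_mul_eq hγ hw
  set ys := yS γ w with hys
  have hy0 : 0 < ys := yS_pos hγ hw0
  have e0 : Real.log (ys / ys) = 0 := by rw [div_self hy0.ne', Real.log_one]
  have hlog : AnalyticAt ℝ (fun y => Real.log (y / ys)) ys := by
    have h1 : AnalyticAt ℝ (fun y : ℝ => y / ys) ys := by fun_prop
    exact h1.log (div_pos hy0 hy0)
  have hd : ∀ y, 0 < y → Real.log (y / ys) ∈ Ioo (-r) r →
      HasDerivAt (fun y => (U w (Real.log (y / ys))).1)
        ((U w (Real.log (y / ys))).1 * S w (Real.log (y / ys)) / y) y ∧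
      HasDerivAt (fun y => (U w (Real.log (y / ys))).2.1)
        (relVel γ (U w (Real.log (y / ys))).2.1 (S w (Real.log (y / ys))) / y) y :=
    fun y hy ht => by
      have hU := H.ode w hw _ ht
      have h1 : HasDerivAt (fun t => (U w t).1) _ _ :=
        (ContinuousLinearMap.fst ℝ ℝ (ℝ × ℝ)).hasFDerivAt.comp_hasDerivAt _ hU
      have h2 : HasDerivAt (fun t => (U w t).2.1) _ _ :=
        (ContinuousLinearMap.fst ℝ ℝ ℝ ∘L .snd ℝ ℝ (ℝ × ℝ)).hasFDerivAt.comp_hasDerivAt _ hU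
      have hl := hasDerivAt_log_div hy0 hy
      have h3 := h1.comp y hl
      have h4 := h2.comp y hl
      refine ⟨h3.congr_deriv ?_, h4.congr_deriv ?_⟩
      · simp [slopeField]; ring
      · simp [slopeField]; ring
  have hys' : Real.log (ys / ys) ∈ Ioo (-r) r := by rw [e0]; exact ⟨by linarith, hr⟩
  refine ⟨?_, ?_, ?_, ?_, ?_, ?_, ?_, ?_⟩
  · have := H.analytic_rho w hw
    rw [← e0] at this
    exact this.comp (f := fun y => Real.log (y / ys)) hlog
  · have := H.analytic_omega w hw
    rw [← e0] at this
    exact this.comp (f := fun y => Real.log (y / ys)) hlog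
  · simp only [e0, H.init w hw]; exact rhoS_pos hγ hw0
  · simp only [e0, H.init w hw]
    unfold G
    rw [← yS_sq hγ hw0]
    ring
  · simp only [e0, H.init w hw]; exact h_rhoS hγ hw0.ne'
  · rw [(hd ys hy0 hys').1.deriv]
    simp only [e0, H.init w hw, H.init_slope w hw]
  · rw [(hd ys hy0 hys').2.deriv]
    simp only [e0, H.init w hw, H.init_slope w hw]
    rfl
  · have h1 : ∀ᶠ y in 𝓝 ys, Real.log (y / ys) ∈ Ioo (-r) r :=
      hlog.continuousAt.eventually (isOpen_Ioo.mem_nhds hys')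
    filter_upwards [h1, lt_mem_nhds hy0] with y hy hy1
    have hg := H.slope w hw _ hy
    have hq := hsq _ hy
    rw [mul_exp_log_div hy0 hy1] at hq
    obtain ⟨d1, d2⟩ := hd y hy1 hy
    have hG : G γ y (U w (Real.log (y / ys))).1 (U w (Real.log (y / ys))).2.1 =
        y ^ 2 * ((U w (Real.log (y / ys))).2.2 - (U w (Real.log (y / ys))).2.1 ^ 2) := by
      unfold G; rw [← hq]; ring
    unfold SolvesMulAt
    rw [d1.deriv, d2.deriv, hG, ← hg]
    unfold relVel
    have := hy1.ne'
    constructor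
    · field_simp
    · field_simp

/-- Functions of `y` obtained from an orbit. -/
theorem isSubsonicExtension (hγ : γ ∈ Ioo (1 : ℝ) (4 / 3)) (H : IsSonicFamily γ r U S)
    (hw : w ∈ Icc (omegaF γ) (2 - γ)) {a : ℝ} {u : ℝ → ℝ × ℝ × ℝ} (ha : 0 ≤ a)
    (hu : ∀ t < 0, a < yS γ w * Real.exp t → ∃ T < t, IsOrbit γ r U w T u)
    (heq : EqOn u (U w) (Icc (-(r / 2)) 0)) :
    ∃ ρ ω : ℝ → ℝ, IsSubsonicExtension γ (yS γ w) a ρ ω ∧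
      ∀ y ∈ Ioo a (yS γ w), ω y = (u (Real.log (y / yS γ w))).2.1 := by
  have hr := H.r_pos
  have hw0 : 0 < w := (omegaF_pos hγ).trans_le hw.1
  have hsq := H.sq_mul_eq hγ hw
  have hL := H.isLPHType hγ hw
  set ys := yS γ w with hys
  have hy0 : 0 < ys := yS_pos hγ hw0
  -- The orbit is prescribed only up to the sonic time. Continuing it by `U w` for t ≥ 0 makes the
  -- functions of y analytic at the sonic point.
  let v : ℝ → ℝ × ℝ × ℝ := fun t => if t < 0 then u t else U w t
  have hvu : ∀ t < 0, v t = u t := fun t ht => by simp only [v, ht, if_true]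
  have hvU : ∀ t, -(r / 2) ≤ t → v t = U w t := fun t ht => by
    by_cases h : t < 0
    · simp only [v, h, if_true]; exact heq ⟨ht, h.le⟩
    · simp only [v, h, if_false]
  have hev : ∀ᶠ y in 𝓝 ys, v (Real.log (y / ys)) = U w (Real.log (y / ys)) := by
    have hc : ContinuousAt (fun y => Real.log (y / ys)) ys :=
      (hasDerivAt_log_div hy0 hy0).continuousAt
    have e0 : Real.log (ys / ys) = 0 := by rw [div_self hy0.ne', Real.log_one]
    have h1 : -(r / 2) < Real.log (ys / ys) := by rw [e0]; linarith
    filter_upwards [hc.eventually (lt_mem_nhds h1)] with y hy using hvU _ hy.le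
  have hlt : ∀ y ∈ Ioo a ys, Real.log (y / ys) < 0 := fun y hy =>
    Real.log_neg (div_pos (ha.trans_lt hy.1) hy0) ((div_lt_one hy0).mpr hy.2)
  have key : ∀ y ∈ Ioo a ys, SolvesAt γ (fun y => (v (Real.log (y / ys))).1)
      (fun y => (v (Real.log (y / ys))).2.1) y ∧
      0 < G γ y (v (Real.log (y / ys))).1 (v (Real.log (y / ys))).2.1 := by
    intro y hy
    have hypos : 0 < y := ha.trans_lt hy.1
    have ht := hlt y hy
    have hexp := mul_exp_log_div hy0 hypos
    set t := Real.log (y / ys) with ht_def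
    obtain ⟨T, hTt, ho⟩ := hu t ht (by rw [hexp]; exact hy.1)
    have htI : t ∈ Ioo T 0 := ⟨hTt, ht⟩
    have hmem := (ho.solves t htI).2
    have hq : y ^ 2 * (u t).2.2 = γ * (u t).1 ^ (γ - 1) := by
      have h0 : -(r / 2) ∈ Icc (-(r / 2)) 0 := ⟨le_rfl, by linarith⟩
      have := sq_mul_eq_of_slopeField (R := fun s => rate γ (u s))
        (fun s hs => ⟨(ho.solves s hs).1, (ho.solves s hs).2.1⟩)
        (t₀ := -(r / 2)) ⟨ho.lt, by linarith⟩
        (by rw [ho.eq h0]; exact hsq _ ⟨by linarith, by linarith⟩) t htI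
      rwa [hexp] at this
    have hg := gap_mul_rate (γ := γ) hmem
    have hG : G γ y (u t).1 (u t).2.1 = y ^ 2 * ((u t).2.2 - (u t).2.1 ^ 2) := by
      unfold G; rw [← hq]; ring
    have hgap : 0 < (u t).2.2 - (u t).2.1 ^ 2 := sub_pos.mpr hmem.2
    have hl := hasDerivAt_log_div hy0 hypos
    have hevy : ∀ᶠ z in 𝓝 y, v (Real.log (z / ys)) = u (Real.log (z / ys)) := by
      filter_upwards [hl.continuousAt.eventually (gt_mem_nhds ht)] with z hz using hvu _ hz
    have h1 := (ho.solves.hasDerivAt_rho htI).comp y hl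
    have h2 := (ho.solves.hasDerivAt_omega htI).comp y hl
    unfold SolvesAt
    simp only [← ht_def, hvu t ht, hG, ← hg]
    refine ⟨⟨?_, ?_⟩, by positivity⟩
    · refine (h1.congr_of_eventuallyEq (hevy.mono fun z hz => ?_)).congr_deriv ?_
      · simp only [Function.comp, hz]
      · have := hgap.ne'
        field_simp
    · refine (h2.congr_of_eventuallyEq (hevy.mono fun z hz => ?_)).congr_deriv ?_
      · simp only [Function.comp, hz]
      · have := hgap.ne'
        unfold vel relVel
        field_simp
  refine ⟨fun y => (v (Real.log (y / ys))).1, fun y => (v (Real.log (y / ys))).2.1,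
    ⟨hL.congr (hev.mono fun y hy => ?_) (hev.mono fun y hy => ?_),
      fun y hy => (key y hy).1, fun y hy => (key y hy).2⟩, fun y hy => ?_⟩
  · simp only [hy]
  · simp only [hy]
  · simp only [hvu _ (hlt y hy)]

end IsSonicFamily

/-! ### Maximal solutions and the critical sonic point -/

namespace IsSonicFamily

variable {γ r w : ℝ} {U : ℝ → ℝ → ℝ × ℝ × ℝ} {S : ℝ → ℝ → ℝ}

theorem eqOn_of_eventuallyEq (H : IsSonicFamily γ r U S) {T T' : ℝ} {u v : ℝ → ℝ × ℝ × ℝ}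
    (ho : IsOrbit γ r U w T u) (hv : SolvesOn (field γ) subsonicRegion T' 0 v) (hT' : T' < 0)
    (hg : ∀ᶠ t in 𝓝[<] 0, v t = U w t) : EqOn v u (Ioo (max T T') 0) := by
  have hr := H.r_pos
  have hlt : max (max T T') (-(r / 2)) < 0 :=
    max_lt (max_lt (ho.lt.trans (by linarith)) hT') (by linarith)
  obtain ⟨s, hs, hsI⟩ := (hg.and (Ioo_mem_nhdsLT hlt)).exists
  refine (hv.mono (le_max_right T T') le_rfl).eqOn isOpen_subsonicRegion (contDiffOn_field γ)
    (ho.solves.mono (le_max_left T T') le_rfl) ⟨(le_max_left _ _).trans_lt hsI.1, hsI.2⟩ ?_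
  rw [hs, ho.eq ⟨((le_max_right _ _).trans_lt hsI.1).le, hsI.2.le⟩]

variable {a : ℝ} {ρ ω : ℝ → ℝ}

theorem eventually_pullback_eq (hγ : γ ∈ Ioo (1 : ℝ) (4 / 3)) (H : IsSonicFamily γ r U S)
    (hw : w ∈ Icc (omegaF γ) (2 - γ)) (E : IsSubsonicExtension γ (yS γ w) a ρ ω)
    (ha : a < yS γ w) : ∀ᶠ t in 𝓝[<] 0, pullback γ (yS γ w) ρ ω t = U w t :=
  (((E.germ hγ ((omegaF_pos hγ).trans_le hw.1) ha).eventually_eq hγ hw (H.sonicGerm hw)).mono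
    fun _ h => h.1).filter_mono (nhdsWithin_mono 0 Iio_subset_Iic_self)

/-- Uniqueness at the sonic point makes any subsonic extension agree with the orbit where both are
defined. What is proved for one orbit thus holds for every representative pair (ρ, ω). -/
theorem pullback_eq_orbit (hγ : γ ∈ Ioo (1 : ℝ) (4 / 3)) (H : IsSonicFamily γ r U S)
    (hw : w ∈ Icc (omegaF γ) (2 - γ)) (E : IsSubsonicExtension γ (yS γ w) a ρ ω)
    {T t : ℝ} {u : ℝ → ℝ × ℝ × ℝ} (ho : IsOrbit γ r U w T u) (ht : t ∈ Ioo T 0)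
    (hat : a < yS γ w * Real.exp t) : pullback γ (yS γ w) ρ ω t = u t := by
  have hy0 := yS_pos hγ ((omegaF_pos hγ).trans_le hw.1)
  have ha : a < yS γ w := by
    have := Real.exp_lt_one_iff.mpr ht.2
    nlinarith
  have h1 : ∀ᶠ s in 𝓝[<] t, a < yS γ w * Real.exp s :=
    ((hasDerivAt_mul_exp (yS γ w) t).continuousAt.eventually (lt_mem_nhds hat)).filter_mono
      nhdsWithin_le_nhds
  obtain ⟨T', h2, h3⟩ := (h1.and self_mem_nhdsWithin).exists
  have h3 : T' < t := h3
  exact H.eqOn_of_eventuallyEq ho (E.solvesOn hγ hy0 h2.le) (h3.trans ht.2)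
    (H.eventually_pullback_eq hγ hw E ha) ⟨max_lt ht.1 h3, ht.2⟩

theorem isOrbit_pullback (hγ : γ ∈ Ioo (1 : ℝ) (4 / 3)) (H : IsSonicFamily γ r U S)
    (hw : w ∈ Icc (omegaF γ) (2 - γ)) (E : IsSubsonicExtension γ (yS γ w) a ρ ω)
    {T : ℝ} (hT : T < -(r / 2)) (ha : a ≤ yS γ w * Real.exp T) :
    IsOrbit γ r U w T (pullback γ (yS γ w) ρ ω) := by
  have hr := H.r_pos
  have hw0 := (omegaF_pos hγ).trans_le hw.1
  have hy0 := yS_pos hγ hw0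
  have hT0 : T < 0 := by linarith
  have ha' : a < yS γ w := by
    have := Real.exp_lt_one_iff.mpr hT0
    nlinarith
  have hs := E.solvesOn hγ hy0 ha
  refine ⟨hT, fun t ht => ?_, hs⟩
  rcases ht.2.eq_or_lt with h | h
  · rw [h, (E.germ hγ hw0 ha').init, H.init w hw]
  · exact H.eqOn_of_eventuallyEq (H.isOrbit hw) hs hT0 (H.eventually_pullback_eq hγ hw E ha')
      ⟨max_lt (by linarith [ht.1]) (hT.trans_le ht.1), h⟩

theorem exists_extension_of_orbit (hγ : γ ∈ Ioo (1 : ℝ) (4 / 3)) (H : IsSonicFamily γ r U S)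
    (hw : w ∈ Icc (omegaF γ) (2 - γ)) {T : ℝ} {u : ℝ → ℝ × ℝ × ℝ} (ho : IsOrbit γ r U w T u) :
    yS γ w * Real.exp T ∈ {y | y ∈ Ioo 0 (yS γ w) ∧
      ∃ ρ ω : ℝ → ℝ, IsSubsonicExtension γ (yS γ w) y ρ ω} := by
  have hr := H.r_pos
  have hy0 := yS_pos hγ ((omegaF_pos hγ).trans_le hw.1)
  have hT0 : T < 0 := ho.lt.trans (by linarith)
  obtain ⟨ρ, ω, h, -⟩ := H.isSubsonicExtension hγ hw (a := yS γ w * Real.exp T) (by positivity)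
    (u := u) (fun t _ h => ⟨T, Real.exp_lt_exp.mp (lt_of_mul_lt_mul_left h hy0.le), ho⟩) ho.eq
  refine ⟨⟨by positivity, ?_⟩, ρ, ω, h⟩
  have := Real.exp_lt_one_iff.mpr hT0
  nlinarith

theorem sonicTime_le (hγ : γ ∈ Ioo (1 : ℝ) (4 / 3)) (H : IsSonicFamily γ r U S)
    (hw : w ∈ Icc (omegaF γ) (2 - γ)) {T : ℝ} {u : ℝ → ℝ × ℝ × ℝ} (ho : IsOrbit γ r U w T u) :
    sonicTime γ (yS γ w) ≤ yS γ w * Real.exp T :=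
  csInf_le ⟨0, fun _ hy => hy.1.1.le⟩ (H.exists_extension_of_orbit hγ hw ho)

/-- The infimum defining `sonicTime` is attained: all orbits with the same w agree where they
overlap, so one glued curve serves every admissible left end. -/
theorem exists_maximal (hγ : γ ∈ Ioo (1 : ℝ) (4 / 3)) (H : IsSonicFamily γ r U S)
    (hw : w ∈ Icc (omegaF γ) (2 - γ)) : ∃ ρ ω : ℝ → ℝ, IsMaximalLPH γ (yS γ w) ρ ω := by
  have hr := H.r_pos
  have hy0 := yS_pos hγ ((omegaF_pos hγ).trans_le hw.1)
  set A := {T | ∃ u, IsOrbit γ r U w T u} with hA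
  obtain ⟨u, hu⟩ := H.exists_glued (w := w) A fun T hT => hT
  have hrA : -r ∈ A := ⟨U w, H.isOrbit hw⟩
  have hside : ∀ t < 0, sonicTime γ (yS γ w) < yS γ w * Real.exp t →
      ∃ T < t, IsOrbit γ r U w T u := fun t ht hlt => by
    obtain ⟨y, ⟨hyI, ρ, ω, E⟩, hyt⟩ :=
      exists_lt_of_csInf_lt ⟨_, H.exists_extension_of_orbit hγ hw (H.isOrbit hw)⟩ hlt
    have he := mul_exp_log_div hy0 hyI.1
    have hlt' : Real.log (y / yS γ w) < t := by
      rw [← he] at hyt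
      exact Real.exp_lt_exp.mp (lt_of_mul_lt_mul_left hyt hy0.le)
    rcases lt_or_ge (Real.log (y / yS γ w)) (-(r / 2)) with h | h
    · exact ⟨_, hlt', hu _ ⟨_, H.isOrbit_pullback hγ hw E h he.ge⟩⟩
    · exact ⟨-r, by linarith, hu _ hrA⟩
  obtain ⟨ρ, ω, h, -⟩ := H.isSubsonicExtension hγ hw (Real.sInf_nonneg fun _ hy => hy.1.1.le)
    hside (hu _ hrA).eq
  exact ⟨ρ, ω, h⟩

/-- A crossing orbit has ω < ω_F at some time, while ω tends to w > ω_F at the sonic point. The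
intermediate value theorem gives the value ω_F in between. -/
theorem exists_eq_omegaF_of_crosses (hγ : γ ∈ Ioo (1 : ℝ) (4 / 3)) (H : IsSonicFamily γ r U S)
    (hw : w ∈ Ioc (omegaF γ) (2 - γ)) (hc : Crosses γ r U w) :
    ∃ ρ ω : ℝ → ℝ, IsMaximalLPH γ (yS γ w) ρ ω ∧
      ∃ y ∈ Ioo (sonicTime γ (yS γ w)) (yS γ w), ω y = omegaF γ := by
  have hwC := Ioc_subset_Icc_self hw
  have hy0 := yS_pos hγ ((omegaF_pos hγ).trans_le hwC.1)
  obtain ⟨T, u, t, ho, ht, -, hlt⟩ := hc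
  obtain ⟨ρ, ω, hM⟩ := H.exists_maximal hγ hwC
  have h1 : ∀ᶠ s in 𝓝[<] 0, omegaF γ < (u s).2.1 :=
    (((continuous_fst.comp continuous_snd).tendsto _).comp
      (H.tendsto_orbit hwC ho)).eventually (lt_mem_nhds hw.1)
  obtain ⟨s, hs, hsI⟩ := (h1.and (Ioo_mem_nhdsLT ht.2)).exists
  have hcont : ContinuousOn (fun x => (u x).2.1) (Icc t s) := fun x hx =>
    (ho.solves.hasDerivAt_omega ⟨ht.1.trans_le hx.1,
      hx.2.trans_lt hsI.2⟩).continuousAt.continuousWithinAt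
  obtain ⟨x, hx, hxe⟩ := intermediate_value_Icc hsI.1.le hcont ⟨hlt.le, hs.le⟩
  have hxI : x ∈ Ioo T 0 := ⟨ht.1.trans_le hx.1, hx.2.trans_lt hsI.2⟩
  have hst : sonicTime γ (yS γ w) < yS γ w * Real.exp x := by
    refine (H.sonicTime_le hγ hwC ho).trans_lt ?_
    have := Real.exp_lt_exp.mpr hxI.1
    gcongr
  refine ⟨ρ, ω, hM, yS γ w * Real.exp x, ⟨hst, ?_⟩, ?_⟩
  · have := Real.exp_lt_one_iff.mpr hxI.2
    nlinarith
  · have := H.pullback_eq_orbit hγ hwC hM ho hxI hst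
    rw [← hxe]
    simp only
    rw [← this]
    rfl

end IsSonicFamily

theorem exists_yS_eq {γ : ℝ} (hγ : γ ∈ Ioo (1 : ℝ) (4 / 3)) {y : ℝ} (hy : y ∈ Icc (yf γ) (yF γ)) :
    ∃ w ∈ Icc (omegaF γ) (2 - γ), yS γ w = y := by
  have ha := omegaF_pos hγ
  have hc : ContinuousOn (yS γ) (Icc (omegaF γ) (2 - γ)) :=
    (continuousOn_yS hγ).mono fun x hx => ha.trans_le hx.1
  rw [← yS_far hγ, ← yS_omegaF hγ] at hy
  exact intermediate_value_Icc' (omegaF_lt hγ).le hc hy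

end SelfSimilarEP

end

/-! ### The critical sonic point and the main theorem. -/

open SelfSimilarEP

theorem proposition4 (γ : ℝ) (hγ : γ ∈ Set.Ioo (1 : ℝ) (4 / 3)) :
    -- the critical solution exists on the whole of `(0, inf Y]`
    0 < SelfSimilarEP.criticalPoint γ ∧
    SelfSimilarEP.sonicTime γ (SelfSimilarEP.criticalPoint γ) = 0 ∧
    (∃ ρ ω : ℝ → ℝ, SelfSimilarEP.IsMaximalLPH γ (SelfSimilarEP.criticalPoint γ) ρ ω) ∧
    -- and has the following properties
    ∀ ρ ω : ℝ → ℝ, SelfSimilarEP.IsMaximalLPH γ (SelfSimilarEP.criticalPoint γ) ρ ω →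
      (∀ y ∈ Set.Ioo 0 (SelfSimilarEP.criticalPoint γ), 0 < deriv ω y) ∧
      Filter.Tendsto ω (nhdsWithin 0 (Set.Ioi 0)) (nhds ((4 - 3 * γ) / 3)) ∧
      (∀ y ∈ Set.Ioo 0 (SelfSimilarEP.criticalPoint γ), deriv ρ y < 0) ∧
      Filter.Tendsto (deriv ρ) (nhdsWithin 0 (Set.Ioi 0)) (nhds 0) ∧
      Filter.Tendsto (deriv ω) (nhdsWithin 0 (Set.Ioi 0)) (nhds 0) ∧
      HasDerivWithinAt (Function.update ω 0 ((4 - 3 * γ) / 3)) 0 (Set.Ici 0) 0 ∧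
      ∃ ρ₀ : ℝ, 1 / (6 * Real.pi) < ρ₀ ∧
        Filter.Tendsto ρ (nhdsWithin 0 (Set.Ioi 0)) (nhds ρ₀) ∧
        HasDerivWithinAt (Function.update ρ 0 ρ₀) 0 (Set.Ici 0) 0 ∧
        ContDiffOn ℝ 2 (Function.update ρ 0 ρ₀)
          (Set.Icc 0 (SelfSimilarEP.criticalPoint γ)) := by
  obtain ⟨r, U, S, H⟩ := exists_isSonicFamily hγ
  obtain ⟨w, hw, hcross, u, hu, hpu⟩ := H.exists_global_orbit hγ
  have hr := H.r_pos
  have ha := omegaF_pos hγ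
  have hwC := Ioo_subset_Icc_self hw
  have hw0 : 0 < w := ha.trans hw.1
  have hy0 := yS_pos hγ hw0
  have hanti := yS_strictAnti hγ
  have hb0 : 0 < 2 - γ := hw0.trans hw.2
  have hyF : yS γ w < yF γ := by
    rw [← yS_omegaF hγ]; exact hanti ha hw0 hw.1
  have hyf : yf γ < yS γ w := by
    rw [← yS_far hγ]; exact hanti hw0 hb0 hw.2
  have hlog : ∀ y ∈ Ioo 0 (yS γ w), Real.log (y / yS γ w) < 0 := fun y hy =>
    Real.log_neg (div_pos hy.1 hy0) ((div_lt_one hy0).mpr hy.2)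
  -- maximal solutions at the critical point are given by the global orbit
  have hpull : ∀ ρ ω a, 0 ≤ a → IsSubsonicExtension γ (yS γ w) a ρ ω → ∀ y ∈ Ioo a (yS γ w),
      pullback γ (yS γ w) ρ ω (Real.log (y / yS γ w)) = u (Real.log (y / yS γ w)) :=
    fun ρ ω a ha0 E y hy => by
      have hy' : y ∈ Ioo 0 (yS γ w) := ⟨ha0.trans_lt hy.1, hy.2⟩
      obtain ⟨T, hT⟩ := exists_lt (min (Real.log (y / yS γ w)) (-(r / 2)))
      refine H.pullback_eq_orbit hγ hwC E (hu T (hT.trans_le (min_le_right _ _)))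
        ⟨hT.trans_le (min_le_left _ _), hlog y hy'⟩ ?_
      rw [mul_exp_log_div hy0 hy'.1]
      exact hy.1
  -- The left end is excluded because the critical orbit stays strictly above ω_F. Any smaller y_*
  -- fails as well, since membership in Y would impose the Friedman value on the critical solution
  -- too. Larger y_* correspond to w' < w, which cross.
  have hset : fundamentalSet γ = Ioo (yS γ w) (yF γ) := by
    ext y
    constructor
    · rintro ⟨hy, hall⟩
      refine ⟨?_, hy.2⟩
      by_contra! hle
      obtain ⟨ρ, ω, hM, z, hz, hze⟩ := hall (yS γ w) ⟨hle, hyF⟩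
      have hs0 : 0 ≤ sonicTime γ (yS γ w) := Real.sInf_nonneg fun _ hy => hy.1.1.le
      have hz0 : z ∈ Ioo 0 (yS γ w) := ⟨hs0.trans_lt hz.1, hz.2⟩
      have h1 := hpull ρ ω _ hs0 hM z hz
      have h2 := (hpu _ (hlog z hz0)).2.1
      rw [← h1] at h2
      simp only [pullback, mul_exp_log_div hy0 hz0.1, hze] at h2
      exact h2.false
    · intro hy
      refine ⟨⟨(hyf.trans hy.1).le, hy.2⟩, fun z hz => ?_⟩
      have hwz : yS γ w < z := hy.1.trans_le hz.1
      obtain ⟨w', hw', rfl⟩ := exists_yS_eq hγ (y := z) ⟨(hyf.trans hwz).le, hz.2.le⟩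
      have hw'0 : 0 < w' := ha.trans_le hw'.1
      have h1 : w' < w := (hanti.lt_iff_gt hw0 hw'0).mp hwz
      have h2 : omegaF γ < w' := by
        have := hz.2
        rw [← yS_omegaF hγ] at this
        exact (hanti.lt_iff_gt hw'0 ha).mp this
      exact H.exists_eq_omegaF_of_crosses hγ ⟨h2, hw'.2⟩ (hcross w' ⟨h2.le, h1⟩)
  have hcrit : criticalPoint γ = yS γ w := by
    unfold criticalPoint
    rw [hset, csInf_Ioo hyF]
  have hsonic : sonicTime γ (yS γ w) = 0 := by
    refine le_antisymm (le_of_forall_gt fun ε hε => ?_)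
      (Real.sInf_nonneg fun _ hy => hy.1.1.le)
    have h1 : Tendsto (fun T => yS γ w * Real.exp T) atBot (𝓝 0) := by
      simpa using Real.tendsto_exp_atBot.const_mul (yS γ w)
    obtain ⟨T, hT, hT'⟩ := ((h1.eventually (gt_mem_nhds hε)).and
      (eventually_lt_atBot (-(r / 2)))).exists
    exact (H.sonicTime_le hγ hwC (hu T hT')).trans_lt hT
  rw [hcrit]
  refine ⟨hy0, hsonic, H.exists_maximal hγ hwC, fun ρ ω hM => ?_⟩
  have hE : IsSubsonicExtension γ (yS γ w) 0 ρ ω := by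
    have := hM
    unfold IsMaximalLPH at this
    rwa [hsonic] at this
  have hval : ∀ y ∈ Ioo 0 (yS γ w), ω y = (u (Real.log (y / yS γ w))).2.1 ∧
      logSlope γ ρ ω y = rate γ (u (Real.log (y / yS γ w))) := fun y hy => by
    have h1 := hpull ρ ω 0 le_rfl hE y hy
    have h2 := sq_mul_gap_pullback (γ := γ) (ρ := ρ) (ω := ω) (t := Real.log (y / yS γ w)) hy0
    rw [mul_exp_log_div hy0 hy.1] at h2
    rw [← h1]
    refine ⟨by simp only [pullback, mul_exp_log_div hy0 hy.1], ?_⟩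
    unfold logSlope rate
    rw [← h2, mul_div_mul_left _ _ (pow_pos hy.1 2).ne']
    simp only [pullback, mul_exp_log_div hy0 hy.1]
  have hF : IsMonotoneFlow γ (yS γ w) w ρ ω := by
    refine ⟨hy0, hE.solves, hE.subsonic, fun y hy => hE.rho_pos hγ (Ioo_subset_Ioc_self hy),
      fun y hy => ?_, fun y hy => ?_, fun y hy => ?_⟩
    · rw [(hval y hy).1, (hval y hy).2]; exact (hpu _ (hlog y hy)).1
    · rw [(hval y hy).1]; exact (hpu _ (hlog y hy)).2.1
    · rw [(hval y hy).1]; exact (hpu _ (hlog y hy)).2.2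
  exact hF.regular_origin hγ hw.2 hE.lph.analytic_rho
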